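/- **Definitions.** Composition is written in diagrammatic order. *Restriction side.* A *restriction category* is a category with an assignment $(f\colon A\to B)\mapsto(\bar f\colon A\to A)$ such that $\bar f f=f$; $\bar f\bar g=\bar g\bar f$ and $\bar g\bar f=\overline{\bar g f}$ for $f,g$ with the same domain; $f\bar g=\overline{fg}\,f$ for composable $f,g$. A morphism $f$ is *total* if $\bar f=\mathrm{id}$. $\mathsf{RCat}_{\mathsf{lax}}$ is the 2-category of restriction categories, restriction functors ($F\bar f=\overline{Ff}$), and restriction natural transformations (families of total morphisms $\varphi_A\colon FA\to GA$ with $(Ff)\varphi_B=(F\bar f)\varphi_A(Gf)$). A *restriction terminal object* is an object $*$ such that each $A$ has a unique total morphism $!_A\colon A\to *$, and $f\,!_B=\bar f\,!_A$ for all $f\colon A\to B$. A *restriction product* of $A,B$ is an object $P$ with total $\pi_A\colon P\to A$, $\pi_B\colon P\to B$ such that for all $f\colon C\to A$, $g\colon C\to B$ there is a unique $h\colon C\to P$ with $h\pi_A=\bar g f$, $h\pi_B=\bar f g$. A restriction category is *Cartesian* if it has a restriction terminal object and all binary restriction products. $\mathsf{cRCat}_{\mathsf{lax}}\subseteq\mathsf{RCat}_{\mathsf{lax}}$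 is the locally full 2-subcategory of Cartesian restriction categories and restriction functors preserving restriction terminal objects and restriction products. *Local side.* A *local category* is a category with an object $\mathsf LM$ and a monomorphism $\eta_M\colon M\to\mathsf LM$ for each object $M$, such that $\mathsf L\mathsf LM=\mathsf LM$ and $\eta_{\mathsf LM}=\mathrm{id}$, and such that for every $f\colon N\to\mathsf LM$ there is a pullback $P$ of $\eta_M$ along $f$, with projection $m\colon P\to N$, for which $\mathsf LP=\mathsf LN$ and $m\eta_N=\eta_P$. An object $M$ is *total* if $M=\mathsf LM$ and $\eta_M=\mathrm{id}$. A *local functor* is a functor $F$ with $F\mathsf LM=\mathsf LFM$, $F\eta_M=\eta_{FM}$ that preserves all pullbacks of the $\eta_M$ along arbitrary morphisms. $\mathsf{LCat}_{\mathsf{lax}}$ is the 2-category of local categories, local functors and all natural transformations. A *local terminal object* is a total terminal object. A *local product* of $M,N$ is a product $(M\times N,\pi_M,\pi_N)$ such that $\mathsf L(M\times N)$ is a product of $\mathsf LM$ and $\mathsf LN$ for which $\eta_{M\times N}=\eta_M\times\eta_N$. A local category is *Cartesian* if it has a local terminal object and local products of all pairs of objects. $\mathsf{cLCat}_{\mathsf{lax}}\subseteq\mathsf{LCat}_{\mathsf{lax}}$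 is the locally full 2-subcategory of Cartesian local categories and local functors preserving local terminal objects and local products. *The 2-functors.* $\mathbf L\colon\mathsf{RCat}_{\mathsf{lax}}\to\mathsf{LCat}_{\mathsf{lax}}$ sends $\mathbb X$ to the category of pairs $(A,a)$ with $a=\bar a\colon A\to A$, whose morphisms $(A,a)\to(B,b)$ are the $f\colon A\to B$ with $\bar f=a$, $fb=f$, with $\mathsf L(A,a)=(A,\mathrm{id}_A)$ and $\eta_{(A,a)}=a$; it sends $F$ to $(A,a)\mapsto(FA,Fa)$, $f\mapsto Ff$, and $\varphi\colon F\Rightarrow G$ to $((Fa)\varphi_A)_{(A,a)}$. $\mathbf R\colon\mathsf{LCat}_{\mathsf{lax}}\to\mathsf{RCat}_{\mathsf{lax}}$ sends $\mathbb C$ to the category of total objects of $\mathbb C$, whose morphisms $M\to N$ are the isomorphism classes of pairs $(U,f)$ with $\mathsf LU=M$ and $f\colon U\to N$, composed by pullback, with $\overline{(U,f)}=(U,\eta_U)$; it sends $F$ to $M\mapsto FM$, $(U,f)\mapsto(FU,Ff)$, and $\varphi$ to $((FM,\varphi_M))_M$. *2-categorical terms.* A *Cartesian object* of a 2-category with finite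 2-products is an object $X$ such that the morphism $X\to\mathbb 1$ to the 2-terminal object and the diagonal $X\to X\times X$ have right adjoints in the 2-category. 2-functors $F\colon\mathcal K\to\mathcal J$ and $G\colon\mathcal J\to\mathcal K$ form a *2-equivalence* if there are 2-natural transformations $\mathrm{id}\Rightarrow GF$ and $FG\Rightarrow\mathrm{id}$ that satisfy the triangle identities and whose components are equivalences in $\mathcal K$ and $\mathcal J$, respectively. **Theorem.** (1) $\mathsf{LCat}_{\mathsf{lax}}$ has finite 2-products, and a local category is Cartesian if and only if it is a Cartesian object of $\mathsf{LCat}_{\mathsf{lax}}$. (2) For small restriction and local categories, the 2-functors $\mathbf R$ and $\mathbf L$ form a 2-equivalence $\mathsf{LCat}_{\mathsf{lax}}\simeq\mathsf{RCat}_{\mathsf{lax}}$ whose counit $\mathbf R\mathbf L\Rightarrow\mathrm{id}$ is invertible, with components that are isomorphisms of restriction categories. This 2-equivalence restricts to a 2-equivalence $\mathsf{cRCat}_{\mathsf{lax}}\simeq\mathsf{cLCat}_{\mathsf{lax}}$: $\mathbf R$ and $\mathbf L$ send Cartesian local (restriction) categories to Cartesian restriction (local) categories and structure-preserving 1-morphisms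 to structure-preserving 1-morphisms, and the restricted 2-functors form a 2-equivalence with the same unit and counit components, the counit components again being isomorphisms in $\mathsf{cRCat}_{\mathsf{lax}}$. -/

import Mathlib

open CategoryTheory Bicategory

universe w v u

set_option linter.checkUnivs false

/-! ### Restriction categories -/

/-- A restriction structure on a category; composition `f ≫ g` is written in diagrammatic order,
and `rest f` is the restriction idempotent of `f`. -/
class RestrictionStructure (X : Type u) [Category.{v} X] where
  rest : ∀ {A B : X}, (A ⟶ B) → (A ⟶ A)
  rest_comp_self : ∀ {A B : X} (f : A ⟶ B), rest f ≫ f = f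
  rest_comm : ∀ {A B C : X} (f : A ⟶ B) (g : A ⟶ C), rest f ≫ rest g = rest g ≫ rest f
  rest_rest_comp : ∀ {A B C : X} (f : A ⟶ B) (g : A ⟶ C),
    rest g ≫ rest f = rest (rest g ≫ f)
  comp_rest : ∀ {A B C : X} (f : A ⟶ B) (g : B ⟶ C), f ≫ rest g = rest (f ≫ g) ≫ f

namespace RestrictionStructure

variable {X : Type u} [Category.{v} X] [RestrictionStructure X]

/-- A morphism is total when its restriction idempotent is the identity. -/
def TotalHom {A B : X} (f : A ⟶ B) : Prop := rest f = 𝟙 A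

lemma rest_id (A : X) : rest (𝟙 A) = 𝟙 A := by
  simpa using rest_comp_self (𝟙 A)

lemma rest_idem {A B : X} (f : A ⟶ B) : rest f ≫ rest f = rest f := by
  rw [rest_rest_comp, rest_comp_self]

lemma rest_rest {A B : X} (f : A ⟶ B) : rest (rest f) = rest f := by
  have h := rest_rest_comp (𝟙 A) f
  simpa [rest_id] using h.symm

lemma rest_comp_rest {A B C : X} (f : A ⟶ B) (g : B ⟶ C) : rest (f ≫ rest g) = rest (f ≫ g) := by
  rw [comp_rest, ← rest_rest_comp, rest_comm, rest_rest_comp, ← Category.assoc, rest_comp_self]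

lemma rest_comp_total {A B C : X} (f : A ⟶ B) {g : B ⟶ C} (hg : TotalHom g) :
    rest (f ≫ g) = rest f := by
  rw [← rest_comp_rest, hg, Category.comp_id]

end RestrictionStructure

open RestrictionStructure

/-- A bundled restriction category. -/
structure RCat where
  carrier : Type u
  [cat : Category.{v} carrier]
  [str : RestrictionStructure carrier]

attribute [instance] RCat.cat RCat.str

/-- A restriction functor: a functor that preserves restriction idempotents. -/
structure RFunctor (X Y : RCat.{v, u}) extends X.carrier ⥤ Y.carrier where
  map_rest : ∀ {A B : X.carrier} (f : A ⟶ B), map (rest f) = rest (map f)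

/-- A restriction natural transformation: a family of total morphisms which is natural up to
restriction. -/
structure RNat {X Y : RCat.{v, u}} (F G : RFunctor X Y) where
  app : ∀ A : X.carrier, F.obj A ⟶ G.obj A
  total : ∀ A, TotalHom (app A)
  naturality : ∀ {A B : X.carrier} (f : A ⟶ B),
    F.map f ≫ app B = F.map (rest f) ≫ app A ≫ G.map f

namespace RCat

lemma RFunctor_total {X Y : RCat.{v, u}} (F : RFunctor X Y) {A B : X.carrier} {f : A ⟶ B}
    (hf : TotalHom f) : TotalHom (F.map f) := by
  have h := F.map_rest f
  rw [hf, F.map_id] at h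
  exact h.symm

lemma total_id {X : RCat.{v, u}} (A : X.carrier) : TotalHom (𝟙 A) := rest_id A

lemma total_comp {X : RCat.{v, u}} {A B C : X.carrier} {f : A ⟶ B} {g : B ⟶ C}
    (hf : TotalHom f) (hg : TotalHom g) : TotalHom (f ≫ g) := by
  unfold TotalHom
  rw [rest_comp_total f hg]
  exact hf

lemma RNat_ext {X Y : RCat.{v, u}} {F G : RFunctor X Y} {φ ψ : RNat F G}
    (h : ∀ A, φ.app A = ψ.app A) : φ = ψ := by
  cases φ
  cases ψ
  congr
  funext A
  exact h A

lemma RFunctor_ext {X Y : RCat.{v, u}} {F G : RFunctor X Y} (h : ∀ A, F.obj A = G.obj A)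
    (h' : ∀ {A B : X.carrier} (f : A ⟶ B), HEq (F.map f) (G.map f)) : F = G := by
  have e : F.toFunctor = G.toFunctor := CategoryTheory.Functor.hext h fun _ _ f => h' f
  cases F
  cases G
  congr

/-- Lax naturality at a total morphism is naturality. -/
lemma RNat_naturality_total {X Y : RCat.{v, u}} {F G : RFunctor X Y} (φ : RNat F G)
    {A B : X.carrier} {f : A ⟶ B} (hf : TotalHom f) :
    F.map f ≫ φ.app B = φ.app A ≫ G.map f := by
  have h := φ.naturality f
  rw [hf] at h
  simpa using h

lemma RNat_rest {X Y : RCat.{v, u}} {F G : RFunctor X Y} (φ : RNat F G)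
    {A B : X.carrier} (f : A ⟶ B) :
    F.map (rest f) ≫ φ.app A = F.map (rest f) ≫ φ.app A ≫ G.map (rest f) := by
  have h := φ.naturality (rest f)
  rwa [rest_rest] at h

instance homCategory (X Y : RCat.{v, u}) : Category (RFunctor X Y) where
  Hom F G := RNat F G
  id F :=
    { app := fun A => 𝟙 (F.obj A)
      total := fun A => total_id _
      naturality := fun f => by
        rw [Category.comp_id, Category.id_comp, ← F.map_comp, rest_comp_self] }
  comp {F G H} φ ψ :=
    { app := fun A => φ.app A ≫ ψ.app A
      total := fun A => total_comp (φ.total A) (ψ.total A)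
      naturality := fun {A B} f => by
        have h1 := φ.naturality f
        have h2 := ψ.naturality f
        have h3 := RNat_rest φ f
        rw [← Category.assoc, h1]
        simp only [Category.assoc]
        rw [h2]
        simp only [← Category.assoc] at h3 ⊢
        rw [← h3] }
  id_comp φ := RNat_ext fun A => Category.id_comp _
  comp_id φ := RNat_ext fun A => Category.comp_id _
  assoc φ ψ χ := RNat_ext fun A => Category.assoc _ _ _

@[simp] lemma comp₂_app {X Y : RCat.{v, u}} {F G H : RFunctor X Y} (φ : F ⟶ G) (ψ : G ⟶ H)
    (A : X.carrier) : RNat.app (φ ≫ ψ) A = RNat.app φ A ≫ RNat.app ψ A := rfl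

/-- The identity restriction functor. -/
def idR (X : RCat.{v, u}) : RFunctor X X where
  toFunctor := 𝟭 _
  map_rest _ := rfl

/-- The composite of restriction functors. -/
def compR {X Y Z : RCat.{v, u}} (F : RFunctor X Y) (G : RFunctor Y Z) : RFunctor X Z where
  toFunctor := F.toFunctor ⋙ G.toFunctor
  map_rest f := by simp [F.map_rest, G.map_rest]

lemma eqToHom_app {X Y : RCat.{v, u}} {F G : RFunctor X Y} (h : F = G) (A : X.carrier) :
    RNat.app (eqToHom h) A = eqToHom (by rw [h]) := by
  subst h
  rfl

/-- The 2-category of restriction categories, restriction functors and restriction natural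
transformations. -/
instance bicategory : Bicategory RCat.{v, u} where
  Hom X Y := RFunctor X Y
  id X := idR X
  comp F G := compR F G
  homCategory := homCategory
  whiskerLeft F G H φ :=
    { app := fun A => RNat.app φ (F.obj A)
      total := fun A => RNat.total φ _
      naturality := fun f => by
        have h := RNat.naturality φ (F.map f)
        rw [← F.map_rest] at h
        exact h }
  whiskerRight {X Y Z F G} φ H :=
    { app := fun A => H.map (RNat.app φ A)
      total := fun A => RFunctor_total H (RNat.total φ A)
      naturality := fun f => by
        have h := congrArg H.map (RNat.naturality φ f)
        rw [H.map_comp, H.map_comp, H.map_comp] at h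
        exact h }
  associator F G H := Iso.refl (compR F (compR G H))
  leftUnitor F := Iso.refl F
  rightUnitor F := Iso.refl F
  whiskerLeft_id _ _ := rfl
  whiskerLeft_comp _ _ _ _ _ _ := rfl
  id_whiskerLeft _ := RNat_ext fun _ =>
    ((Category.id_comp _).trans (Category.comp_id _)).symm
  comp_whiskerLeft _ _ _ _ _ := RNat_ext fun _ =>
    ((Category.id_comp _).trans (Category.comp_id _)).symm
  id_whiskerRight _ H := RNat_ext fun _ => H.map_id _
  comp_whiskerRight _ _ H := RNat_ext fun _ => H.map_comp _ _
  whiskerRight_id _ := RNat_ext fun _ =>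
    ((Category.id_comp _).trans (Category.comp_id _)).symm
  whiskerRight_comp _ _ _ := RNat_ext fun _ =>
    ((Category.id_comp _).trans (Category.comp_id _)).symm
  whisker_assoc _ _ _ _ _ := RNat_ext fun _ =>
    ((Category.id_comp _).trans (Category.comp_id _)).symm
  whisker_exchange {X Y Z F G H I} φ ψ :=
    RNat_ext fun A => (RNat_naturality_total ψ (RNat.total φ A)).symm
  pentagon _ _ _ I := RNat_ext fun _ =>
    (congrArg (fun t => t ≫ _) (I.map_id _)).trans (Category.id_comp _)
  triangle _ G := RNat_ext fun _ => (Category.id_comp _).trans (G.map_id _).symm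

instance : Bicategory.Strict RCat.{v, u} where
  id_comp _ := rfl
  comp_id _ := rfl
  assoc _ _ _ := rfl
  leftUnitor_eqToIso _ := rfl
  rightUnitor_eqToIso _ := rfl
  associator_eqToIso _ _ _ := rfl

end RCat

/-! ### Local categories -/

/-- A local structure on a category. The maximal inclusion of `M` is `η M`; equalities between
objects are transported along `eqToHom`. -/
class LocalStructure (C : Type u) [Category.{v} C] where
  L : C → C
  η : ∀ M : C, M ⟶ L M
  L_L : ∀ M, L (L M) = L M
  η_L : ∀ M, η (L M) = eqToHom (L_L M).symm
  η_mono : ∀ M, Mono (η M)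
  exists_pullback : ∀ {M N : C} (f : N ⟶ L M), ∃ (P : C) (m : P ⟶ N) (k : P ⟶ M)
    (h : L P = L N), IsPullback m k f (η M) ∧ m ≫ η N = η P ≫ eqToHom h

/-- A total object: it equals its enlargement and its maximal inclusion is the identity. -/
def LocalStructure.IsTotalObj {C : Type u} [Category.{v} C] [LocalStructure C] (M : C) : Prop :=
  ∃ h : L M = M, η M = eqToHom h.symm

open LocalStructure

/-- A bundled local category. -/
structure LCat where
  carrier : Type u
  [cat : Category.{v} carrier]
  [str : LocalStructure carrier]

attribute [instance] LCat.cat LCat.str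

/-- A local functor: a functor that preserves the local structure strictly, and the pullbacks of
maximal inclusions along arbitrary morphisms. -/
structure LFunctor (C D : LCat.{v, u}) extends C.carrier ⥤ D.carrier where
  obj_L : ∀ M : C.carrier, obj (L M) = L (obj M)
  map_η : ∀ M : C.carrier, map (η M) ≫ eqToHom (obj_L M) = η (obj M)
  map_isPullback : ∀ {P M N : C.carrier} {m : P ⟶ N} {k : P ⟶ M} {f : N ⟶ L M},
    IsPullback m k f (η M) → IsPullback (map m) (map k) (map f) (map (η M))

namespace LCat

/-- Local natural transformations are the natural transformations of underlying functors. -/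
instance homCategory (C D : LCat.{v, u}) : Category (LFunctor C D) where
  Hom F G := NatTrans F.toFunctor G.toFunctor
  id F := NatTrans.id F.toFunctor
  comp φ ψ := NatTrans.vcomp φ ψ
  id_comp _ := NatTrans.ext (funext fun _ => Category.id_comp _)
  comp_id _ := NatTrans.ext (funext fun _ => Category.comp_id _)
  assoc _ _ _ := NatTrans.ext (funext fun _ => Category.assoc _ _ _)

/-- The identity local functor. -/
def idL (C : LCat.{v, u}) : LFunctor C C where
  toFunctor := 𝟭 _
  obj_L _ := rfl
  map_η _ := Category.comp_id _
  map_isPullback h := h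

/-- The composite of local functors. -/
def compL {C D E : LCat.{v, u}} (F : LFunctor C D) (G : LFunctor D E) : LFunctor C E where
  toFunctor := F.toFunctor ⋙ G.toFunctor
  obj_L M := (congrArg G.obj (F.obj_L M)).trans (G.obj_L _)
  map_η M := by
    have h := G.map_η (F.obj M)
    rw [← F.map_η, G.map_comp, eqToHom_map, Category.assoc, eqToHom_trans] at h
    exact h
  map_isPullback {P M N m k f} h := by
    have h1 := F.map_isPullback h
    have e : F.map (η M) = η (F.obj M) ≫ eqToHom (F.obj_L M).symm := by
      rw [← F.map_η, Category.assoc, eqToHom_trans, eqToHom_refl, Category.comp_id]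
    have h2 : IsPullback (F.map m) (F.map k) (F.map f ≫ eqToHom (F.obj_L M)) (η (F.obj M)) := by
      refine IsPullback.of_iso h1 (Iso.refl _) (Iso.refl _) (Iso.refl _) (eqToIso (F.obj_L M))
        ?_ ?_ ?_ ?_
      · simp
      · simp
      · simp
      · simp [F.map_η]
    refine IsPullback.of_iso (G.map_isPullback h2) (Iso.refl _) (Iso.refl _) (Iso.refl _)
      (eqToIso (congrArg G.obj (F.obj_L M).symm)) ?_ ?_ ?_ ?_
    · simp
    · simp
    · simp [eqToHom_map]
    · simp [e, eqToHom_map]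

/-- The 2-category of local categories, local functors and local natural transformations. -/
instance bicategory : Bicategory LCat.{v, u} where
  Hom C D := LFunctor C D
  id C := idL C
  comp F G := compL F G
  homCategory := homCategory
  whiskerLeft F _ _ φ := Functor.whiskerLeft F.toFunctor φ
  whiskerRight φ H := Functor.whiskerRight φ H.toFunctor
  associator F G H := Iso.refl (compL F (compL G H))
  leftUnitor F := Iso.refl F
  rightUnitor F := Iso.refl F
  whiskerLeft_id _ _ := rfl
  whiskerLeft_comp _ _ _ _ _ _ := rfl
  id_whiskerLeft _ := NatTrans.ext <| funext fun _ =>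
    ((Category.id_comp _).trans (Category.comp_id _)).symm
  comp_whiskerLeft _ _ _ _ _ := NatTrans.ext <| funext fun _ =>
    ((Category.id_comp _).trans (Category.comp_id _)).symm
  id_whiskerRight _ H := NatTrans.ext <| funext fun _ => H.map_id _
  comp_whiskerRight _ _ H := NatTrans.ext <| funext fun _ => H.map_comp _ _
  whiskerRight_id _ := NatTrans.ext <| funext fun _ =>
    ((Category.id_comp _).trans (Category.comp_id _)).symm
  whiskerRight_comp _ _ _ := NatTrans.ext <| funext fun _ =>
    ((Category.id_comp _).trans (Category.comp_id _)).symm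
  whisker_assoc _ _ _ _ _ := NatTrans.ext <| funext fun _ =>
    ((Category.id_comp _).trans (Category.comp_id _)).symm
  whisker_exchange φ ψ := NatTrans.ext <| funext fun A => (NatTrans.naturality ψ (φ.app A)).symm
  pentagon _ _ _ I := NatTrans.ext <| funext fun _ =>
    (congrArg (fun t => t ≫ _) (I.map_id _)).trans (Category.id_comp _)
  triangle _ G := NatTrans.ext <| funext fun _ => (Category.id_comp _).trans (G.map_id _).symm

instance : Bicategory.Strict LCat.{v, u} where
  id_comp _ := rfl
  comp_id _ := rfl
  assoc _ _ _ := rfl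
  leftUnitor_eqToIso _ := rfl
  rightUnitor_eqToIso _ := rfl
  associator_eqToIso _ _ _ := rfl

lemma hom₂_ext {C D : LCat.{v, u}} {F G : LFunctor C D} {φ ψ : F ⟶ G}
    (h : ∀ A, NatTrans.app φ A = NatTrans.app ψ A) : φ = ψ :=
  NatTrans.ext (funext h)

end LCat

/-! ### The local category of a restriction category -/

/-- Objects of the local category of `X`: an object together with a restriction idempotent. -/
@[ext]
structure LObj (X : RCat.{v, u}) where
  base : X.carrier
  idem : base ⟶ base
  rest_idem : rest idem = idem

/-- Morphisms `(A, a) ⟶ (B, b)`: morphisms `f : A ⟶ B` with `rest f = a` and `f ≫ b = f`. -/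
@[ext]
structure LHom {X : RCat.{v, u}} (P Q : LObj X) where
  hom : P.base ⟶ Q.base
  rest_hom : rest hom = P.idem
  hom_idem : hom ≫ Q.idem = hom

namespace LObj

variable {X : RCat.{v, u}}

lemma idem_comp (P : LObj X) : P.idem ≫ P.idem = P.idem := by
  have h := rest_comp_self P.idem
  rwa [P.rest_idem] at h

lemma idem_hom {P Q : LObj X} (f : LHom P Q) : P.idem ≫ f.hom = f.hom := by
  rw [← f.rest_hom, rest_comp_self]

instance category : Category (LObj X) where
  Hom P Q := LHom P Q
  id P := ⟨P.idem, P.rest_idem, P.idem_comp⟩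
  comp {P Q R} f g := ⟨f.hom ≫ g.hom, by
    rw [← rest_comp_rest, g.rest_hom, f.hom_idem, f.rest_hom], by
    rw [Category.assoc, g.hom_idem]⟩
  id_comp f := LHom.ext (idem_hom f)
  comp_id f := LHom.ext f.hom_idem
  assoc _ _ _ := LHom.ext (Category.assoc _ _ _)

lemma hom_ext {P Q : LObj X} {f g : P ⟶ Q} (h : LHom.hom f = LHom.hom g) : f = g := LHom.ext h

@[simp] lemma id_hom (P : LObj X) : LHom.hom (𝟙 P) = P.idem := rfl

@[simp] lemma comp_hom {P Q R : LObj X} (f : P ⟶ Q) (g : Q ⟶ R) :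
    LHom.hom (f ≫ g) = LHom.hom f ≫ LHom.hom g := rfl

lemma eqToHom_hom {P Q : LObj X} (h : P = Q) :
    LHom.hom (eqToHom h) = P.idem ≫ eqToHom (congrArg LObj.base h) := by
  subst h
  simp

/-- The enlargement `(A, 𝟙)` of `(A, a)`. -/
abbrev enlarge (P : LObj X) : LObj X := ⟨P.base, 𝟙 _, rest_id _⟩

/-- The maximal inclusion `a : (A, a) ⟶ (A, 𝟙)`. -/
def incl (P : LObj X) : P ⟶ P.enlarge := LHom.mk P.idem P.rest_idem (Category.comp_id _)

/-- The restriction of `Q` to the preimage of `P` along `f`. -/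
abbrev pre {P Q : LObj X} (f : Q ⟶ P.enlarge) : LObj X :=
  ⟨Q.base, rest (LHom.hom f ≫ P.idem), rest_rest _⟩

lemma preFst_aux {A B : X.carrier} {b : B ⟶ B} {a : A ⟶ A} {f : B ⟶ A} (hb : rest b = b)
    (hf : rest f = b) : rest (f ≫ a) ≫ b = rest (f ≫ a) := by
  have h : b ≫ rest (f ≫ a) = rest (f ≫ a) := by
    rw [← hf, rest_rest_comp, ← Category.assoc, rest_comp_self]
  have h' : rest (f ≫ a) ≫ rest b = rest b ≫ rest (f ≫ a) := rest_comm _ _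
  rw [hb] at h'
  rw [h', h]

/-- The inclusion of the preimage. -/
def preFst {P Q : LObj X} (f : Q ⟶ P.enlarge) : pre f ⟶ Q :=
  LHom.mk (rest (LHom.hom (P := Q) (Q := P.enlarge) f ≫ P.idem)) (rest_rest _) (preFst_aux Q.rest_idem (LHom.rest_hom f))

/-- The restriction of `f` to the preimage. -/
def preSnd {P Q : LObj X} (f : Q ⟶ P.enlarge) : pre f ⟶ P :=
  LHom.mk (LHom.hom (P := Q) (Q := P.enlarge) f ≫ P.idem) rfl ((Category.assoc _ _ _).trans
    (congrArg (fun t => LHom.hom (P := Q) (Q := P.enlarge) f ≫ t) P.idem_comp))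

lemma pre_w {A B : X.carrier} {a : A ⟶ A} (ha : rest a = a) (ha' : a ≫ a = a) (f : B ⟶ A) :
    rest (f ≫ a) ≫ f = (f ≫ a) ≫ a := by
  rw [Category.assoc, ha', ← comp_rest, ha]

lemma pre_lift {A B C : X.carrier} {a : A ⟶ A} {f : B ⟶ A} {g : C ⟶ B} {h : C ⟶ A}
    (hh : h ≫ a = h) (hr : rest g = rest h) (w : g ≫ f = h ≫ a) :
    g ≫ rest (f ≫ a) = g := by
  rw [comp_rest, ← Category.assoc, w, hh, hh, ← hr, rest_comp_self]

lemma isPullback_pre {P Q : LObj X} (f : Q ⟶ P.enlarge) :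
    IsPullback (preFst f) (preSnd f) f (incl P) := by
  have w : preFst f ≫ f = preSnd f ≫ incl P :=
    hom_ext (pre_w P.rest_idem P.idem_comp (LHom.hom (P := Q) (Q := P.enlarge) f))
  have key : ∀ s : Limits.PullbackCone f (incl P),
      LHom.hom s.fst ≫ rest (LHom.hom f ≫ P.idem) = LHom.hom s.fst := fun s =>
    pre_lift (LHom.hom_idem s.snd) ((LHom.rest_hom s.fst).trans (LHom.rest_hom s.snd).symm)
      (congrArg LHom.hom s.condition)
  refine IsPullback.of_isLimit' ⟨w⟩ (Limits.PullbackCone.IsLimit.mk _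
    (fun s => LHom.mk (LHom.hom (P := s.pt) (Q := Q) s.fst) (LHom.rest_hom s.fst) (key s))
    (fun s => hom_ext (key s)) (fun s => hom_ext ?_) (fun s m h1 _ => hom_ext ?_))
  · have hs : LHom.hom s.fst ≫ LHom.hom f = LHom.hom s.snd ≫ P.idem :=
      congrArg LHom.hom s.condition
    have h2 := LHom.hom_idem s.snd
    have h3 : LHom.hom s.fst ≫ (LHom.hom (P := Q) (Q := P.enlarge) f ≫ P.idem) =
        (LHom.hom s.fst ≫ LHom.hom f) ≫ P.idem := (Category.assoc _ _ _).symm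
    exact h3.trans ((congrArg (fun t => t ≫ P.idem) hs).trans
      ((congrArg (fun t => t ≫ P.idem) h2).trans h2))
  · have h2 : LHom.hom m ≫ rest (LHom.hom (P := Q) (Q := P.enlarge) f ≫ P.idem) = LHom.hom s.fst := congrArg LHom.hom h1
    exact (LHom.hom_idem m).symm.trans h2

instance localStructure : LocalStructure (LObj X) where
  L := enlarge
  η := incl
  L_L _ := rfl
  η_L _ := rfl
  η_mono P := ⟨fun g h w => by
    apply hom_ext
    have h' : LHom.hom g ≫ P.idem = LHom.hom h ≫ P.idem := congrArg LHom.hom w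
    rwa [LHom.hom_idem, LHom.hom_idem] at h'⟩
  exists_pullback f := ⟨pre f, preFst f, preSnd f, rfl, isPullback_pre f,
    (hom_ext (LHom.hom_idem (preFst f)) : preFst f ≫ incl _ = incl (pre f)).trans
      (Category.comp_id _).symm⟩

end LObj

/-- The local category of a restriction category. -/
def RCat.toLocal (X : RCat.{v, u}) : LCat.{v, max u v} := ⟨LObj X⟩

/-- The underlying functor of the local functor induced by a restriction functor. -/
abbrev RFunctor.toLocalFunctor {X Y : RCat.{v, u}} (F : RFunctor X Y) : LObj X ⥤ LObj Y where
  obj P := ⟨F.obj P.base, F.map P.idem, by rw [← F.map_rest, P.rest_idem]⟩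
  map {P Q} f := LHom.mk (F.map (LHom.hom (P := P) (Q := Q) f))
    ((F.map_rest _).symm.trans (congrArg (fun t => F.map t) (LHom.rest_hom f)))
    ((F.map_comp _ _).symm.trans (congrArg (fun t => F.map t) (LHom.hom_idem f)))
  map_id _ := rfl
  map_comp _ _ := LObj.hom_ext (F.map_comp _ _)

lemma RFunctor.toLocal_obj_enlarge {X Y : RCat.{v, u}} (F : RFunctor X Y) (P : LObj X) :
    F.toLocalFunctor.obj P.enlarge = (F.toLocalFunctor.obj P).enlarge := by
  simp only [F.map_id]

lemma RFunctor.toLocal_map_incl {X Y : RCat.{v, u}} (F : RFunctor X Y) (P : LObj X) :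
    F.toLocalFunctor.map P.incl ≫ eqToHom (F.toLocal_obj_enlarge P) =
      (F.toLocalFunctor.obj P).incl := by
  apply LObj.hom_ext
  rw [LObj.comp_hom, LObj.eqToHom_hom]
  change F.map P.idem ≫ F.map (𝟙 _) ≫ 𝟙 _ = F.map P.idem
  simp

lemma RFunctor.toLocal_pre {X Y : RCat.{v, u}} (F : RFunctor X Y) {P Q : LObj X}
    (f : Q ⟶ P.enlarge) :
    IsPullback (F.toLocalFunctor.map (LObj.preFst f)) (F.toLocalFunctor.map (LObj.preSnd f))
      (F.toLocalFunctor.map f) (F.toLocalFunctor.map P.incl) := by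
  let g : F.toLocalFunctor.obj Q ⟶ (F.toLocalFunctor.obj P).enlarge :=
    LHom.mk (F.map (LHom.hom (P := Q) (Q := P.enlarge) f)) (LHom.rest_hom (F.toLocalFunctor.map f)) (Category.comp_id _)
  have hg : F.toLocalFunctor.map f ≫ eqToHom (F.toLocal_obj_enlarge P) = g := by
    apply LObj.hom_ext
    rw [LObj.comp_hom, LObj.eqToHom_hom]
    change F.map (LHom.hom f) ≫ F.map (𝟙 _) ≫ 𝟙 _ = F.map (LHom.hom f)
    rw [F.map_id, Category.comp_id, Category.comp_id]
  have hr : F.map (rest (LHom.hom f ≫ P.idem)) = rest (F.map (LHom.hom f) ≫ F.map P.idem) := by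
    rw [F.map_rest, F.map_comp]
  have e : F.toLocalFunctor.obj (LObj.pre f) = LObj.pre g := by
    simp only [g, hr]
  refine IsPullback.of_iso (LObj.isPullback_pre g) (eqToIso e.symm) (Iso.refl _) (Iso.refl _)
    (eqToIso (F.toLocal_obj_enlarge P).symm) ?_ ?_ ?_ ?_
  · apply LObj.hom_ext
    rw [Iso.refl_hom, Category.comp_id, LObj.comp_hom, eqToIso.hom, LObj.eqToHom_hom]
    change rest (F.map (LHom.hom f) ≫ F.map P.idem) =
      (rest (F.map (LHom.hom f) ≫ F.map P.idem) ≫ 𝟙 _) ≫ F.map (rest (LHom.hom f ≫ P.idem))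
    rw [hr, Category.comp_id, RestrictionStructure.rest_idem]
  · apply LObj.hom_ext
    rw [Iso.refl_hom, Category.comp_id, LObj.comp_hom, eqToIso.hom, LObj.eqToHom_hom]
    change F.map (LHom.hom f) ≫ F.map P.idem =
      (rest (F.map (LHom.hom f) ≫ F.map P.idem) ≫ 𝟙 _) ≫ F.map (LHom.hom f ≫ P.idem)
    rw [F.map_comp, Category.comp_id, rest_comp_self]
  · rw [← hg, Iso.refl_hom, Category.id_comp, eqToIso.hom, Category.assoc, eqToHom_trans,
      eqToHom_refl, Category.comp_id]
  · rw [← F.toLocal_map_incl, Iso.refl_hom, Category.id_comp, eqToIso.hom, Category.assoc,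
      eqToHom_trans, eqToHom_refl, Category.comp_id]

lemma RFunctor.toLocal_isPullback {X Y : RCat.{v, u}} (F : RFunctor X Y) {P M N : LObj X}
    {m : P ⟶ N} {k : P ⟶ M} {f : N ⟶ M.enlarge} (h : IsPullback m k f M.incl) :
    IsPullback (F.toLocalFunctor.map m) (F.toLocalFunctor.map k) (F.toLocalFunctor.map f)
      (F.toLocalFunctor.map M.incl) := by
  have h0 := LObj.isPullback_pre f
  refine IsPullback.of_iso (F.toLocal_pre f) (F.toLocalFunctor.mapIso (h.isoIsPullback _ _ h0).symm)
    (Iso.refl _) (Iso.refl _) (Iso.refl _) ?_ ?_ ?_ ?_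
  · rw [Iso.refl_hom, Category.comp_id, Functor.mapIso_hom, ← Functor.map_comp]
    exact congrArg F.toLocalFunctor.map (h.isoIsPullback_inv_fst _ _ h0).symm
  · rw [Iso.refl_hom, Category.comp_id, Functor.mapIso_hom, ← Functor.map_comp]
    exact congrArg F.toLocalFunctor.map (h.isoIsPullback_inv_snd _ _ h0).symm
  · rw [Iso.refl_hom, Iso.refl_hom, Category.comp_id, Category.id_comp]
  · rw [Iso.refl_hom, Iso.refl_hom, Category.comp_id, Category.id_comp]

/-- The local functor induced by a restriction functor: `(A, a) ↦ (F A, F a)`, `f ↦ F f`. -/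
def RFunctor.toLocal {X Y : RCat.{v, u}} (F : RFunctor X Y) :
    LFunctor X.toLocal Y.toLocal where
  toFunctor := F.toLocalFunctor
  obj_L P := F.toLocal_obj_enlarge P
  map_η P := F.toLocal_map_incl P
  map_isPullback h := F.toLocal_isPullback h

lemma RNat.toLocal_aux {X Y : RCat.{v, u}} {F G : RFunctor X Y} (φ : RNat F G) (P : LObj X) :
    rest (F.map P.idem ≫ φ.app P.base) = F.map P.idem ∧
      (F.map P.idem ≫ φ.app P.base) ≫ G.map P.idem = F.map P.idem ≫ φ.app P.base := by
  constructor
  · rw [rest_comp_total _ (φ.total _), ← F.map_rest, P.rest_idem]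
  · have h := RCat.RNat_rest φ P.idem
    rw [P.rest_idem] at h
    rw [Category.assoc]
    exact h.symm

/-- The local natural transformation induced by a restriction natural transformation, with
component `F a ≫ φ A` at `(A, a)`. -/
def RNat.toLocal {X Y : RCat.{v, u}} {F G : RFunctor X Y} (φ : RNat F G) :
    F.toLocal ⟶ G.toLocal :=
  NatTrans.mk (F := F.toLocalFunctor) (G := G.toLocalFunctor)
    (fun P => LHom.mk (F.map P.idem ≫ φ.app P.base) (φ.toLocal_aux P).1 (φ.toLocal_aux P).2)
    (fun P Q f => LObj.hom_ext (by
      change F.map (LHom.hom f) ≫ F.map Q.idem ≫ φ.app Q.base =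
        (F.map P.idem ≫ φ.app P.base) ≫ G.map (LHom.hom f)
      rw [← Category.assoc, ← F.map_comp, LHom.hom_idem, φ.naturality, LHom.rest_hom,
        Category.assoc]))

/-- The 2-functor from restriction categories to local categories. -/
def toLocal2 : StrictPseudofunctor RCat.{v, u} LCat.{v, max u v} :=
  StrictPseudofunctor.mk''
    { obj := RCat.toLocal
      map := fun F => RFunctor.toLocal F
      map₂ := fun φ => RNat.toLocal φ
      map₂_id := fun F => LCat.hom₂_ext fun P => LObj.hom_ext (Category.comp_id _)
      map₂_comp := fun {X Y F G H} φ ψ => LCat.hom₂_ext fun P => LObj.hom_ext (by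
        change F.map P.idem ≫ φ.app P.base ≫ ψ.app P.base =
          (F.map P.idem ≫ φ.app P.base) ≫ G.map P.idem ≫ ψ.app P.base
        have h := RCat.RNat_rest φ P.idem
        rw [P.rest_idem] at h
        have h' := congrArg (fun t => t ≫ ψ.app P.base) h
        simpa only [Category.assoc] using h')
      map_id := fun _ => rfl
      map_comp := fun _ _ => rfl
      map₂_whisker_left := fun {X Y Z} F {G H} φ => 
        ((Category.id_comp _).trans (Category.comp_id _)).symm
      map₂_whisker_right := fun {X Y Z F G} φ H => by
        refine Eq.trans ?_ ((Category.id_comp _).trans (Category.comp_id _)).symm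
        exact LCat.hom₂_ext fun P => LObj.hom_ext (Functor.map_comp (RFunctor.toFunctor H) (F.map P.idem)
          (RNat.app φ P.base)).symm }

/-! ### The restriction category of a local category -/

/-- A representative `(U, f)` of a partial morphism `M ⟶ N`: an object `U` with `L U = M` and a
morphism `f : U ⟶ N`. -/
structure PMap {C : LCat.{v, u}} (M N : C.carrier) where
  dom : C.carrier
  L_dom : L dom = M
  arr : dom ⟶ N

namespace PMap

variable {C : LCat.{v, u}}

/-- The maximal inclusion of the domain, as a morphism to `M = L U`. -/
def incl {M N : C.carrier} (p : PMap M N) : p.dom ⟶ M := η p.dom ≫ eqToHom p.L_dom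

instance mono_incl {M N : C.carrier} (p : PMap M N) : Mono p.incl := by
  have := η_mono p.dom
  unfold incl
  infer_instance

/-- Two representatives are identified when their domains are isomorphic, compatibly with the
maximal inclusions and with the morphisms. -/
def Rel {M N : C.carrier} (p q : PMap M N) : Prop :=
  ∃ e : p.dom ≅ q.dom, e.hom ≫ q.incl = p.incl ∧ e.hom ≫ q.arr = p.arr

lemma Rel.refl {M N : C.carrier} (p : PMap M N) : Rel p p :=
  ⟨Iso.refl _, Category.id_comp _, Category.id_comp _⟩

lemma Rel.symm {M N : C.carrier} {p q : PMap M N} : Rel p q → Rel q p := by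
  rintro ⟨e, h1, h2⟩
  exact ⟨e.symm, by simp [← h1], by simp [← h2]⟩

lemma Rel.trans {M N : C.carrier} {p q r : PMap M N} : Rel p q → Rel q r → Rel p r := by
  rintro ⟨e, h1, h2⟩ ⟨e', h1', h2'⟩
  exact ⟨e ≪≫ e', by simp [h1, h1'], by simp [h2, h2']⟩

/-- The setoid of isomorphisms of representatives. -/
def setoid (M N : C.carrier) : Setoid (PMap M N) :=
  ⟨Rel, Rel.refl, Rel.symm, Rel.trans⟩

/-- `r` is a composite of `p` and `q`: its domain is the pullback of the maximal inclusion of the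
domain of `q` along the morphism of `p`. -/
def IsComp {M N P : C.carrier} (p : PMap M N) (q : PMap N P) (r : PMap M P) : Prop :=
  ∃ (m : r.dom ⟶ p.dom) (k : r.dom ⟶ q.dom), IsPullback m k p.arr q.incl ∧
    m ≫ p.incl = r.incl ∧ k ≫ q.arr = r.arr

lemma exists_isComp {M N P : C.carrier} (p : PMap M N) (q : PMap N P) :
    ∃ r : PMap M P, IsComp p q r := by
  obtain ⟨U, rfl, f⟩ := p
  obtain ⟨V, rfl, g⟩ := q
  obtain ⟨W, m, k, h, hp, hm⟩ := exists_pullback f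
  refine ⟨⟨W, h, k ≫ g⟩, m, k, ?_, ?_, rfl⟩
  · simpa [incl] using hp
  · simpa [incl] using hm

lemma IsComp.unique {M N P : C.carrier} {p p' : PMap M N} {q q' : PMap N P} {r r' : PMap M P}
    (hp : Rel p p') (hq : Rel q q') (h : IsComp p q r) (h' : IsComp p' q' r') : Rel r r' := by
  obtain ⟨e, e1, e2⟩ := hp
  obtain ⟨d, d1, d2⟩ := hq
  obtain ⟨m, k, hpb, h1, h2⟩ := h
  obtain ⟨m', k', hpb', h1', h2'⟩ := h'
  have hpb2 : IsPullback (m ≫ e.hom) (k ≫ d.hom) p'.arr q'.incl :=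
    IsPullback.of_iso hpb (Iso.refl _) e d (Iso.refl _) (by simp) (by simp) (by simp [e2])
      (by simp [d1])
  refine ⟨hpb2.isoIsPullback _ _ hpb', ?_, ?_⟩
  · rw [← h1', ← Category.assoc, hpb2.isoIsPullback_hom_fst _ _ hpb', Category.assoc, e1, h1]
  · rw [← h2', ← Category.assoc, hpb2.isoIsPullback_hom_snd _ _ hpb', Category.assoc, d2, h2]

lemma IsComp.assoc {M N P Q : C.carrier} {p : PMap M N} {q : PMap N P} {s : PMap P Q}
    {a : PMap M P} {b : PMap N Q} {x : PMap M Q} (ha : IsComp p q a) (hb : IsComp q s b)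
    (hx : IsComp a s x) : IsComp p b x := by
  obtain ⟨m1, k1, h1, i1, j1⟩ := ha
  obtain ⟨m3, k3, h3, i3, j3⟩ := hb
  obtain ⟨m2, k2, h2, i2, j2⟩ := hx
  have w : (m2 ≫ k1) ≫ q.arr = k2 ≫ s.incl := by
    rw [Category.assoc, j1, h2.w]
  have big : IsPullback (h3.lift _ _ w ≫ k3) m2 s.incl (k1 ≫ q.arr) := by
    rw [h3.lift_snd, j1]
    exact h2.flip
  have left : IsPullback (h3.lift _ _ w) m2 m3 k1 :=
    IsPullback.of_right big (h3.lift_fst _ _ w) h3.flip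
  refine ⟨m2 ≫ m1, h3.lift _ _ w, ?_, ?_, ?_⟩
  · rw [← i3]
    exact left.flip.paste_horiz h1
  · rw [Category.assoc, i1, i2]
  · rw [← j3, ← Category.assoc, h3.lift_snd, j2]

/-- The total partial morphism given by a morphism of `C` whose source is its own enlargement. -/
abbrev ofHom {M N : C.carrier} (hM : IsTotalObj M) (f : M ⟶ N) : PMap M N := ⟨M, hM.1, f⟩

lemma incl_ofHom {M N : C.carrier} (hM : IsTotalObj M) (f : M ⟶ N) :
    (ofHom hM f).incl = 𝟙 M := by
  have hη : η M = eqToHom hM.1.symm := hM.2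
  have h : η M ≫ eqToHom hM.1 = 𝟙 M := by rw [hη, eqToHom_trans, eqToHom_refl]
  exact h

/-- The restriction idempotent `(U, η_U)` of `(U, f)`. -/
abbrev restr {M N : C.carrier} (p : PMap M N) : PMap M M := ⟨p.dom, p.L_dom, p.incl⟩

lemma isComp_ofHom {M N P : C.carrier} (p : PMap M N) (hN : IsTotalObj N) (g : N ⟶ P) :
    IsComp p (ofHom hN g) ⟨p.dom, p.L_dom, p.arr ≫ g⟩ := by
  refine ⟨𝟙 _, p.arr, ?_, Category.id_comp _, rfl⟩
  rw [incl_ofHom]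
  exact IsPullback.of_horiz_isIso ⟨by simp⟩

lemma ofHom_isComp {M N : C.carrier} (hM : IsTotalObj M) (p : PMap M N) :
    IsComp (ofHom hM (𝟙 M)) p p := by
  refine ⟨p.incl, 𝟙 _, ?_, ?_, Category.id_comp _⟩
  · exact IsPullback.of_vert_isIso ⟨by simp⟩
  · rw [incl_ofHom]
    exact Category.comp_id _

/-- Composition with a partial morphism whose domain contains the image. -/
lemma isComp_of_factor {M N P : C.carrier} (p : PMap M N) (q : PMap N P) (t : p.dom ⟶ q.dom)
    (ht : t ≫ q.incl = p.arr) : IsComp p q ⟨p.dom, p.L_dom, t ≫ q.arr⟩ := by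
  refine ⟨𝟙 _, t, ?_, Category.id_comp _, rfl⟩
  refine IsPullback.of_isLimit' ⟨by rw [Category.id_comp, ht]⟩
    (Limits.PullbackCone.IsLimit.mk _ (fun s => s.fst) (fun s => Category.comp_id _)
      (fun s => ?_) (fun s m h1 _ => by rw [← h1, Category.comp_id]))
  rw [← cancel_mono q.incl, Category.assoc, ht, s.condition]

lemma restr_isComp {M N : C.carrier} (p : PMap M N) : IsComp p.restr p p := by
  have h := isComp_of_factor p.restr p (𝟙 p.dom) (Category.id_comp _)
  have e : 𝟙 p.dom ≫ p.arr = p.arr := Category.id_comp _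
  rw [e] at h
  exact h

lemma restr_comm {M N P : C.carrier} {p : PMap M N} {q : PMap M P} {r : PMap M M}
    (h : IsComp p.restr q.restr r) : IsComp q.restr p.restr r := by
  obtain ⟨m, k, h, h1, h2⟩ := h
  exact ⟨k, m, h.flip, h.w.symm.trans h1, h.w.trans h2⟩

lemma restr_restr {M N P : C.carrier} {p : PMap M N} {q : PMap M P} {r : PMap M N}
    (h : IsComp q.restr p r) : IsComp q.restr p.restr r.restr := by
  obtain ⟨m, k, h, h1, h2⟩ := h
  exact ⟨m, k, h, h1, h.w.symm.trans h1⟩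

lemma comp_restr {M N P : C.carrier} {p : PMap M N} {q : PMap N P} {r : PMap M P}
    (h : IsComp p q r) : ∃ s, IsComp p q.restr s ∧ IsComp r.restr p s := by
  obtain ⟨m, k, h, h1, h2⟩ := h
  refine ⟨⟨r.dom, r.L_dom, k ≫ q.incl⟩, ⟨m, k, h, h1, rfl⟩, ?_⟩
  rw [← h.w]
  exact isComp_of_factor r.restr p m h1

lemma Rel.restr {M N : C.carrier} {p q : PMap M N} (h : Rel p q) : Rel p.restr q.restr := by
  obtain ⟨e, h1, h2⟩ := h
  exact ⟨e, h1, h1⟩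

end PMap

/-- Objects of the restriction category of `C`: the total objects of `C`. -/
structure RObj (C : LCat.{v, u}) where
  obj : C.carrier
  total : IsTotalObj obj

namespace RObj

variable {C : LCat.{v, u}}

/-- Composition of classes of partial morphisms. -/
noncomputable def compQ {M N P : C.carrier} (f : Quotient (PMap.setoid M N))
    (g : Quotient (PMap.setoid N P)) : Quotient (PMap.setoid M P) :=
  Quotient.map₂ (fun p q => (PMap.exists_isComp p q).choose)
    (fun _ _ hp _ _ hq => PMap.IsComp.unique hp hq (PMap.exists_isComp _ _).choose_spec
      (PMap.exists_isComp _ _).choose_spec) f g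

lemma compQ_eq {M N P : C.carrier} {p : PMap M N} {q : PMap N P} {r : PMap M P}
    (h : PMap.IsComp p q r) :
    compQ (Quotient.mk (PMap.setoid M N) p) (Quotient.mk (PMap.setoid N P) q) =
      Quotient.mk (PMap.setoid M P) r :=
  Quotient.sound (s := PMap.setoid M P)
    (PMap.IsComp.unique (PMap.Rel.refl p) (PMap.Rel.refl q)
      (PMap.exists_isComp p q).choose_spec h)

lemma compQ_id {M N : C.carrier} (hN : IsTotalObj N) (f : Quotient (PMap.setoid M N)) :
    compQ f (Quotient.mk (PMap.setoid N N) (PMap.ofHom hN (𝟙 N))) = f := by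
  induction f using Quotient.inductionOn with
  | _ p =>
    have h := PMap.isComp_ofHom p hN (𝟙 N)
    rw [Category.comp_id] at h
    exact compQ_eq h

lemma id_compQ {M N : C.carrier} (hM : IsTotalObj M) (f : Quotient (PMap.setoid M N)) :
    compQ (Quotient.mk (PMap.setoid M M) (PMap.ofHom hM (𝟙 M))) f = f := by
  induction f using Quotient.inductionOn with
  | _ p => exact compQ_eq (PMap.ofHom_isComp hM p)

lemma compQ_assoc {M N P Q : C.carrier} (f : Quotient (PMap.setoid M N))
    (g : Quotient (PMap.setoid N P)) (h : Quotient (PMap.setoid P Q)) :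
    compQ (compQ f g) h = compQ f (compQ g h) := by
  induction f using Quotient.inductionOn with
  | _ p =>
  induction g using Quotient.inductionOn with
  | _ q =>
  induction h using Quotient.inductionOn with
  | _ s =>
  obtain ⟨a, ha⟩ := PMap.exists_isComp p q
  obtain ⟨b, hb⟩ := PMap.exists_isComp q s
  obtain ⟨x, hx⟩ := PMap.exists_isComp a s
  rw [compQ_eq ha, compQ_eq hb, compQ_eq hx, compQ_eq (ha.assoc hb hx)]

noncomputable instance category : Category (RObj C) where
  Hom M N := Quotient (PMap.setoid M.obj N.obj)
  id M := Quotient.mk _ (PMap.ofHom M.total (𝟙 M.obj))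
  comp f g := compQ f g
  id_comp {M _} f := id_compQ M.total f
  comp_id {_ N} f := compQ_id N.total f
  assoc f g h := compQ_assoc f g h

/-- The class of a partial morphism. -/
def cls {M N : RObj C} (p : PMap M.obj N.obj) : M ⟶ N := Quotient.mk (PMap.setoid M.obj N.obj) p

lemma cls_comp {M N P : RObj C} {p : PMap M.obj N.obj} {q : PMap N.obj P.obj}
    {r : PMap M.obj P.obj} (h : PMap.IsComp p q r) :
    (cls p : M ⟶ N) ≫ (cls q : N ⟶ P) = cls r := compQ_eq h

lemma cls_surj {M N : RObj C} (f : M ⟶ N) : ∃ p, f = cls p :=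
  Quotient.inductionOn f fun p => ⟨p, rfl⟩

/-- The restriction idempotent of a class of partial morphisms. -/
def restQ {M N : RObj C} (f : M ⟶ N) : M ⟶ M :=
  Quotient.map (fun p => p.restr) (fun _ _ h => PMap.Rel.restr h) f

lemma restQ_cls {M N : RObj C} (p : PMap M.obj N.obj) :
    restQ (cls p : M ⟶ N) = cls p.restr := rfl

noncomputable instance restrictionStructure : RestrictionStructure (RObj C) where
  rest f := restQ f
  rest_comp_self f := by
    obtain ⟨p, rfl⟩ := cls_surj f
    rw [restQ_cls, cls_comp p.restr_isComp]
  rest_comm f g := by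
    obtain ⟨p, rfl⟩ := cls_surj f
    obtain ⟨q, rfl⟩ := cls_surj g
    obtain ⟨r, hr⟩ := PMap.exists_isComp p.restr q.restr
    rw [restQ_cls, restQ_cls, cls_comp hr, cls_comp (PMap.restr_comm hr)]
  rest_rest_comp f g := by
    obtain ⟨p, rfl⟩ := cls_surj f
    obtain ⟨q, rfl⟩ := cls_surj g
    obtain ⟨r, hr⟩ := PMap.exists_isComp q.restr p
    rw [restQ_cls, restQ_cls, cls_comp hr, restQ_cls, cls_comp (PMap.restr_restr hr)]
  comp_rest f g := by
    obtain ⟨p, rfl⟩ := cls_surj f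
    obtain ⟨q, rfl⟩ := cls_surj g
    obtain ⟨r, hr⟩ := PMap.exists_isComp p q
    obtain ⟨s, h1, h2⟩ := PMap.comp_restr hr
    rw [restQ_cls, cls_comp hr, restQ_cls, cls_comp h1, cls_comp h2]

end RObj

/-- The restriction category of a local category. -/
noncomputable def LCat.toRestriction (C : LCat.{v, u}) : RCat.{max u v, u} := ⟨RObj C⟩

namespace LFunctor

variable {C D : LCat.{v, u}}

lemma isTotalObj (F : LFunctor C D) {M : C.carrier} (h : IsTotalObj M) : IsTotalObj (F.obj M) := by
  obtain ⟨h, hη⟩ := h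
  refine ⟨(F.obj_L M).symm.trans (congrArg F.obj h), ?_⟩
  rw [← F.map_η, hη, eqToHom_map, eqToHom_trans]

/-- The image of a representative of a partial morphism. -/
abbrev mapPMap (F : LFunctor C D) {M N : C.carrier} (p : PMap M N) :
    PMap (C := D) (F.obj M) (F.obj N) :=
  ⟨F.obj p.dom, (F.obj_L p.dom).symm.trans (congrArg F.obj p.L_dom), F.map p.arr⟩

lemma incl_mapPMap (F : LFunctor C D) {M N : C.carrier} (p : PMap M N) :
    (F.mapPMap p).incl = F.map p.incl := by
  unfold PMap.incl mapPMap
  rw [← F.map_η, F.map_comp, eqToHom_map, Category.assoc, eqToHom_trans]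

lemma mapPMap_rel (F : LFunctor C D) {M N : C.carrier} {p q : PMap M N} (h : PMap.Rel p q) :
    PMap.Rel (F.mapPMap p) (F.mapPMap q) := by
  obtain ⟨e, h1, h2⟩ := h
  refine ⟨F.toFunctor.mapIso e, ?_, ?_⟩
  · rw [incl_mapPMap, incl_mapPMap, ← h1, F.map_comp]
    rfl
  · exact (F.map_comp _ _).symm.trans (congrArg (fun t => F.map t) h2)

lemma map_isPullback' (F : LFunctor C D) {P M N Q : C.carrier} {m : P ⟶ N} {k : P ⟶ M} {f : N ⟶ Q}
    (e : L M = Q) (h : IsPullback m k f (η M ≫ eqToHom e)) :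
    IsPullback (F.map m) (F.map k) (F.map f) (F.map (η M ≫ eqToHom e)) := by
  subst e
  rw [eqToHom_refl, Category.comp_id] at h ⊢
  exact F.map_isPullback h

lemma mapPMap_isComp (F : LFunctor C D) {M N P : C.carrier} {p : PMap M N} {q : PMap N P}
    {r : PMap M P} (h : PMap.IsComp p q r) :
    PMap.IsComp (F.mapPMap p) (F.mapPMap q) (F.mapPMap r) := by
  obtain ⟨m, k, h, h1, h2⟩ := h
  refine ⟨F.map m, F.map k, ?_, ?_, ?_⟩
  · rw [incl_mapPMap]
    exact F.map_isPullback' q.L_dom h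
  · rw [incl_mapPMap, incl_mapPMap, ← h1, F.map_comp]
  · exact (F.map_comp _ _).symm.trans (congrArg (fun t => F.map t) h2)

/-- The underlying functor of the restriction functor induced by a local functor. -/
noncomputable def toRestrictionFunctor (F : LFunctor C D) : RObj C ⥤ RObj D where
  obj M := ⟨F.obj M.obj, F.isTotalObj M.total⟩
  map f := Quotient.map (fun p => F.mapPMap p) (fun _ _ h => F.mapPMap_rel h) f
  map_id M := congrArg (Quotient.mk _) (by
    have h : F.map (𝟙 M.obj) = 𝟙 (F.obj M.obj) := F.map_id _
    change (⟨F.obj M.obj, _, F.map (𝟙 M.obj)⟩ : PMap (F.obj M.obj) (F.obj M.obj)) = _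
    rw [h])
  map_comp f g := by
    obtain ⟨p, rfl⟩ := RObj.cls_surj f
    obtain ⟨q, rfl⟩ := RObj.cls_surj g
    obtain ⟨r, hr⟩ := PMap.exists_isComp p q
    rw [RObj.cls_comp hr]
    exact (RObj.compQ_eq (F.mapPMap_isComp hr)).symm

/-- The restriction functor induced by a local functor: `M ↦ F M`, `(U, f) ↦ (F U, F f)`. -/
noncomputable def toRestriction (F : LFunctor C D) :
    RFunctor C.toRestriction D.toRestriction where
  toFunctor := F.toRestrictionFunctor
  map_rest f := Quotient.inductionOn f fun p => congrArg (Quotient.mk _) (by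
    have h : F.mapPMap p.restr = (F.mapPMap p).restr := by
      have h1 := F.incl_mapPMap p
      change _ = (⟨_, _, (F.mapPMap p).incl⟩ : PMap _ _)
      rw [h1]
    exact h)

/-- The restriction natural transformation induced by a local natural transformation, with
component `(F M, φ M)` at `M`. -/
noncomputable def natToRestriction {F G : LFunctor C D} (φ : F ⟶ G) :
    RNat F.toRestriction G.toRestriction where
  app M := RObj.cls (M := ⟨F.obj M.obj, F.isTotalObj M.total⟩)
    (N := ⟨G.obj M.obj, G.isTotalObj M.total⟩)
    (PMap.ofHom (F.isTotalObj M.total) (NatTrans.app φ M.obj))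
  total M := congrArg (Quotient.mk _) (by
    have h := PMap.incl_ofHom (F.isTotalObj M.total) (NatTrans.app φ M.obj)
    change (⟨F.obj M.obj, (F.isTotalObj M.total).1, (PMap.ofHom (F.isTotalObj M.total)
      (NatTrans.app φ M.obj)).incl⟩ : PMap (F.obj M.obj) (F.obj M.obj)) = _
    rw [h]
    rfl)
  naturality {M N} f := by
    obtain ⟨p, rfl⟩ := RObj.cls_surj f
    have h1 := PMap.isComp_ofHom (F.mapPMap p) (F.isTotalObj N.total) (NatTrans.app φ N.obj)
    have h2 := PMap.isComp_ofHom (F.mapPMap p.restr) (F.isTotalObj M.total)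
      (NatTrans.app φ M.obj)
    have h3 := PMap.isComp_of_factor
      ⟨(F.mapPMap p.restr).dom, (F.mapPMap p.restr).L_dom,
        (F.mapPMap p.restr).arr ≫ NatTrans.app φ M.obj⟩ (G.mapPMap p) (NatTrans.app φ p.dom) (by
        rw [G.incl_mapPMap]
        exact (NatTrans.naturality φ p.incl).symm)
    refine (RObj.compQ_eq h1).trans (Eq.trans ?_ (RObj.compQ_assoc _ _ _))
    refine Eq.trans ?_ (((congrArg (fun t => RObj.compQ t _) (RObj.compQ_eq h2)).trans
      (RObj.compQ_eq h3)).symm)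
    have h4 : (F.mapPMap p).arr ≫ NatTrans.app φ N.obj =
        NatTrans.app φ p.dom ≫ (G.mapPMap p).arr := NatTrans.naturality φ p.arr
    rw [h4]

end LFunctor

/-- The 2-functor from local categories to restriction categories. -/
noncomputable def toRestriction2 : StrictPseudofunctor LCat.{v, u} RCat.{max u v, u} :=
  StrictPseudofunctor.mk''
    { obj := LCat.toRestriction
      map := fun F => LFunctor.toRestriction F
      map₂ := fun φ => LFunctor.natToRestriction φ
      map₂_id := fun F => RCat.RNat_ext fun M => rfl
      map₂_comp := fun {X Y F G H} φ ψ => RCat.RNat_ext fun M =>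
        (RObj.compQ_eq (PMap.isComp_ofHom (PMap.ofHom (F.isTotalObj M.total)
          (NatTrans.app φ M.obj)) (G.isTotalObj M.total) (NatTrans.app ψ M.obj))).symm
      map_id := fun C => RCat.RFunctor_ext (fun _ => rfl) (fun f => by
        obtain ⟨p, rfl⟩ := RObj.cls_surj f
        rfl)
      map_comp := fun F G => RCat.RFunctor_ext (fun _ => rfl) (fun f => by
        obtain ⟨p, rfl⟩ := RObj.cls_surj f
        rfl)
      map₂_whisker_left := fun {X Y Z} F {G H} φ => RCat.RNat_ext fun M => by
        erw [RCat.comp₂_app, RCat.comp₂_app, RCat.eqToHom_app, RCat.eqToHom_app]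
        exact ((Category.id_comp _).trans (Category.comp_id _)).symm
      map₂_whisker_right := fun {X Y Z F G} φ H => RCat.RNat_ext fun M => by
        erw [RCat.comp₂_app, RCat.comp₂_app, RCat.eqToHom_app, RCat.eqToHom_app]
        exact ((Category.id_comp _).trans (Category.comp_id _)).symm }

/-! ### 2-categorical notions -/

section TwoCategories

universe w₁ v₁ u₁ w₂ v₂ u₂

/-- `T` is a 2-terminal object: every hom-category into `T` is isomorphic to the terminal
category. -/
def IsTwoTerminal {B : Type u₁} [Bicategory.{w₁, v₁} B] (T : B) : Prop :=
  ∀ X : B, (∃ t : X ⟶ T, ∀ f : X ⟶ T, f = t) ∧ ∀ f g : X ⟶ T, ∃ α : f ⟶ g, ∀ β : f ⟶ g, β = α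

/-- `p` and `q` exhibit `P` as a 2-product: composition with them is an isomorphism of categories
from `(X ⟶ P)` to `(X ⟶ A) × (X ⟶ A')`. -/
def IsTwoProduct {B : Type u₁} [Bicategory.{w₁, v₁} B] {P A A' : B} (p : P ⟶ A) (q : P ⟶ A') :
    Prop :=
  ∀ X : B, (∀ (f : X ⟶ A) (g : X ⟶ A'), ∃! h : X ⟶ P, h ≫ p = f ∧ h ≫ q = g) ∧
    ∀ (h k : X ⟶ P) (α : h ≫ p ⟶ k ≫ p) (β : h ≫ q ⟶ k ≫ q),
      ∃! γ : h ⟶ k, γ ▷ p = α ∧ γ ▷ q = β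

/-- A 2-category has finite 2-products. -/
def HasFiniteTwoProducts (B : Type u₁) [Bicategory.{w₁, v₁} B] : Prop :=
  (∃ T : B, IsTwoTerminal T) ∧
    ∀ A A' : B, ∃ (P : B) (p : P ⟶ A) (q : P ⟶ A'), IsTwoProduct p q

/-- A Cartesian object: the terminal morphism and the diagonal morphism have right adjoints. -/
def IsCartesianObject {B : Type u₁} [Bicategory.{w₁, v₁} B] (X : B) : Prop :=
  (∃ (T : B) (t : X ⟶ T), IsTwoTerminal T ∧ IsLeftAdjoint t) ∧
    ∃ (P : B) (p q : P ⟶ X) (d : X ⟶ P), IsTwoProduct p q ∧ d ≫ p = 𝟙 X ∧ d ≫ q = 𝟙 X ∧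
      IsLeftAdjoint d

/-- A 1-cell that is an isomorphism. -/
def IsIsoCell {B : Type u₁} [Bicategory.{w₁, v₁} B] {a b : B} (f : a ⟶ b) : Prop :=
  ∃ g : b ⟶ a, f ≫ g = 𝟙 a ∧ g ≫ f = 𝟙 b

/-- A 1-cell that is an internal equivalence. -/
def IsEquivalenceCell {B : Type u₁} [Bicategory.{w₁, v₁} B] {a b : B} (f : a ⟶ b) : Prop :=
  ∃ g : b ⟶ a, Nonempty (f ≫ g ≅ 𝟙 a) ∧ Nonempty (g ≫ f ≅ 𝟙 b)

/-- A (strict) 2-natural transformation between 2-functors. -/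
structure TwoNatTrans {B : Type u₁} [Bicategory.{w₁, v₁} B] {C : Type u₂} [Bicategory.{w₂, v₂} C]
    (F G : StrictPseudofunctor B C) where
  app : ∀ a : B, F.obj a ⟶ G.obj a
  naturality : ∀ {a b : B} (f : a ⟶ b), F.map f ≫ app b = app a ≫ G.map f
  naturality₂ : ∀ {a b : B} {f g : a ⟶ b} (α : f ⟶ g),
    F.map₂ α ▷ app b ≫ eqToHom (naturality g) = eqToHom (naturality f) ≫ app a ◁ G.map₂ α

/-- The 2-functors `F` and `G` form a 2-equivalence: there are 2-natural transformations
`unit : 𝟙 ⟶ G F` and `counit : F G ⟶ 𝟙` which satisfy the triangle identities strictly and whose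
components are internal equivalences. -/
structure TwoEquivalence {B : Type u₁} [Bicategory.{w₁, v₁} B] {C : Type u₂}
    [Bicategory.{w₂, v₂} C] (F : StrictPseudofunctor B C) (G : StrictPseudofunctor C B) where
  unit : TwoNatTrans (StrictPseudofunctor.id B) (F.comp G)
  counit : TwoNatTrans (G.comp F) (StrictPseudofunctor.id C)
  left_triangle : ∀ b : B, F.map (unit.app b) ≫ counit.app (F.obj b) = 𝟙 (F.obj b)
  right_triangle : ∀ c : C, unit.app (G.obj c) ≫ G.map (counit.app c) = 𝟙 (G.obj c)
  unit_equivalence : ∀ b : B, IsEquivalenceCell (unit.app b)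
  counit_equivalence : ∀ c : C, IsEquivalenceCell (counit.app c)

/-- Data of a locally full 2-subcategory: a class of objects, and a class of 1-cells closed under
identities and composition. All 2-cells are kept. -/
structure SubTwoCat (B : Type u₁) [Bicategory.{w₁, v₁} B] where
  IsObj : B → Prop
  IsHom : ∀ {a b : B}, (a ⟶ b) → Prop
  id_mem : ∀ a : B, IsHom (𝟙 a)
  comp_mem : ∀ {a b c : B} {f : a ⟶ b} {g : b ⟶ c}, IsHom f → IsHom g → IsHom (f ≫ g)

namespace SubTwoCat

variable {B : Type u₁} [Bicategory.{w₁, v₁} B] {C : Type u₂} [Bicategory.{w₂, v₂} C]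

/-- Objects of a locally full 2-subcategory. -/
structure Obj (S : SubTwoCat B) where
  obj : B
  mem : S.IsObj obj

/-- 1-cells of a locally full 2-subcategory. -/
@[ext]
structure Hom {S : SubTwoCat B} (a b : S.Obj) where
  hom : a.obj ⟶ b.obj
  mem : S.IsHom hom

variable {S : SubTwoCat B} {T : SubTwoCat C}

instance homCategory (a b : S.Obj) : Category (Hom a b) where
  Hom f g := f.hom ⟶ g.hom
  id f := 𝟙 f.hom
  comp α β := CategoryStruct.comp (obj := a.obj ⟶ b.obj) α β
  id_comp _ := Category.id_comp (obj := a.obj ⟶ b.obj) _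
  comp_id _ := Category.comp_id (obj := a.obj ⟶ b.obj) _
  assoc _ _ _ := Category.assoc (obj := a.obj ⟶ b.obj) _ _ _

/-- Invertible 2-cells of the ambient 2-category are invertible in the 2-subcategory. -/
def isoMk {a b : S.Obj} {f g : Hom a b} (α : f.hom ≅ g.hom) : f ≅ g where
  hom := α.hom
  inv := α.inv
  hom_inv_id := α.hom_inv_id
  inv_hom_id := α.inv_hom_id

instance bicategory : Bicategory S.Obj where
  Hom a b := Hom a b
  id a := ⟨𝟙 a.obj, S.id_mem _⟩
  comp f g := ⟨f.hom ≫ g.hom, S.comp_mem f.mem g.mem⟩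
  homCategory := homCategory
  whiskerLeft {_ _ _} f {_ _} α := Bicategory.whiskerLeft (B := B) f.hom α
  whiskerRight {_ _ _} {_ _} α h := Bicategory.whiskerRight (B := B) α h.hom
  associator f g h := isoMk (α_ f.hom g.hom h.hom)
  leftUnitor f := isoMk (λ_ f.hom)
  rightUnitor f := isoMk (ρ_ f.hom)
  whiskerLeft_id _ _ := Bicategory.whiskerLeft_id (B := B) _ _
  whiskerLeft_comp _ _ _ _ _ _ := Bicategory.whiskerLeft_comp (B := B) _ _ _
  id_whiskerLeft _ := Bicategory.id_whiskerLeft (B := B) _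
  comp_whiskerLeft _ _ _ _ _ := Bicategory.comp_whiskerLeft (B := B) _ _ _
  id_whiskerRight _ _ := Bicategory.id_whiskerRight (B := B) _ _
  comp_whiskerRight _ _ _ := Bicategory.comp_whiskerRight (B := B) _ _ _
  whiskerRight_id _ := Bicategory.whiskerRight_id (B := B) _
  whiskerRight_comp _ _ _ := Bicategory.whiskerRight_comp (B := B) _ _ _
  whisker_assoc _ _ _ _ _ := Bicategory.whisker_assoc (B := B) _ _ _
  whisker_exchange _ _ := Bicategory.whisker_exchange (B := B) _ _
  pentagon _ _ _ _ := Bicategory.pentagon (B := B) _ _ _ _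
  triangle _ _ := Bicategory.triangle (B := B) _ _

lemma eqToHom_eq {a b : S.Obj} {f g : Hom a b} (h : f = g) :
    (eqToHom h : f ⟶ g) = (eqToHom (congrArg Hom.hom h) : f.hom ⟶ g.hom) := by
  subst h
  rfl

lemma isoMk_eqToIso {a b : S.Obj} {f g : Hom a b} (h : f = g) :
    isoMk (eqToIso (congrArg Hom.hom h)) = eqToIso h := by
  subst h
  rfl

instance strict [Bicategory.Strict B] : Bicategory.Strict S.Obj where
  id_comp f := Hom.ext (Bicategory.Strict.id_comp f.hom)
  comp_id f := Hom.ext (Bicategory.Strict.comp_id f.hom)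
  assoc f g h := Hom.ext (Bicategory.Strict.assoc f.hom g.hom h.hom)
  leftUnitor_eqToIso f := (congrArg isoMk (Bicategory.Strict.leftUnitor_eqToIso f.hom)).trans
    (isoMk_eqToIso (f := (⟨𝟙 _ ≫ f.hom, _⟩ : Hom _ _)) (g := f) _)
  rightUnitor_eqToIso f := (congrArg isoMk (Bicategory.Strict.rightUnitor_eqToIso f.hom)).trans
    (isoMk_eqToIso (f := (⟨f.hom ≫ 𝟙 _, _⟩ : Hom _ _)) (g := f) _)
  associator_eqToIso f g h :=
    (congrArg isoMk (Bicategory.Strict.associator_eqToIso f.hom g.hom h.hom)).trans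
    (isoMk_eqToIso (f := (⟨(f.hom ≫ g.hom) ≫ h.hom, _⟩ : Hom _ _))
      (g := (⟨f.hom ≫ g.hom ≫ h.hom, _⟩ : Hom _ _)) _)

/-- A 2-functor sends a 2-subcategory into another one. -/
structure MapsTo (F : StrictPseudofunctor B C) (S : SubTwoCat B) (T : SubTwoCat C) : Prop where
  obj : ∀ {a : B}, S.IsObj a → T.IsObj (F.obj a)
  hom : ∀ {a b : B} {f : a ⟶ b}, S.IsObj a → S.IsObj b → S.IsHom f → T.IsHom (F.map f)

/-- The 2-functor between 2-subcategories obtained by restricting a 2-functor. -/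
def restrict [Bicategory.Strict B] [Bicategory.Strict C] (F : StrictPseudofunctor B C)
    (h : MapsTo F S T) : StrictPseudofunctor S.Obj T.Obj :=
  StrictPseudofunctor.mk''
    { obj := fun a => ⟨F.obj a.obj, h.obj a.mem⟩
      map := fun {a b} f => ⟨F.map f.hom, h.hom a.mem b.mem f.mem⟩
      map₂ := fun {_ _} {f g} α => F.map₂ (f := f.hom) (g := g.hom) α
      map₂_id := fun _ => F.map₂_id _
      map₂_comp := fun _ _ => F.map₂_comp _ _
      map_id := fun _ => Hom.ext (F.map_id _)
      map_comp := fun _ _ => Hom.ext (F.map_comp _ _)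
      map₂_whisker_left := fun {_ _ _} f {g g'} η => by
        have h1 := F.map₂_whisker_left f.hom (g := g.hom) (h := g'.hom) η
        rw [F.mapComp_eq_eqToIso, F.mapComp_eq_eqToIso, eqToIso.hom, eqToIso.inv] at h1
        rw [eqToHom_eq, eqToHom_eq]
        exact h1
      map₂_whisker_right := fun {_ _ _} {f f'} η g => by
        have h1 := F.map₂_whisker_right (f := f.hom) (g := f'.hom) η g.hom
        rw [F.mapComp_eq_eqToIso, F.mapComp_eq_eqToIso, eqToIso.hom, eqToIso.inv] at h1
        rw [eqToHom_eq, eqToHom_eq]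
        exact h1 }

end SubTwoCat

end TwoCategories

/-! ### Cartesian restriction categories and Cartesian local categories -/

namespace RCat

variable {X Y : RCat.{v, u}}

/-- A restriction terminal object. -/
def IsRestrictionTerminal (T : X.carrier) : Prop :=
  (∀ A : X.carrier, ∃! t : A ⟶ T, TotalHom t) ∧
    ∀ {A B : X.carrier} (f : A ⟶ B) (a : A ⟶ T) (b : B ⟶ T), TotalHom a → TotalHom b →
      f ≫ b = rest f ≫ a

/-- `P` with the projections `p` and `q` is a restriction product of `A` and `B`. -/
def IsRestrictionProduct {P A B : X.carrier} (p : P ⟶ A) (q : P ⟶ B) : Prop :=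
  TotalHom p ∧ TotalHom q ∧ ∀ {C : X.carrier} (f : C ⟶ A) (g : C ⟶ B),
    ∃! h : C ⟶ P, h ≫ p = rest g ≫ f ∧ h ≫ q = rest f ≫ g

/-- A Cartesian restriction category. -/
def IsCartesian (X : RCat.{v, u}) : Prop :=
  (∃ T : X.carrier, IsRestrictionTerminal T) ∧
    ∀ A B : X.carrier, ∃ (P : X.carrier) (p : P ⟶ A) (q : P ⟶ B), IsRestrictionProduct p q

/-- A restriction functor that preserves restriction terminal objects and restriction products. -/
def PreservesCartesian (F : RFunctor X Y) : Prop :=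
  (∀ T : X.carrier, IsRestrictionTerminal T → IsRestrictionTerminal (F.obj T)) ∧
    ∀ {P A B : X.carrier} (p : P ⟶ A) (q : P ⟶ B), IsRestrictionProduct p q →
      IsRestrictionProduct (F.map p) (F.map q)

/-- The 2-subcategory of Cartesian restriction categories. -/
def cartesian : SubTwoCat RCat.{v, u} where
  IsObj X := IsCartesian X
  IsHom F := PreservesCartesian F
  id_mem _ := ⟨fun _ h => h, fun _ _ h => h⟩
  comp_mem hF hG := ⟨fun _ h => hG.1 _ (hF.1 _ h), fun _ _ h => hG.2 _ _ (hF.2 _ _ h)⟩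

end RCat

namespace LCat

variable {C D : LCat.{v, u}}

/-- A local terminal object: a total object which is terminal. -/
def IsLocalTerminal (T : C.carrier) : Prop :=
  IsTotalObj T ∧ Nonempty (Limits.IsTerminal T)

/-- `P` with the projections `p` and `q` is a local product of `M` and `N`: it is a product of `M`
and `N`, and `L P` is a product of `L M` and `L N` in such a way that `η P` is `η M × η N`. -/
def IsLocalProduct {P M N : C.carrier} (p : P ⟶ M) (q : P ⟶ N) : Prop :=
  Nonempty (Limits.IsLimit (Limits.BinaryFan.mk p q)) ∧
    ∃ (p' : L P ⟶ L M) (q' : L P ⟶ L N), Nonempty (Limits.IsLimit (Limits.BinaryFan.mk p' q')) ∧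
      η P ≫ p' = p ≫ η M ∧ η P ≫ q' = q ≫ η N

/-- A Cartesian local category. -/
def IsCartesian (C : LCat.{v, u}) : Prop :=
  (∃ T : C.carrier, IsLocalTerminal T) ∧
    ∀ M N : C.carrier, ∃ (P : C.carrier) (p : P ⟶ M) (q : P ⟶ N), IsLocalProduct p q

/-- A local functor that preserves local terminal objects and local products. -/
def PreservesCartesian (F : LFunctor C D) : Prop :=
  (∀ T : C.carrier, IsLocalTerminal T → IsLocalTerminal (F.obj T)) ∧
    ∀ {P M N : C.carrier} (p : P ⟶ M) (q : P ⟶ N), IsLocalProduct p q →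
      IsLocalProduct (F.map p) (F.map q)

/-- The 2-subcategory of Cartesian local categories. -/
def cartesian : SubTwoCat LCat.{v, u} where
  IsObj C := IsCartesian C
  IsHom F := PreservesCartesian F
  id_mem _ := ⟨fun _ h => h, fun _ _ h => h⟩
  comp_mem hF hG := ⟨fun _ h => hG.1 _ (hF.1 _ h), fun _ _ h => hG.2 _ _ (hF.2 _ _ h)⟩

end LCat

/-! ### Finite 2-products of local categories -/

section Product

variable {C : Type*} [Category* C] {D : Type*} [Category* D]

/-! Finite 2-products of local categories are computed on underlying categories, because a square in
a product category is a pullback exactly when both components are. An adjunction in the 2-category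
is an ordinary adjunction whose two functors are local. A local right adjoint of the map to the
point therefore picks a total terminal object. A local right adjoint `S` of the diagonal gives
binary products with `S (L M, L N) = L (S (M, N))`, and these are local products
(`exists_isLocalProduct_of_adjunction`). Conversely, local products are only given up to
isomorphism, while a local functor must preserve `L` strictly. `exists_strict_products` resolves
this: products are chosen for total pairs first, and every other product is cut out of the chosen
product of the enlargements by pullbacks of maximal inclusions, which do not change the enlargement.

For the 2-equivalence, the unit sends `M` to `(L M, (M, η M))`. It is fully faithful, because a
partial map `L M ⟶ L N` with domain `M` and values in `N` is just a map `M ⟶ N`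
(`exists_eq_unitMap`, `unitMap_injective`). It is surjective on objects, because a restriction
idempotent is the class of some `(U, η U)` (`exists_unitObj_eq`). It has a pseudo-inverse that is a
local functor, once preimages are chosen compatibly with `L`. The counit is even invertible: the
total objects of the local category of `X` are the `(A, 𝟙)`, and a partial map between them is
determined by one morphism of `X` (`exists_eq_jObj`, `exists_eq_jMap`, `kMap_jMap`). Strict
naturality and the triangle identities hold because local functors preserve `L` and `η` on the nose.

For the Cartesian restriction, total maps in the restriction category of `C` are maps of `C` between
total objects, and restriction products there are the ordinary products of `C` with total vertex and
factors (`RObj.isRestrictionProduct_of_isLimit`, `RObj.isLimit_of_isRestrictionProduct`). In the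
other direction, `LObj.isLocalProduct_iff` describes local products by a restriction product of the
underlying objects and equations between restriction idempotents, which every Cartesian restriction
functor preserves. Finally, the unit, its pseudo-inverses and the counit preserve the Cartesian
structure, being equivalences or isomorphisms, so the 2-equivalence restricts with the same
components. -/

lemma isPullback_of_existsUnique {P X Y Z : C} {m : P ⟶ X} {k : P ⟶ Y} {f : X ⟶ Z} {g : Y ⟶ Z}
    (w : m ≫ f = k ≫ g)
    (h : ∀ {W : C} (a : W ⟶ X) (b : W ⟶ Y), a ≫ f = b ≫ g → ∃! t : W ⟶ P, t ≫ m = a ∧ t ≫ k = b) :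
    IsPullback m k f g :=
  IsPullback.mk' w
    (fun _ a b h1 h2 => (h (b ≫ m) (b ≫ k) (by simp [w])).unique ⟨h1, h2⟩ ⟨rfl, rfl⟩)
    (fun _ a b hab => (h a b hab).exists)

/-- A cone on the first components is completed to a cone in `C × D` with vertex `(W, P.2)` by using
the given projections `m.2`, `k.2` as second components. Uniqueness follows by completing a
candidate with the identity of `P.2`. -/
lemma IsPullback.prod_fst {P X Y Z : C × D} {m : P ⟶ X} {k : P ⟶ Y} {f : X ⟶ Z} {g : Y ⟶ Z}
    (h : IsPullback m k f g) : IsPullback m.1 k.1 f.1 g.1 := by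
  have w := h.w
  have w2 : m.2 ≫ f.2 = k.2 ≫ g.2 := congrArg Prod.snd w
  refine isPullback_of_existsUnique (congrArg Prod.fst w) fun {W} a b hab => ?_
  have hs : ((a, m.2) : (W, P.2) ⟶ X) ≫ f = ((b, k.2) : (W, P.2) ⟶ Y) ≫ g :=
    Prod.hom_ext hab w2
  refine ⟨(h.lift _ _ hs).1, ⟨congrArg Prod.fst (h.lift_fst _ _ hs),
    congrArg Prod.fst (h.lift_snd _ _ hs)⟩, fun t ht => ?_⟩
  have ht' : ((t, 𝟙 _) : (W, P.2) ⟶ P) = h.lift _ _ hs := by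
    refine h.hom_ext ?_ ?_
    · rw [h.lift_fst]
      exact Prod.hom_ext ht.1 (Category.id_comp _)
    · rw [h.lift_snd]
      exact Prod.hom_ext ht.2 (Category.id_comp _)
  exact congrArg Prod.fst ht'

lemma IsPullback.prod_snd {P X Y Z : C × D} {m : P ⟶ X} {k : P ⟶ Y} {f : X ⟶ Z} {g : Y ⟶ Z}
    (h : IsPullback m k f g) : IsPullback m.2 k.2 f.2 g.2 :=
  IsPullback.prod_fst (h.map (CategoryTheory.Prod.swap C D))

lemma IsPullback.prod_mk {P X Y Z : C × D} {m : P ⟶ X} {k : P ⟶ Y} {f : X ⟶ Z} {g : Y ⟶ Z}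
    (h1 : IsPullback m.1 k.1 f.1 g.1) (h2 : IsPullback m.2 k.2 f.2 g.2) : IsPullback m k f g := by
  refine isPullback_of_existsUnique (Prod.hom_ext h1.w h2.w) fun {W} a b hab => ?_
  have e1 : a.1 ≫ f.1 = b.1 ≫ g.1 := congrArg Prod.fst hab
  have e2 : a.2 ≫ f.2 = b.2 ≫ g.2 := congrArg Prod.snd hab
  refine ⟨(h1.lift _ _ e1, h2.lift _ _ e2), ⟨Prod.hom_ext (h1.lift_fst _ _ e1) (h2.lift_fst _ _ e2),
    Prod.hom_ext (h1.lift_snd _ _ e1) (h2.lift_snd _ _ e2)⟩, fun t ht => Prod.hom_ext ?_ ?_⟩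
  · refine h1.hom_ext ?_ ?_
    · exact (congrArg Prod.fst ht.1).trans (h1.lift_fst _ _ e1).symm
    · exact (congrArg Prod.fst ht.2).trans (h1.lift_snd _ _ e1).symm
  · refine h2.hom_ext ?_ ?_
    · exact (congrArg Prod.snd ht.1).trans (h2.lift_fst _ _ e2).symm
    · exact (congrArg Prod.snd ht.2).trans (h2.lift_snd _ _ e2).symm

instance LocalStructure.prod [LocalStructure C] [LocalStructure D] : LocalStructure (C × D) where
  L M := (L M.1, L M.2)
  η M := (η M.1, η M.2)
  L_L M := Prod.ext (L_L M.1) (L_L M.2)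
  η_L M := Prod.hom_ext (by rw [eqToHom_fst]; exact η_L M.1) (by rw [eqToHom_snd]; exact η_L M.2)
  η_mono M := ⟨fun g h w => by
    have := η_mono M.1
    have := η_mono M.2
    exact Prod.hom_ext ((cancel_mono (η M.1)).1 (congrArg Prod.fst w))
      ((cancel_mono (η M.2)).1 (congrArg Prod.snd w))⟩
  exists_pullback {M N} f := by
    obtain ⟨P, m, k, h, hp, hm⟩ := exists_pullback (M := M.1) (N := N.1) f.1
    obtain ⟨P', m', k', h', hp', hm'⟩ := exists_pullback (M := M.2) (N := N.2) f.2
    refine ⟨(P, P'), (m, m'), (k, k'), Prod.ext h h', IsPullback.prod_mk hp hp',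
      Prod.hom_ext ?_ ?_⟩
    · rw [CategoryTheory.prod_comp_fst, CategoryTheory.prod_comp_fst, eqToHom_fst]
      exact hm
    · rw [CategoryTheory.prod_comp_snd, CategoryTheory.prod_comp_snd, eqToHom_snd]
      exact hm'

end Product

lemma LFunctor.ext_toFunctor {C D : LCat.{v, u}} {F G : LFunctor C D}
    (h : F.toFunctor = G.toFunctor) : F = G := by
  cases F
  cases G
  congr

/-! ### The 2-terminal local category and binary 2-products -/

namespace LCat

/-- The category with one object and one morphism. -/
structure Point : Type u where

instance : Category.{v} Point.{u} where
  Hom _ _ := PUnit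
  id _ := ⟨⟩
  comp _ _ := ⟨⟩

instance {M N : Point.{u}} (f : M ⟶ N) : IsIso f := ⟨⟨PUnit.unit, rfl, rfl⟩⟩

lemma Point.isPullback {P M N Q : Point.{u}} (m : P ⟶ M) (k : P ⟶ N) (f : M ⟶ Q) (g : N ⟶ Q) :
    IsPullback m k f g := IsPullback.of_horiz_isIso ⟨rfl⟩

instance : LocalStructure Point.{u} where
  L M := M
  η _ := 𝟙 _
  L_L _ := rfl
  η_L _ := rfl
  η_mono _ := inferInstance
  exists_pullback f := ⟨_, 𝟙 _, f, rfl, IsPullback.of_horiz_isIso ⟨rfl⟩, rfl⟩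

/-- The terminal local category. -/
def point : LCat.{v, u} := ⟨Point.{u}⟩

/-- The local functor to the terminal local category. -/
def toPoint (C : LCat.{v, u}) : LFunctor C point.{v, u} where
  obj _ := Point.mk
  map _ := 𝟙 _
  map_id _ := rfl
  map_comp _ _ := rfl
  obj_L _ := rfl
  map_η _ := rfl
  map_isPullback _ := Point.isPullback _ _ _ _

lemma isTwoTerminal_point : IsTwoTerminal point.{v, u} := fun C =>
  ⟨⟨toPoint C, fun _ => LFunctor.ext_toFunctor rfl⟩,
    fun _ _ => ⟨NatTrans.mk (fun _ => PUnit.unit) (fun _ _ _ => rfl), fun _ => rfl⟩⟩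

/-- The product of two local categories. -/
def prod (C D : LCat.{v, u}) : LCat.{v, u} := ⟨C.carrier × D.carrier⟩

/-- The first projection. -/
def fst (C D : LCat.{v, u}) : LFunctor (prod C D) C where
  toFunctor := CategoryTheory.Prod.fst C.carrier D.carrier
  obj_L _ := rfl
  map_η _ := Category.comp_id _
  map_isPullback h := IsPullback.prod_fst h

/-- The second projection. -/
def snd (C D : LCat.{v, u}) : LFunctor (prod C D) D where
  toFunctor := CategoryTheory.Prod.snd C.carrier D.carrier
  obj_L _ := rfl
  map_η _ := Category.comp_id _
  map_isPullback h := IsPullback.prod_snd h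

/-- The pairing of local functors. -/
def pair {B C D : LCat.{v, u}} (F : LFunctor B C) (G : LFunctor B D) : LFunctor B (prod C D) where
  toFunctor := F.toFunctor.prod' G.toFunctor
  obj_L M := Prod.ext (F.obj_L M) (G.obj_L M)
  map_η M := Prod.hom_ext ((congrArg (fun t => F.map (η M) ≫ t) (eqToHom_fst _)).trans (F.map_η M))
    ((congrArg (fun t => G.map (η M) ≫ t) (eqToHom_snd _)).trans (G.map_η M))
  map_isPullback h := IsPullback.prod_mk (F.map_isPullback h) (G.map_isPullback h)

lemma isTwoProduct_prod (C D : LCat.{v, u}) :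
    IsTwoProduct (B := LCat.{v, u}) (P := prod C D) (fst C D) (snd C D) := by
  refine fun B => ⟨fun F G => ⟨pair F G, ⟨rfl, rfl⟩, ?_⟩, fun H K φ ψ => ?_⟩
  · rintro H ⟨rfl, rfl⟩
    rfl
  · let χ : H ⟶ K := NatTrans.mk (F := LFunctor.toFunctor H) (G := LFunctor.toFunctor K)
      (fun M => (NatTrans.app φ M, NatTrans.app ψ M))
      (fun M N f => Prod.hom_ext (NatTrans.naturality φ f) (NatTrans.naturality ψ f))
    refine ⟨χ, ⟨rfl, rfl⟩, ?_⟩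
    rintro χ' ⟨rfl, rfl⟩
    rfl

lemma hasFiniteTwoProducts : HasFiniteTwoProducts LCat.{v, u} :=
  ⟨⟨point, isTwoTerminal_point⟩, fun C D => ⟨prod C D, fst C D, snd C D, isTwoProduct_prod C D⟩⟩

end LCat

/-! ### Cartesian objects -/

lemma nonempty_isLimit_binaryFan_iff {C : Type*} [Category* C] {P M N : C} (p : P ⟶ M)
    (q : P ⟶ N) : Nonempty (Limits.IsLimit (Limits.BinaryFan.mk p q)) ↔
      ∀ {X : C} (f : X ⟶ M) (g : X ⟶ N), ∃! h : X ⟶ P, h ≫ p = f ∧ h ≫ q = g := by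
  constructor
  · rintro ⟨hl⟩ X f g
    obtain ⟨h, h1, h2⟩ := Limits.BinaryFan.IsLimit.lift' hl f g
    exact ⟨h, ⟨h1, h2⟩, fun k hk => Limits.BinaryFan.IsLimit.hom_ext hl (hk.1.trans h1.symm)
      (hk.2.trans h2.symm)⟩
  · intro h
    choose l hl hu using @h
    exact ⟨Limits.BinaryFan.IsLimit.mk _ (fun f g => l f g) (fun f g => (hl f g).1)
      (fun f g => (hl f g).2) (fun f g m h1 h2 => hu f g m ⟨h1, h2⟩)⟩

lemma isLimit_binaryFan_of_iso {C : Type*} [Category* C] {P M N P' M' N' : C} {p : P ⟶ M}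
    {q : P ⟶ N} (h : Nonempty (Limits.IsLimit (Limits.BinaryFan.mk p q))) (e : P' ≅ P) (a : M ≅ M')
    (b : N ≅ N') : Nonempty (Limits.IsLimit (Limits.BinaryFan.mk (e.hom ≫ p ≫ a.hom)
      (e.hom ≫ q ≫ b.hom))) := by
  rw [nonempty_isLimit_binaryFan_iff] at h ⊢
  intro X f g
  obtain ⟨k, ⟨h1, h2⟩, hu⟩ := h (f ≫ a.inv) (g ≫ b.inv)
  refine ⟨k ≫ e.inv, ⟨by simp [reassoc_of% h1], by simp [reassoc_of% h2]⟩, fun l hl => ?_⟩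
  rw [← hu (l ≫ e.hom) ⟨by simp [← hl.1], by simp [← hl.2]⟩]
  simp

/-! ### Cartesian objects do not depend on the chosen 2-terminal object and 2-product -/

section Bicategory

variable {B : Type*} [Bicategory B]

/-- An invertible 1-cell is left adjoint to its inverse. -/
lemma exists_adjunction_of_inverse {a b : B} {f : a ⟶ b} {g : b ⟶ a} (h : f ≫ g = 𝟙 a)
    (h' : g ≫ f = 𝟙 b) : Nonempty (Bicategory.Adjunction f g) :=
  let e := Bicategory.Equivalence.mkOfAdjointifyCounit (eqToIso h.symm) (eqToIso h')
  ⟨⟨e.unit.hom, e.counit.hom, e.left_triangle_hom, e.right_triangle_hom⟩⟩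

lemma IsLeftAdjoint.comp_inverse {a b c : B} {t : a ⟶ b} (ht : IsLeftAdjoint t) {f : b ⟶ c}
    {g : c ⟶ b} (h : f ≫ g = 𝟙 b) (h' : g ≫ f = 𝟙 c) : IsLeftAdjoint (t ≫ f) := by
  obtain ⟨⟨r, adj⟩⟩ := ht
  obtain ⟨adj'⟩ := exists_adjunction_of_inverse h h'
  exact IsLeftAdjoint.mk (adj.comp adj')

lemma IsTwoTerminal.hom_eq {T : B} (h : IsTwoTerminal T) {a : B} (f g : a ⟶ T) : f = g := by
  obtain ⟨⟨t, ht⟩, -⟩ := h a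
  rw [ht f, ht g]

lemma IsTwoProduct.hom_ext {P A A' : B} {p : P ⟶ A} {q : P ⟶ A'} (h : IsTwoProduct p q) {a : B}
    {f g : a ⟶ P} (h1 : f ≫ p = g ≫ p) (h2 : f ≫ q = g ≫ q) : f = g :=
  ((h a).1 (g ≫ p) (g ≫ q)).unique ⟨h1, h2⟩ ⟨rfl, rfl⟩

/-- For a Cartesian object, the terminal morphism to any 2-terminal object and the diagonal
morphism to any 2-product have right adjoints. -/
lemma IsCartesianObject.isLeftAdjoint [Bicategory.Strict B] {X : B} (h : IsCartesianObject X)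
    {T : B} (hT : IsTwoTerminal T) (t : X ⟶ T) {P : B} {p q : P ⟶ X} (hP : IsTwoProduct p q)
    {d : X ⟶ P} (h1 : d ≫ p = 𝟙 X) (h2 : d ≫ q = 𝟙 X) : IsLeftAdjoint t ∧ IsLeftAdjoint d := by
  obtain ⟨⟨T', t', hT', ht'⟩, P', p', q', d', hP', h1', h2', hd'⟩ := h
  constructor
  · obtain ⟨⟨f, -⟩, -⟩ := hT T'
    obtain ⟨⟨g, -⟩, -⟩ := hT' T
    rw [hT.hom_eq t (t' ≫ f)]
    exact IsLeftAdjoint.comp_inverse ht' (hT'.hom_eq (f ≫ g) _) (hT.hom_eq (g ≫ f) _)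
  -- The comparison 1-cells between the two 2-products are strictly inverse to each other, and `d`
  -- is `d'` followed by one of them.
  · obtain ⟨f, ⟨f1, f2⟩, -⟩ := (hP P').1 p' q'
    obtain ⟨g, ⟨g1, g2⟩, -⟩ := (hP' P).1 p q
    have e : d = d' ≫ f := hP.hom_ext (by rw [Bicategory.Strict.assoc, f1, h1, h1'])
      (by rw [Bicategory.Strict.assoc, f2, h2, h2'])
    rw [e]
    refine IsLeftAdjoint.comp_inverse hd' (g := g) (hP'.hom_ext ?_ ?_) (hP.hom_ext ?_ ?_)
    · rw [Bicategory.Strict.assoc, g1, f1, Bicategory.Strict.id_comp]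
    · rw [Bicategory.Strict.assoc, g2, f2, Bicategory.Strict.id_comp]
    · rw [Bicategory.Strict.assoc, f1, g1, Bicategory.Strict.id_comp]
    · rw [Bicategory.Strict.assoc, f2, g2, Bicategory.Strict.id_comp]

/-- The associator implicit in bicategorical composition is made explicit. In the 2-category of
local categories it has identity components, so the zigzag can be evaluated at objects. -/
lemma leftZigzag_eq {a b : B} {f : a ⟶ b} {g : b ⟶ a} (η : 𝟙 a ⟶ f ≫ g) (θ : g ≫ f ⟶ 𝟙 b) :
    leftZigzag η θ = η ▷ f ≫ (α_ f g f).hom ≫ f ◁ θ := by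
  simp [leftZigzag, bicategoricalComp]

lemma rightZigzag_eq {a b : B} {f : a ⟶ b} {g : b ⟶ a} (η : 𝟙 a ⟶ f ≫ g) (θ : g ≫ f ⟶ 𝟙 b) :
    rightZigzag η θ = g ◁ η ≫ (α_ g f g).inv ≫ θ ▷ g := by
  simp [rightZigzag, bicategoricalComp]

end Bicategory

namespace LCat

/-- An adjunction in the 2-category of local categories is an adjunction of underlying functors. -/
def toAdjunction {C D : LCat.{v, u}} {F : C ⟶ D} {G : D ⟶ C} (adj : Bicategory.Adjunction F G) :
    CategoryTheory.Adjunction (LFunctor.toFunctor F) (LFunctor.toFunctor G) where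
  unit := adj.unit
  counit := adj.counit
  left_triangle_components X := by
    have h := congrArg (fun φ => NatTrans.app φ X)
      ((leftZigzag_eq _ _).symm.trans adj.left_triangle)
    exact (congrArg (fun t => _ ≫ t) (Category.id_comp _).symm).trans
      (h.trans (Category.id_comp _))
  right_triangle_components Y := by
    have h := congrArg (fun φ => NatTrans.app φ Y)
      ((rightZigzag_eq _ _).symm.trans adj.right_triangle)
    exact (congrArg (fun t => _ ≫ t) (Category.id_comp _).symm).trans
      (h.trans (Category.id_comp _))

/-- Adjoint functors between local categories that are local functors are adjoint in the
2-category of local categories. -/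
def ofAdjunction {C D : LCat.{v, u}} {F : C ⟶ D} {G : D ⟶ C}
    (adj : CategoryTheory.Adjunction (LFunctor.toFunctor F) (LFunctor.toFunctor G)) :
    Bicategory.Adjunction F G where
  unit := adj.unit
  counit := adj.counit
  left_triangle := (leftZigzag_eq _ _).trans <| hom₂_ext fun X => by
    have h := adj.left_triangle_components X
    change (LFunctor.toFunctor F).map (NatTrans.app adj.unit X) ≫ 𝟙 _ ≫
      NatTrans.app adj.counit ((LFunctor.toFunctor F).obj X) = 𝟙 _ ≫ 𝟙 _
    rw [Category.id_comp, Category.id_comp]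
    exact h
  right_triangle := (rightZigzag_eq _ _).trans <| hom₂_ext fun Y => by
    have h := adj.right_triangle_components Y
    change NatTrans.app adj.unit ((LFunctor.toFunctor G).obj Y) ≫ 𝟙 _ ≫
      (LFunctor.toFunctor G).map (NatTrans.app adj.counit Y) = 𝟙 _ ≫ 𝟙 _
    rw [Category.id_comp, Category.id_comp]
    exact h

/-- The diagonal local functor. -/
def diag (C : LCat.{v, u}) : LFunctor C (prod C C) := pair (idL C) (idL C)

lemma isTotalObj_L {C : LCat.{v, u}} (M : C.carrier) : IsTotalObj (L M) := ⟨L_L M, η_L M⟩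

/-- The counit at `(M, N)` is a pair of projections making `S.obj (M, N)` a product. Since `S`
preserves `L` strictly, `L (S.obj (M, N))` is the product of `L M` and `L N`, and naturality of the
counit at `(η M, η N)` is the compatibility of `η` with the projections. -/
lemma exists_isLocalProduct_of_adjunction {C : LCat.{v, u}} {S : C.carrier × C.carrier ⥤ C.carrier}
    (adj : CategoryTheory.Adjunction (Functor.diag C.carrier) S)
    (hL : ∀ M N, S.obj (L M, L N) = L (S.obj (M, N)))
    (hη : ∀ M N, S.map ((η M, η N) : (M, N) ⟶ (L M, L N)) ≫ eqToHom (hL M N) = η (S.obj (M, N)))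
    (M N : C.carrier) : ∃ (P : C.carrier) (p : P ⟶ M) (q : P ⟶ N), IsLocalProduct p q := by
  let p : ∀ M N, S.obj (M, N) ⟶ M := fun M N => (adj.counit.app (M, N)).1
  let q : ∀ M N, S.obj (M, N) ⟶ N := fun M N => (adj.counit.app (M, N)).2
  have hl : ∀ M N, Nonempty (Limits.IsLimit (Limits.BinaryFan.mk (p M N) (q M N))) := by
    refine fun M N => (nonempty_isLimit_binaryFan_iff _ _).2 fun {X} f g => ?_
    obtain ⟨e, he⟩ : ∃ e : (X ⟶ M) × (X ⟶ N) ≃ (X ⟶ S.obj (M, N)),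
        ∀ h, e.symm h = (h ≫ p M N, h ≫ q M N) :=
      ⟨adj.homEquiv X (M, N), adj.homEquiv_counit _ _⟩
    refine ⟨e (f, g), ?_, fun k hk => ?_⟩
    · have := he (e (f, g))
      rw [e.symm_apply_apply] at this
      exact ⟨(congrArg Prod.fst this).symm, (congrArg Prod.snd this).symm⟩
    · apply e.symm.injective
      rw [e.symm_apply_apply, he, hk.1, hk.2]
  have hn := adj.counit.naturality ((η M, η N) : (M, N) ⟶ (L M, L N))
  refine ⟨S.obj (M, N), p M N, q M N, hl M N, ?_⟩
  rw [← hη]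
  refine ⟨eqToHom (hL M N).symm ≫ p (L M) (L N), eqToHom (hL M N).symm ≫ q (L M) (L N), ?_, ?_, ?_⟩
  -- The enlargement carries the projections of `S.obj (L M, L N)`, transported along the equality
  -- `hL`.
  · simpa using isLimit_binaryFan_of_iso (hl (L M) (L N)) (eqToIso (hL M N).symm) (Iso.refl _)
      (Iso.refl _)
  · simp only [Category.assoc, eqToHom_trans_assoc, eqToHom_refl, Category.id_comp]
    exact congrArg Prod.fst hn
  · simp only [Category.assoc, eqToHom_trans_assoc, eqToHom_refl, Category.id_comp]
    exact congrArg Prod.snd hn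

/-- The right adjoint of the map to the point is a local functor, so it sends the point to a total
object, and the hom-set bijection makes that object terminal. The products come from the right
adjoint of the diagonal. -/
lemma isCartesian_of_isLeftAdjoint {C : LCat.{v, u}}
    (ht : IsLeftAdjoint (B := LCat.{v, u}) (toPoint C))
    (hd : IsLeftAdjoint (B := LCat.{v, u}) (diag C)) : IsCartesian C := by
  obtain ⟨⟨r, adj⟩⟩ := ht
  obtain ⟨⟨s, adj'⟩⟩ := hd
  constructor
  · refine ⟨(LFunctor.toFunctor r).obj Point.mk, LFunctor.isTotalObj r ⟨rfl, rfl⟩, ⟨?_⟩⟩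
    exact Limits.IsTerminal.ofUniqueHom
      (fun M => (toAdjunction adj).homEquiv M Point.mk PUnit.unit)
      (fun M m => ((toAdjunction adj).homEquiv M Point.mk).symm.injective rfl)
  · exact exists_isLocalProduct_of_adjunction (S := LFunctor.toFunctor s) (toAdjunction adj')
      (fun M N => LFunctor.obj_L s (M, N)) (fun M N => LFunctor.map_η s (M, N))

end LCat

/-! ### Chosen binary products and the right adjoint of the diagonal -/

section ChosenProducts

variable {C : Type*} [Category* C]

section Fan

variable {P M N : C} {p : P ⟶ M} {q : P ⟶ N}
  (h : Nonempty (Limits.IsLimit (Limits.BinaryFan.mk p q)))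

/-- The morphism into a binary product with given components. -/
noncomputable def fanLift {X : C} (f : X ⟶ M) (g : X ⟶ N) : X ⟶ P :=
  Limits.BinaryFan.IsLimit.lift h.some f g

lemma fanLift_fst {X : C} (f : X ⟶ M) (g : X ⟶ N) : fanLift h f g ≫ p = f :=
  Limits.BinaryFan.IsLimit.lift_fst h.some f g

lemma fanLift_snd {X : C} (f : X ⟶ M) (g : X ⟶ N) : fanLift h f g ≫ q = g :=
  Limits.BinaryFan.IsLimit.lift_snd h.some f g

lemma fan_hom_ext (h : Nonempty (Limits.IsLimit (Limits.BinaryFan.mk p q))) {X : C}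
    {f g : X ⟶ P} (h1 : f ≫ p = g ≫ p) (h2 : f ≫ q = g ≫ q) : f = g :=
  Limits.BinaryFan.IsLimit.hom_ext h.some h1 h2

end Fan

/-- The functor given by a choice of binary products. -/
noncomputable def chosenProdFunctor {P : C → C → C} (p : ∀ M N, P M N ⟶ M) (q : ∀ M N, P M N ⟶ N)
    (h : ∀ M N, Nonempty (Limits.IsLimit (Limits.BinaryFan.mk (p M N) (q M N)))) : C × C ⥤ C where
  obj M := P M.1 M.2
  map {M N} f := fanLift (h N.1 N.2) (p M.1 M.2 ≫ f.1) (q M.1 M.2 ≫ f.2)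
  map_id M := fan_hom_ext (h M.1 M.2) (by simp [fanLift_fst]) (by simp [fanLift_snd])
  map_comp {M N K} f g := fan_hom_ext (h K.1 K.2)
    (by simp [fanLift_fst, reassoc_of% fanLift_fst (h N.1 N.2)])
    (by simp [fanLift_snd, reassoc_of% fanLift_snd (h N.1 N.2)])

variable {P : C → C → C} {p : ∀ M N, P M N ⟶ M} {q : ∀ M N, P M N ⟶ N}
  (h : ∀ M N, Nonempty (Limits.IsLimit (Limits.BinaryFan.mk (p M N) (q M N))))

lemma chosenProdFunctor_map_fst {M N : C × C} (f : M ⟶ N) :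
    (chosenProdFunctor p q h).map f ≫ p N.1 N.2 = p M.1 M.2 ≫ f.1 :=
  fanLift_fst (h N.1 N.2) _ _

lemma chosenProdFunctor_map_snd {M N : C × C} (f : M ⟶ N) :
    (chosenProdFunctor p q h).map f ≫ q N.1 N.2 = q M.1 M.2 ≫ f.2 :=
  fanLift_snd (h N.1 N.2) _ _

/-- A choice of binary products is right adjoint to the diagonal. -/
noncomputable def diagAdjunction :
    CategoryTheory.Adjunction (Functor.diag C) (chosenProdFunctor p q h) where
  unit :=
    { app := fun M => fanLift (h M M) (𝟙 M) (𝟙 M)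
      naturality := fun M N f => by
        refine fan_hom_ext (h N N) ?_ ?_
        · refine ((Category.assoc _ _ _).trans (congrArg _ (fanLift_fst (h N N) _ _))).trans
            (Eq.trans ?_ (((Category.assoc _ _ _).trans
              (congrArg _ (chosenProdFunctor_map_fst h (M := (M, M)) (N := (N, N)) (f, f)))).symm))
          exact (Category.comp_id f).trans ((Category.id_comp f).symm.trans
            ((congrArg (fun t => t ≫ f) (fanLift_fst (h M M) _ _).symm).trans
              (Category.assoc _ _ _)))
        · refine ((Category.assoc _ _ _).trans (congrArg _ (fanLift_snd (h N N) _ _))).trans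
            (Eq.trans ?_ (((Category.assoc _ _ _).trans
              (congrArg _ (chosenProdFunctor_map_snd h (M := (M, M)) (N := (N, N)) (f, f)))).symm))
          exact (Category.comp_id f).trans ((Category.id_comp f).symm.trans
            ((congrArg (fun t => t ≫ f) (fanLift_snd (h M M) _ _).symm).trans
              (Category.assoc _ _ _))) }
  counit :=
    { app := fun M => (p M.1 M.2, q M.1 M.2)
      naturality := fun M N f => Prod.hom_ext (chosenProdFunctor_map_fst h f)
        (chosenProdFunctor_map_snd h f) }
  left_triangle_components M := Prod.hom_ext (fanLift_fst (h M M) _ _) (fanLift_snd (h M M) _ _)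
  right_triangle_components M := fan_hom_ext (h M.1 M.2)
    ((Category.assoc _ _ _).trans ((congrArg _ (chosenProdFunctor_map_fst h _)).trans
      (((Category.assoc _ _ _).symm.trans (congrArg (fun t => t ≫ p M.1 M.2)
        (fanLift_fst (h _ _) _ _))).trans rfl)))
    ((Category.assoc _ _ _).trans ((congrArg _ (chosenProdFunctor_map_snd h _)).trans
      (((Category.assoc _ _ _).symm.trans (congrArg (fun t => t ≫ q M.1 M.2)
        (fanLift_snd (h _ _) _ _))).trans rfl)))

end ChosenProducts

section Pullbacks

variable {C : Type*} [Category* C]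

/-- The product of two subobjects `m : U ⟶ T` and `m' : V ⟶ T`, given as pullbacks, of a product
`T`. -/
lemma isLimit_of_pullbacks {T M' N' M N U V W : C} {a : T ⟶ M'} {b : T ⟶ N'}
    (hT : Nonempty (Limits.IsLimit (Limits.BinaryFan.mk a b))) {i : M ⟶ M'} {j : N ⟶ N'} [Mono i]
    [Mono j] {m : U ⟶ T} {k : U ⟶ M} (hU : IsPullback m k a i) {m' : V ⟶ T} {k' : V ⟶ N}
    (hV : IsPullback m' k' b j) {n : W ⟶ U} {l : W ⟶ V} (hW : IsPullback n l m m') :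
    Nonempty (Limits.IsLimit (Limits.BinaryFan.mk (n ≫ k) (l ≫ k'))) := by
  rw [nonempty_isLimit_binaryFan_iff] at hT ⊢
  intro X f g
  -- The map to the ambient product `T` lies in `U` because its first component factors through `i`,
  -- and in `V` because its second factors through `j`; hence it lies in their intersection `W`.
  obtain ⟨t, ⟨t1, t2⟩, ht⟩ := hT (f ≫ i) (g ≫ j)
  have e : hU.lift t f t1 ≫ m = hV.lift t g t2 ≫ m' := by simp
  refine ⟨hW.lift _ _ e, ⟨by simp, by simp⟩, fun h ⟨h1, h2⟩ => ?_⟩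
  have h3 : h ≫ n ≫ m = t := ht _ ⟨by simp [hU.w, ← h1], by rw [hW.w]; simp [hV.w, ← h2]⟩
  apply hW.hom_ext
  · apply hU.hom_ext <;> simp [← h1, ← h3]
  · apply hV.hom_ext <;> simp [← h2, ← h3, hW.w]

end Pullbacks

/-! ### Strictly local right adjoints from local products -/

namespace LCat

/-- The local functor from the terminal local category that picks a total object. -/
def const {C : LCat.{v, u}} (T : C.carrier) (hT : IsTotalObj T) : LFunctor point.{v, u} C where
  obj _ := T
  map _ := 𝟙 T
  map_id _ := rfl
  map_comp _ _ := (Category.comp_id _).symm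
  obj_L _ := hT.1.symm
  map_η _ := (Category.id_comp _).trans hT.2.symm
  map_isPullback _ := IsPullback.of_horiz_isIso ⟨rfl⟩

lemma isLeftAdjoint_toPoint {C : LCat.{v, u}} {T : C.carrier} (hT : IsLocalTerminal T) :
    IsLeftAdjoint (B := LCat.{v, u}) (toPoint C) := by
  obtain ⟨h, ⟨hT⟩⟩ := hT
  refine IsLeftAdjoint.mk (g := const T h) (ofAdjunction ?_)
  exact
    { unit :=
        { app := fun M => hT.from M
          naturality := fun _ _ _ => hT.hom_ext _ _ }
      counit :=
        { app := fun _ => PUnit.unit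
          naturality := fun _ _ _ => rfl }
      left_triangle_components := fun _ => rfl
      right_triangle_components := fun _ => hT.hom_ext _ _ }

/-- For total factors, the enlargement of a local product is again a product, and it is total.
Totality is placed behind an implication so that `choose` produces functions on all pairs of
objects; on other pairs the value is an arbitrary local product. -/
lemma exists_total_products {C : LCat.{v, u}}
    (hC : ∀ M N : C.carrier, ∃ (P : C.carrier) (p : P ⟶ M) (q : P ⟶ N), IsLocalProduct p q)
    (M N : C.carrier) : ∃ (T : C.carrier) (a : T ⟶ M) (b : T ⟶ N), IsTotalObj M → IsTotalObj N →
      IsTotalObj T ∧ Nonempty (Limits.IsLimit (Limits.BinaryFan.mk a b)) := by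
  obtain ⟨P, p, q, -, p', q', h, -⟩ := hC M N
  by_cases hMN : IsTotalObj M ∧ IsTotalObj N
  · refine ⟨L P, p' ≫ eqToHom hMN.1.1, q' ≫ eqToHom hMN.2.1, fun _ _ => ⟨isTotalObj_L P, ?_⟩⟩
    simpa using isLimit_binaryFan_of_iso h (Iso.refl _) (eqToIso hMN.1.1) (eqToIso hMN.2.1)
  · exact ⟨P, p, q, fun h h' => (hMN ⟨h, h'⟩).elim⟩

/-- Given products of total objects, the products of all objects can be chosen compatibly with the
enlargements. -/
lemma exists_strict_products {C : LCat.{v, u}} {T : C.carrier → C.carrier → C.carrier}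
    {a : ∀ M N, T M N ⟶ M} {b : ∀ M N, T M N ⟶ N}
    (hT : ∀ M N, IsTotalObj M → IsTotalObj N →
      IsTotalObj (T M N) ∧ Nonempty (Limits.IsLimit (Limits.BinaryFan.mk (a M N) (b M N))))
    (M N : C.carrier) : ∃ (P : C.carrier) (p : P ⟶ M) (q : P ⟶ N) (h : L P = T (L M) (L N)),
      Nonempty (Limits.IsLimit (Limits.BinaryFan.mk p q)) ∧
      η P ≫ eqToHom h ≫ a (L M) (L N) = p ≫ η M ∧ η P ≫ eqToHom h ≫ b (L M) (L N) = q ≫ η N ∧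
      (IsTotalObj M → IsTotalObj N →
        ∃ e : P = T M N, p = eqToHom e ≫ a M N ∧ q = eqToHom e ≫ b M N) := by
  by_cases hMN : IsTotalObj M ∧ IsTotalObj N
  -- On total pairs the chosen product is `T M N` itself, which forces the value at `(L M, L N)` to
  -- be `T (L M) (L N)`.
  · obtain ⟨hM, hN⟩ := hMN
    obtain ⟨hP, hl⟩ := hT M N hM hN
    -- Stated for arbitrary `M' = M` and `N' = N`, so that the equalities can be eliminated by
    -- substitution before being applied to `L M = M` and `L N = N`.
    have key : ∀ {M' N' : C.carrier} (e : M' = M) (e' : N' = N) (h : T M N = T M' N'),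
        eqToHom h ≫ a M' N' = a M N ≫ eqToHom e.symm ∧
          eqToHom h ≫ b M' N' = b M N ≫ eqToHom e'.symm := by
      rintro _ _ rfl rfl h
      simp
    have e : T M N = T (L M) (L N) := by rw [hM.1, hN.1]
    obtain ⟨k1, k2⟩ := key hM.1 hN.1 e
    refine ⟨T M N, a M N, b M N, hP.1.trans e, hl, ?_, ?_,
      fun _ _ => ⟨rfl, by simp, by simp⟩⟩
    · rw [hP.2, hM.2, eqToHom_trans_assoc, k1]
    · rw [hP.2, hN.2, eqToHom_trans_assoc, k2]
  · obtain ⟨⟨eT, hη⟩, hl⟩ := hT (L M) (L N) (isTotalObj_L M) (isTotalObj_L N)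
    -- `U` and `V` are the preimages in the total product of `M` and `N` under the two projections.
    -- The local axiom gives both the enlargement `T (L M) (L N)`, and `hm`, `hm'` identify their
    -- inclusions with their maximal inclusions.
    obtain ⟨U, m, k, hU, hUp, hUm⟩ := exists_pullback (a (L M) (L N))
    obtain ⟨V, m', k', hV, hVp, hVm⟩ := exists_pullback (b (L M) (L N))
    have hm : η U ≫ eqToHom (hU.trans eT) = m := by
      rw [← eqToHom_trans hU eT, ← Category.assoc, ← hUm, hη, Category.assoc, eqToHom_trans,
        eqToHom_refl, Category.comp_id]
    have hm' : η V ≫ eqToHom (hV.trans eT) = m' := by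
      rw [← eqToHom_trans hV eT, ← Category.assoc, ← hVm, hη, Category.assoc, eqToHom_trans,
        eqToHom_refl, Category.comp_id]
    -- The intersection of `U` and `V`, obtained by pulling back the maximal inclusion of `V` along
    -- `m`. Its enlargement is that of `U`, hence `T (L M) (L N)`.
    obtain ⟨W, n, l, hW, hWp, hWm⟩ := exists_pullback (m ≫ eqToHom (hV.trans eT).symm)
    have hWp' : IsPullback n l m m' := by
      refine IsPullback.of_iso hWp (Iso.refl _) (Iso.refl _) (Iso.refl _)
        (eqToIso (hV.trans eT)) ?_ ?_ ?_ ?_ <;> simp [hm']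
    have := η_mono M
    have := η_mono N
    have hWT : η W ≫ eqToHom (hW.trans (hU.trans eT)) = n ≫ m := by
      rw [← hm, ← Category.assoc, hWm, Category.assoc, eqToHom_trans]
    refine ⟨W, n ≫ k, l ≫ k', hW.trans (hU.trans eT), isLimit_of_pullbacks hl hUp hVp hWp',
      ?_, ?_, fun h h' => (hMN ⟨h, h'⟩).elim⟩
    · rw [← Category.assoc, hWT, Category.assoc, Category.assoc, hUp.w]
    · rw [← Category.assoc, hWT, hWp'.w, Category.assoc, Category.assoc, hVp.w]

/-- The strict choice of products makes the product functor commute with `L` on objects and send `(η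
M, η N)` to `η` of the product. Pullbacks are preserved because it is a right adjoint. -/
lemma isLeftAdjoint_diag {C : LCat.{v, u}}
    (hC : ∀ M N : C.carrier, ∃ (P : C.carrier) (p : P ⟶ M) (q : P ⟶ N), IsLocalProduct p q) :
    IsLeftAdjoint (B := LCat.{v, u}) (diag C) := by
  choose T a b hT using exists_total_products hC
  choose P p q hL hl ha hb hs using exists_strict_products hT
  let adj := diagAdjunction hl
  -- Both sides equal `T (L M) (L N)`: the left by the choice on total pairs, the right by the
  -- choice of enlargements.
  have hLP : ∀ M N, P (L M) (L N) = L (P M N) := fun M N =>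
    (hs (L M) (L N) (isTotalObj_L M) (isTotalObj_L N)).choose.trans (hL M N).symm
  have hη : ∀ M N (s : P M N ⟶ P (L M) (L N)), s ≫ p (L M) (L N) = p M N ≫ η M →
      s ≫ q (L M) (L N) = q M N ≫ η N → s ≫ eqToHom (hLP M N) = η (P M N) := by
    intro M N s h1 h2
    obtain ⟨e, e1, e2⟩ := hs (L M) (L N) (isTotalObj_L M) (isTotalObj_L N)
    rw [e1] at h1
    rw [e2] at h2
    rw [← cancel_mono (eqToHom (hL M N))]
    refine fan_hom_ext (hT (L M) (L N) (isTotalObj_L M) (isTotalObj_L N)).2 ?_ ?_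
    · simp only [Category.assoc, eqToHom_trans_assoc]
      exact h1.trans (ha M N).symm
    · simp only [Category.assoc, eqToHom_trans_assoc]
      exact h2.trans (hb M N).symm
  let S : LFunctor (prod C C) C :=
    { toFunctor := chosenProdFunctor p q hl
      obj_L := fun M => hLP M.1 M.2
      map_η := fun M => hη M.1 M.2 _
        (chosenProdFunctor_map_fst hl ((η M.1, η M.2) : (M.1, M.2) ⟶ (L M.1, L M.2)))
        (chosenProdFunctor_map_snd hl ((η M.1, η M.2) : (M.1, M.2) ⟶ (L M.1, L M.2)))
      map_isPullback := fun h => by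
        have := adj.rightAdjoint_preservesLimits
        exact h.map (chosenProdFunctor p q hl) }
  exact IsLeftAdjoint.mk (g := S) (ofAdjunction adj)

theorem isCartesianObject_iff (C : LCat.{v, u}) : IsCartesianObject C ↔ IsCartesian C := by
  constructor
  · intro h
    obtain ⟨h1, h2⟩ := h.isLeftAdjoint isTwoTerminal_point (toPoint C)
      (isTwoProduct_prod C C) (d := diag C) rfl rfl
    exact isCartesian_of_isLeftAdjoint h1 h2
  · rintro ⟨⟨T, hT⟩, h⟩
    exact ⟨⟨point, toPoint C, isTwoTerminal_point, isLeftAdjoint_toPoint hT⟩, prod C C,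
      fst C C, snd C C, diag C, isTwoProduct_prod C C, rfl, rfl, isLeftAdjoint_diag h⟩

end LCat

/-! ### The unit on objects and morphisms -/

namespace RObj

variable {C : LCat.{v, u}}

lemma ext_obj {M N : RObj C} (h : M.obj = N.obj) : M = N := by
  cases M
  cases N
  cases h
  rfl

lemma cls_eq_iff {M N : RObj C} {p q : PMap M.obj N.obj} :
    (cls p : M ⟶ N) = cls q ↔ PMap.Rel p q :=
  Quotient.eq (r := PMap.setoid M.obj N.obj)

lemma cls_heq {M M' N N' : RObj C} (hM : M = M') (hN : N = N') {p : PMap M.obj N.obj}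
    {p' : PMap M'.obj N'.obj} (e : p.dom ≅ p'.dom)
    (h1 : e.hom ≫ p'.incl = p.incl ≫ eqToHom (congrArg obj hM))
    (h2 : e.hom ≫ p'.arr = p.arr ≫ eqToHom (congrArg obj hN)) :
    HEq (cls p : M ⟶ N) (cls p' : M' ⟶ N') := by
  subst hM hN
  refine heq_of_eq (cls_eq_iff.2 ⟨e, ?_, ?_⟩)
  · rw [h1, eqToHom_refl, Category.comp_id]
  · rw [h2, eqToHom_refl, Category.comp_id]

/-- Turns transport along an equality of total objects into a total partial map, so that
compositions with it can be computed on representatives. -/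
lemma eqToHom_eq_cls {M N : RObj C} (h : M = N) :
    eqToHom h = cls (PMap.ofHom M.total (eqToHom (congrArg obj h))) := by
  subst h
  rfl

/-- The enlargement of an object, as a total object. -/
abbrev enlarge (M : C.carrier) : RObj C := ⟨L M, LCat.isTotalObj_L M⟩

end RObj

namespace LCat

variable {C : LCat.{v, u}}

/-- The partial morphism `L M ⟶ L N` represented by a morphism `M ⟶ N`. -/
abbrev unitPMap {M N : C.carrier} (f : M ⟶ N) : PMap (L M) (L N) := ⟨M, rfl, f ≫ η N⟩

/-- The object `(L M, (M, η M))` of the local category of partial morphisms. -/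
abbrev unitObj (M : C.carrier) : LObj C.toRestriction where
  base := RObj.enlarge M
  idem := RObj.cls (M := RObj.enlarge M) (N := RObj.enlarge M) ⟨M, rfl, η M⟩
  rest_idem := RObj.cls_eq_iff.2 ⟨Iso.refl _, Category.id_comp _, by
    dsimp only [PMap.restr, PMap.incl]
    simp⟩

lemma incl_mk (M : C.carrier) {N : C.carrier} (f : M ⟶ N) :
    (⟨M, rfl, f⟩ : PMap (L M) N).incl = η M := Category.comp_id _

lemma cls_unitPMap_comp {M N : C.carrier} (f : M ⟶ N) {K : RObj C} (g : N ⟶ K.obj) :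
    (RObj.cls (unitPMap f) : RObj.enlarge M ⟶ RObj.enlarge N) ≫
      (RObj.cls ⟨N, rfl, g⟩ : RObj.enlarge N ⟶ K) = RObj.cls ⟨M, rfl, f ≫ g⟩ :=
  RObj.cls_comp (PMap.isComp_of_factor (unitPMap f) ⟨N, rfl, g⟩ f (by rw [incl_mk]))

/-- The morphism of the local category of partial morphisms represented by `f`. -/
abbrev unitMap {M N : C.carrier} (f : M ⟶ N) : unitObj M ⟶ unitObj N where
  hom := RObj.cls (M := RObj.enlarge M) (N := RObj.enlarge N) (unitPMap f)
  rest_hom := RObj.cls_eq_iff.2 ⟨Iso.refl _, Category.id_comp _, by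
    dsimp only [PMap.restr, PMap.incl]
    simp⟩
  hom_idem := cls_unitPMap_comp f (K := RObj.enlarge N) (η N)

/-- The functor `M ↦ (L M, (M, η M))`, `f ↦ (M, f ≫ η N)`. -/
def unitFunctor (C : LCat.{v, u}) : C.carrier ⥤ LObj C.toRestriction where
  obj M := unitObj M
  map f := unitMap f
  map_id M := LObj.hom_ext (RObj.cls_eq_iff.2 ⟨Iso.refl _, Category.id_comp _, by
    dsimp only [unitPMap]
    simp⟩)
  map_comp {M N K} f g := LObj.hom_ext (by
    refine Eq.trans ?_ (cls_unitPMap_comp f (K := RObj.enlarge K) (g ≫ η K)).symm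
    exact congrArg RObj.cls (congrArg (PMap.mk M rfl) (Category.assoc f g (η K))))

/-- The condition on the restriction identifies the domain of a representative with `M`. The
condition of absorbing the idempotent of `N` says that the pullback of `η N` along the
representative is its whole domain, so the representative factors through `η N`. -/
lemma exists_eq_unitMap {M N : C.carrier} (f : unitObj M ⟶ unitObj N) :
    ∃ g : M ⟶ N, unitMap g = f := by
  obtain ⟨f, hr, hi⟩ := f
  obtain ⟨p, rfl⟩ := RObj.cls_surj (C := C) f
  obtain ⟨e, he, -⟩ := RObj.cls_eq_iff.1 hr
  obtain ⟨r, hr'⟩ := PMap.exists_isComp p ⟨N, rfl, η N⟩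
  have hi' : (RObj.cls r : RObj.enlarge M ⟶ RObj.enlarge N) = RObj.cls p :=
    (RObj.cls_comp hr').symm.trans hi
  obtain ⟨d, hd, -⟩ := RObj.cls_eq_iff.1 hi'
  obtain ⟨m, k, hpb, h1, -⟩ := hr'
  -- The pullback projection `m` is thus invertible, which yields the factorization `hw` through `η
  -- N`.
  have hm : d.hom = m := by rw [← cancel_mono p.incl, hd, h1]
  have hw : p.arr = d.inv ≫ k ≫ η N := by
    rw [← incl_mk N (η N), ← hpb.w, ← hm, d.inv_hom_id_assoc]
  have he' : e.hom ≫ η M = p.incl := by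
    rw [← incl_mk M (η M)]
    exact he
  refine ⟨e.inv ≫ d.inv ≫ k, LObj.hom_ext (RObj.cls_eq_iff.2 ⟨e.symm, ?_, ?_⟩)⟩
  · change e.inv ≫ p.incl = _
    rw [incl_mk, ← he', e.inv_hom_id_assoc]
  · change e.inv ≫ p.arr = (e.inv ≫ d.inv ≫ k) ≫ η N
    rw [hw, Category.assoc, Category.assoc]

/-- An isomorphism of representatives is over the monomorphism `η M`, hence the identity, and `η N`
can then be cancelled. -/
lemma unitMap_injective {M N : C.carrier} {f g : M ⟶ N} (h : unitMap f = unitMap g) : f = g := by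
  obtain ⟨e, h1, h2⟩ := RObj.cls_eq_iff.1 (congrArg LHom.hom h)
  have := η_mono M
  have := η_mono N
  have he : e.hom = 𝟙 M := by
    rw [incl_mk, incl_mk] at h1
    rw [← cancel_mono (η M), Category.id_comp]
    exact h1
  have h3 : e.hom ≫ g ≫ η N = f ≫ η N := h2
  rw [← cancel_mono (η N), ← h3, he, Category.id_comp]

/-- An idempotent equal to its own restriction is the class of some `(U, η U)`, so `Q` is strictly
the image of `U`. The second clause fixes the preimage of `(M, 𝟙)` as `M`; this normalization makes
the chosen section commute strictly with enlargement. -/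
lemma exists_unitObj_eq (Q : LObj C.toRestriction) : ∃ U : C.carrier, unitObj U = Q ∧
    (∀ M : RObj C, Q = LObj.enlarge (X := C.toRestriction) ⟨M, 𝟙 M, rest_id _⟩ → U = M.obj) := by
  by_cases h : ∃ M : RObj C, Q = LObj.enlarge (X := C.toRestriction) ⟨M, 𝟙 M, rest_id _⟩
  · obtain ⟨M, rfl⟩ := h
    refine ⟨M.obj, LObj.ext (RObj.ext_obj M.total.1) ?_, fun N hN => ?_⟩
    · refine RObj.cls_heq (RObj.ext_obj M.total.1) (RObj.ext_obj M.total.1)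
        (p' := PMap.ofHom M.total (𝟙 M.obj)) (Iso.refl _) ?_ ?_
      · rw [PMap.incl_ofHom, incl_mk, M.total.2, eqToHom_trans]
        exact Category.comp_id _
      · dsimp only
        rw [M.total.2, eqToHom_trans]
        exact Category.comp_id _
    · exact congrArg RObj.obj (congrArg LObj.base hN)
  · obtain ⟨⟨M, hM⟩, a, ha⟩ := Q
    obtain ⟨p, rfl⟩ := RObj.cls_surj (C := C) a
    obtain ⟨U, hU, f⟩ := p
    have hU' : L U = M := hU
    subst hU'
    refine ⟨U, LObj.ext rfl (heq_of_eq ?_), fun N hN => (h ⟨N, hN⟩).elim⟩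
    -- The arrow `f` of the representative may be replaced by the maximal inclusion, because the
    -- class equals its restriction.
    refine Eq.trans ?_ ha
    exact RObj.cls_eq_iff.2 ⟨Iso.refl _, Category.id_comp _, by
      dsimp only [PMap.restr, PMap.incl]
      simp⟩

end LCat

lemma LocalStructure.eqToHom_comp_η {C : Type u} [Category.{v} C] [LocalStructure C] {M N : C}
    (h : M = N) : eqToHom h ≫ η N = η M ≫ eqToHom (congrArg L h) := by
  subst h
  simp

/-! ### Local functors that are equivalences -/

namespace LCat

/-- Natural isomorphisms of underlying functors are invertible 2-cells. -/
def isoOfNatIso {C D : LCat.{v, u}} {F G : LFunctor C D} (α : F.toFunctor ≅ G.toFunctor) :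
    F ≅ G where
  hom := α.hom
  inv := α.inv
  hom_inv_id := α.hom_inv_id
  inv_hom_id := α.inv_hom_id

section Inverse

variable {C D : LCat.{v, u}} (E : LFunctor C D) [E.toFunctor.Full] [E.toFunctor.Faithful]
  (s : D.carrier → C.carrier)

/-- The inverse of a fully faithful functor with a section on objects. -/
noncomputable abbrev inverseFunctor (hs : ∀ Q, E.obj (s Q) = Q) : D.carrier ⥤ C.carrier where
  obj := s
  map {P Q} f := E.toFunctor.preimage (eqToHom (hs P) ≫ f ≫ eqToHom (hs Q).symm)
  map_id Q := E.toFunctor.map_injective (by simp)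
  map_comp f g := E.toFunctor.map_injective (by simp)

/-- The inverse of a fully faithful local functor with a section on objects that is compatible with
enlargements. -/
noncomputable def inverse (hs : ∀ Q, E.obj (s Q) = Q) (hL : ∀ Q, s (L Q) = L (s Q)) :
    LFunctor D C where
  toFunctor := inverseFunctor E s hs
  obj_L := hL
  map_η Q := E.toFunctor.map_injective (by
    have h := eqToHom_comp_η (hs Q)
    rw [← E.map_η, Category.assoc, eqToHom_trans] at h
    rw [E.map_comp, eqToHom_map, Functor.map_preimage, reassoc_of% h]
    simp only [Category.assoc, eqToHom_trans, eqToHom_refl, Category.comp_id])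
  map_isPullback {P M N m k f} h := by
    -- `E` is fully faithful and so reflects pullbacks. The image under `E` of the square in
    -- question is the given pullback, up to the equalities `hs`.
    refine IsPullback.of_map E.toFunctor ?_ ?_
    · rw [← Functor.map_comp, h.w, Functor.map_comp]
    · refine IsPullback.of_iso h (eqToIso (hs _).symm) (eqToIso (hs _).symm) (eqToIso (hs _).symm)
        (eqToIso (hs _).symm) ?_ ?_ ?_ ?_ <;>
      simp

theorem isEquivalenceCell_of_section (hs : ∀ Q, E.obj (s Q) = Q)
    (hL : ∀ Q, s (L Q) = L (s Q)) :
    IsEquivalenceCell (B := LCat.{v, u}) E := by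
  let α : E.toFunctor ⋙ inverseFunctor E s hs ≅ 𝟭 _ := NatIso.ofComponents
    (fun M => E.toFunctor.preimageIso (eqToIso (hs (E.obj M))))
    (fun f => E.toFunctor.map_injective (by simp))
  let β : inverseFunctor E s hs ⋙ E.toFunctor ≅ 𝟭 _ := NatIso.ofComponents
    (fun Q => eqToIso (hs Q)) (fun f => by simp)
  exact ⟨inverse E s hs hL, ⟨isoOfNatIso (F := compL E (inverse E s hs hL)) (G := idL C) α⟩,
    ⟨isoOfNatIso (F := compL (inverse E s hs hL) E) (G := idL D) β⟩⟩

end Inverse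

lemma toFunctor_isEquivalence {C D : LCat.{v, u}} {E : LFunctor C D} {G : LFunctor D C}
    (h : Nonempty (CategoryStruct.comp (obj := LCat.{v, u}) E G ≅ 𝟙 C))
    (h' : Nonempty (CategoryStruct.comp (obj := LCat.{v, u}) G E ≅ 𝟙 D)) :
    E.toFunctor.IsEquivalence := by
  obtain ⟨a⟩ := h
  obtain ⟨b⟩ := h'
  exact Functor.IsEquivalence.mk' G.toFunctor
    (Iso.mk (C := C.carrier ⥤ C.carrier) a.inv a.hom a.inv_hom_id a.hom_inv_id)
    (Iso.mk (C := D.carrier ⥤ D.carrier) b.hom b.inv b.hom_inv_id b.inv_hom_id)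

/-- An equivalence preserves the terminal object and both limit cones in a local product; the cone
on enlargements is moved along the equalities `E.obj_L`. -/
lemma preservesCartesian_of_isEquivalence {C D : LCat.{v, u}} (E : LFunctor C D)
    [E.toFunctor.IsEquivalence] : PreservesCartesian E := by
  refine ⟨fun T ⟨hT, ⟨h⟩⟩ => ⟨E.isTotalObj hT, ⟨h.isTerminalObj E.toFunctor⟩⟩, ?_⟩
  rintro P M N p q ⟨⟨h⟩, p', q', ⟨h'⟩, hp, hq⟩
  have hη : ∀ M : C.carrier, η (E.obj M) = E.map (η M) ≫ eqToHom (E.obj_L M) := fun M =>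
    (E.map_η M).symm
  refine ⟨⟨Limits.mapIsLimitOfPreservesOfIsLimit E.toFunctor p q h⟩,
    eqToHom (E.obj_L P).symm ≫ E.map p' ≫ eqToHom (E.obj_L M),
    eqToHom (E.obj_L P).symm ≫ E.map q' ≫ eqToHom (E.obj_L N), ?_, ?_, ?_⟩
  · exact isLimit_binaryFan_of_iso ⟨Limits.mapIsLimitOfPreservesOfIsLimit E.toFunctor p' q' h'⟩
      (eqToIso (E.obj_L P).symm) (eqToIso (E.obj_L M)) (eqToIso (E.obj_L N))
  · rw [hη, hη, Category.assoc, eqToHom_trans_assoc, eqToHom_refl, Category.id_comp,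
      ← Category.assoc, ← E.map_comp, hp, E.map_comp, Category.assoc]
  · rw [hη, hη, Category.assoc, eqToHom_trans_assoc, eqToHom_refl, Category.id_comp,
      ← Category.assoc, ← E.map_comp, hq, E.map_comp, Category.assoc]

end LCat

/-! ### The unit is an equivalence -/

namespace LCat

instance (C : LCat.{v, u}) : (unitFunctor C).Full := ⟨fun f => exists_eq_unitMap f⟩

instance (C : LCat.{v, u}) : (unitFunctor C).Faithful := ⟨fun h => unitMap_injective h⟩

instance (C : LCat.{v, u}) : (unitFunctor C).IsEquivalence where
  essSurj := ⟨fun Q => by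
    obtain ⟨U, h, -⟩ := exists_unitObj_eq Q
    exact ⟨U, ⟨eqToIso h⟩⟩⟩

/-- Since `L M` is total, its idempotent `(L M, η (L M))` is the identity up to transport along `L
(L M) = L M`. -/
lemma unitObj_L {C : LCat.{v, u}} (M : C.carrier) : unitObj (L M) = (unitObj M).enlarge := by
  have e : RObj.enlarge (L M) = RObj.enlarge M := RObj.ext_obj (L_L M)
  refine LObj.ext e (RObj.cls_heq e e (p' := PMap.ofHom (isTotalObj_L M) (𝟙 (L M))) (Iso.refl _)
    ?_ ?_)
  · rw [PMap.incl_ofHom, incl_mk, η_L, eqToHom_trans]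
    exact Category.comp_id _
  · dsimp only
    rw [η_L, eqToHom_trans]
    exact Category.comp_id _

/-- The unit of the 2-equivalence. -/
def unit (C : LCat.{u, u}) : LFunctor C C.toRestriction.toLocal where
  toFunctor := unitFunctor C
  obj_L M := unitObj_L M
  map_η M := by
    apply LObj.hom_ext
    have e : RObj.enlarge (L M) = RObj.enlarge M := RObj.ext_obj (L_L M)
    have h1 : LHom.hom (eqToHom (unitObj_L M)) = (unitObj (L M)).idem ≫ eqToHom e :=
      LObj.eqToHom_hom _
    have h2 : (RObj.cls (unitPMap (η M)) : RObj.enlarge M ⟶ RObj.enlarge (L M)) ≫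
        (unitObj (L M)).idem = RObj.cls (unitPMap (η M)) :=
      cls_unitPMap_comp (η M) (K := RObj.enlarge (L M)) (η (L M))
    have h3 : (RObj.cls (unitPMap (η M)) : RObj.enlarge M ⟶ RObj.enlarge (L M)) ≫ eqToHom e =
        (unitObj M).idem := by
      rw [RObj.eqToHom_eq_cls, RObj.cls_comp (PMap.isComp_ofHom _ _ _)]
      refine congrArg RObj.cls (congrArg (PMap.mk M rfl) ?_)
      dsimp only [unitPMap]
      rw [η_L, Category.assoc, eqToHom_trans, eqToHom_refl, Category.comp_id]
    change (RObj.cls (unitPMap (η M)) : RObj.enlarge M ⟶ RObj.enlarge (L M)) ≫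
      LHom.hom (eqToHom (unitObj_L M)) = (unitObj M).idem
    rw [h1]
    exact (Category.assoc _ _ _).symm.trans ((congrArg (fun t => t ≫ eqToHom e) h2).trans h3)
  map_isPullback h := h.map (unitFunctor C)

theorem isEquivalenceCell_unit (C : LCat.{u, u}) :
    IsEquivalenceCell (B := LCat.{u, u}) (unit C) := by
  choose s hs hs' using exists_unitObj_eq (C := C)
  have : (unit C).toFunctor.Full := inferInstanceAs (unitFunctor C).Full
  have : (unit C).toFunctor.Faithful := inferInstanceAs (unitFunctor C).Faithful
  refine isEquivalenceCell_of_section (unit C) s hs fun Q => ?_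
  -- The section sends the enlargement of `Q` to the base object of `Q`, by the normalization, and
  -- this is `L (s Q)` because the unit sends `s Q` to `Q`.
  exact (hs' (LObj.enlarge Q) Q.base rfl).trans
    (congrArg (fun t : LObj C.toRestriction => RObj.obj t.base) (hs Q)).symm

instance unit_isEquivalence (C : LCat.{u, u}) : (unit C).toFunctor.IsEquivalence :=
  inferInstanceAs (unitFunctor C).IsEquivalence

end LCat

/-! ### The counit -/

namespace RCat

variable {X : RCat.{v, u}}

/-- The object `(A, 𝟙)` of the local category of `X`, as a total object. -/
abbrev jObj (A : X.carrier) : RObj X.toLocal :=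
  RObj.enlarge (C := X.toLocal) (LObj.mk A (𝟙 A) (rest_id A))

/-- The partial morphism `((A, rest f), f)` from `(A, 𝟙)` to `(B, 𝟙)`. -/
abbrev jPMap {A B : X.carrier} (f : A ⟶ B) : PMap (jObj A).obj (jObj B).obj where
  dom := LObj.mk A (rest f) (rest_rest f)
  L_dom := rfl
  arr := LHom.mk f rfl (Category.comp_id f)

/-- The class of `((A, rest f), f)`. -/
abbrev jMap {A B : X.carrier} (f : A ⟶ B) : jObj A ⟶ jObj B := RObj.cls (jPMap f)

lemma exists_eq_jObj (Q : RObj X.toLocal) : ∃ A : X.carrier, Q = jObj A :=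
  ⟨Q.obj.base, RObj.ext_obj Q.total.1.symm⟩

/-- The morphism of `X` underlying a partial morphism of the local category of `X`. -/
def kPMap {M N : X.toLocal.carrier} (p : PMap M N) : M.base ⟶ N.base :=
  eqToHom (congrArg LObj.base p.L_dom.symm) ≫
    LHom.hom (P := p.dom) (Q := N) p.arr

/-- Restriction idempotents commute, so `f = a ≫ b ≫ f = b ≫ a ≫ f = b ≫ f = g`. -/
lemma eq_of_comp_eq {A B : X.carrier} {a b : A ⟶ A} {f g : A ⟶ B} (ha : rest a = a)
    (hb : rest b = b) (hf : rest f = a) (hg : a ≫ g = f) (hf' : b ≫ f = g) : f = g := by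
  have hab : a ≫ b = b ≫ a := by rw [← ha, ← hb, rest_comm]
  calc f = a ≫ b ≫ f := by rw [hf', hg]
    _ = b ≫ rest f ≫ f := by rw [← Category.assoc, hab, Category.assoc, hf]
    _ = g := by rw [rest_comp_self, hf']

/-- An isomorphism of representatives is compatible with the maximal inclusions, so its underlying
morphism is the idempotent of its source, and likewise for the inverse. The two underlying morphisms
then restrict to each other and are equal. -/
lemma kPMap_eq_of_rel {M N : X.toLocal.carrier} {p q : PMap M N} (h : PMap.Rel p q) :
    kPMap p = kPMap q := by
  obtain ⟨⟨A, a, ha⟩, hp, ⟨f, hf, hf'⟩⟩ := p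
  obtain ⟨⟨B, b, hb⟩, hq, ⟨g, hg, hg'⟩⟩ := q
  subst hp
  obtain rfl : B = A := congrArg LObj.base hq
  obtain ⟨e, h1, h2⟩ := h
  have key : ∀ {c d : B ⟶ B} (hc : rest c = c) (hd : rest d = d)
      (t : (LObj.mk B c hc : LObj X) ⟶ LObj.mk B d hd),
      t ≫ LObj.incl _ = (LObj.incl (LObj.mk B c hc)) → LHom.hom t = c := by
    intro c d hc hd t ht
    exact (LHom.hom_idem t).symm.trans (congrArg LHom.hom ht)
  have e1 : LHom.hom e.hom = a := key ha hb e.hom (by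
    refine Eq.trans ?_ (h1.trans (Category.comp_id _))
    exact congrArg (fun t => e.hom ≫ t) (Category.comp_id _).symm)
  have e2 : LHom.hom e.inv = b := key hb ha e.inv (by
    refine (Iso.inv_comp_eq e).2 ?_
    refine Eq.trans ?_ (h1.symm.trans ?_)
    · exact (Category.comp_id _).symm
    · exact congrArg (fun t => e.hom ≫ t) (Category.comp_id _))
  have h3 : LHom.hom e.hom ≫ g = f := congrArg LHom.hom h2
  have h4 : LHom.hom e.inv ≫ f = g := congrArg LHom.hom ((Iso.inv_comp_eq e).2 h2.symm)
  change 𝟙 _ ≫ f = 𝟙 _ ≫ g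
  rw [e1] at h3
  rw [e2] at h4
  exact congrArg (fun t => 𝟙 _ ≫ t) (eq_of_comp_eq ha hb hf h3 h4)

/-- The morphism of `X` underlying a morphism between total objects of its local category. -/
def kMap {M N : RObj X.toLocal} (f : M ⟶ N) : M.obj.base ⟶ N.obj.base :=
  Quotient.lift (s := PMap.setoid M.obj N.obj) kPMap (fun _ _ h => kPMap_eq_of_rel h) f

lemma kMap_jMap {A B : X.carrier} (f : A ⟶ B) : kMap (jMap f) = f := Category.id_comp f

lemma exists_eq_jMap {A B : X.carrier} (F : jObj A ⟶ jObj B) : ∃ f : A ⟶ B, F = jMap f := by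
  -- The idempotent of the domain is kept as a variable, so that the equation `rest f = a` can be
  -- substituted.
  have key : ∀ (a : A ⟶ A) (ha : rest a = a) (h : L (LObj.mk A a ha : X.toLocal.carrier) = _)
      (f : A ⟶ B) (hf : rest f = a) (hf' : f ≫ 𝟙 B = f),
      (RObj.cls ⟨LObj.mk A a ha, h, LHom.mk f hf hf'⟩ : jObj A ⟶ jObj B) = jMap f := by
    rintro _ _ _ f rfl _
    rfl
  obtain ⟨⟨⟨A', a, ha⟩, h, ⟨f, hf, hf'⟩⟩, rfl⟩ := RObj.cls_surj F
  obtain rfl : A' = A := congrArg LObj.base h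
  exact ⟨f, key a ha h f hf hf'⟩

/-- The composite is represented on the explicit preimage pullback. Being `jMap k` for some `k`, it
is determined by its underlying morphism, which is `(f ≫ rest g) ≫ g = f ≫ g`. The same device
identifies restrictions and identities below. -/
lemma jMap_comp {A B D : X.carrier} (f : A ⟶ B) (g : B ⟶ D) :
    jMap f ≫ jMap g = jMap (f ≫ g) := by
  let P : LObj X := LObj.mk B (rest g) (rest_rest g)
  let Q : LObj X := LObj.mk A (rest f) (rest_rest f)
  let f' : Q ⟶ P.enlarge := LHom.mk f rfl (Category.comp_id f)
  have h : PMap.IsComp (C := X.toLocal) (jPMap f) (jPMap g)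
      ⟨LObj.pre f', rfl, LObj.preSnd f' ≫ (jPMap g).arr⟩ := by
    refine ⟨LObj.preFst f', LObj.preSnd f', ?_, ?_, rfl⟩
    · have := LObj.isPullback_pre f'
      have e : (jPMap g).incl = LObj.incl P := Category.comp_id _
      rw [e]
      exact this
    · refine (congrArg (fun t => LObj.preFst f' ≫ t) (Category.comp_id _)).trans
        (Eq.trans ?_ (Category.comp_id _).symm)
      exact LObj.hom_ext (LHom.hom_idem (LObj.preFst f'))
  rw [RObj.cls_comp h]
  obtain ⟨k, hk⟩ := exists_eq_jMap (RObj.cls (M := jObj A) (N := jObj D)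
    ⟨LObj.pre f', rfl, LObj.preSnd f' ≫ (jPMap g).arr⟩)
  have hk' := congrArg kMap hk
  rw [kMap_jMap] at hk'
  rw [hk, ← hk']
  congr 1
  change _ = f ≫ g
  refine (Category.id_comp ((f ≫ rest g) ≫ g)).trans ?_
  rw [Category.assoc, rest_comp_self]

lemma rest_jMap {A B : X.carrier} (f : A ⟶ B) :
    rest (jMap f) = jMap (rest f) := by
  obtain ⟨k, hk⟩ := exists_eq_jMap (rest (jMap f))
  have hk' := congrArg kMap hk
  rw [kMap_jMap] at hk'
  rw [hk, ← hk']
  congr 1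
  refine (Category.id_comp _).trans ?_
  have : LHom.hom (jPMap f).incl = rest f := by
    have h : (jPMap f).incl = LObj.incl (LObj.mk A (rest f) (rest_rest f)) := Category.comp_id _
    rw [h]
    rfl
  exact this

lemma jMap_id (A : X.carrier) : jMap (𝟙 A) = 𝟙 (jObj A) := by
  obtain ⟨k, hk⟩ := exists_eq_jMap (𝟙 (jObj A))
  have hk' := congrArg kMap hk
  rw [kMap_jMap] at hk'
  rw [hk, ← hk']
  congr 1
  exact (Category.id_comp (𝟙 A)).symm

/-- The counit of the 2-equivalence. -/
def counit (X : RCat.{u, u}) : RFunctor X.toLocal.toRestriction X where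
  obj M := M.obj.base
  map f := kMap f
  map_id M := by
    obtain ⟨A, rfl⟩ := exists_eq_jObj M
    exact Category.id_comp (𝟙 A)
  map_comp {M N P} F G := by
    obtain ⟨A, rfl⟩ := exists_eq_jObj M
    obtain ⟨B, rfl⟩ := exists_eq_jObj N
    obtain ⟨D, rfl⟩ := exists_eq_jObj P
    obtain ⟨f, rfl⟩ := exists_eq_jMap F
    obtain ⟨g, rfl⟩ := exists_eq_jMap G
    refine (congrArg kMap (jMap_comp f g)).trans ?_
    rw [kMap_jMap, kMap_jMap, kMap_jMap]
    rfl
  map_rest {M N} F := by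
    obtain ⟨A, rfl⟩ := exists_eq_jObj M
    obtain ⟨B, rfl⟩ := exists_eq_jObj N
    obtain ⟨f, rfl⟩ := exists_eq_jMap F
    refine (congrArg kMap (rest_jMap f)).trans ?_
    rw [kMap_jMap, kMap_jMap]
    rfl

/-- The inverse of the counit: `A ↦ (A, 𝟙)`, `f ↦ ((A, rest f), f)`. -/
def counitInv (X : RCat.{u, u}) : RFunctor X X.toLocal.toRestriction where
  obj A := jObj A
  map f := jMap f
  map_id A := jMap_id A
  map_comp f g := (jMap_comp f g).symm
  map_rest f := (rest_jMap f).symm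

lemma counit_comp_counitInv (X : RCat.{u, u}) :
    compR (counit X) (counitInv X) = idR X.toLocal.toRestriction := by
  refine RFunctor_ext (fun M => ?_) (fun {M N} F => ?_)
  · obtain ⟨A, rfl⟩ := exists_eq_jObj M
    rfl
  · obtain ⟨A, rfl⟩ := exists_eq_jObj M
    obtain ⟨B, rfl⟩ := exists_eq_jObj N
    obtain ⟨f, rfl⟩ := exists_eq_jMap F
    exact heq_of_eq (congrArg jMap (kMap_jMap f))

lemma counitInv_comp_counit (X : RCat.{u, u}) : compR (counitInv X) (counit X) = idR X :=
  RFunctor_ext (fun _ => rfl) (fun f => heq_of_eq (kMap_jMap f))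

theorem isIsoCell_counit (X : RCat.{u, u}) : IsIsoCell (B := RCat.{u, u}) (counit X) :=
  ⟨counitInv X, counit_comp_counitInv X, counitInv_comp_counit X⟩

end RCat

/-! ### 2-naturality and the triangle identities -/

/-- Converts heterogeneous equality of components into the form with `eqToHom` that strict
2-naturality requires. -/
lemma comp_eqToHom_of_heq {C : Type*} [Category* C] {A A' B B' : C} (hA : A = A') (hB : B = B')
    {f : A ⟶ B} {f' : A' ⟶ B'} (h : HEq f f') : f ≫ eqToHom hB = eqToHom hA ≫ f' := by
  subst hA hB
  rw [eq_of_heq h, eqToHom_refl, eqToHom_refl, Category.comp_id, Category.id_comp]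

lemma LObj.hom_heq {X : RCat.{v, u}} {P P' Q Q' : LObj X} (hP : P = P') (hQ : Q = Q') {f : P ⟶ Q}
    {f' : P' ⟶ Q'} (h : HEq (LHom.hom f) (LHom.hom f')) : HEq f f' := by
  subst hP hQ
  exact heq_of_eq (LObj.hom_ext (eq_of_heq h))

lemma LFunctor.ext_heq {C D : LCat.{v, u}} {F G : LFunctor C D} (h : ∀ M, F.obj M = G.obj M)
    (h' : ∀ {M N : C.carrier} (f : M ⟶ N), HEq (F.map f) (G.map f)) : F = G :=
  LFunctor.ext_toFunctor (CategoryTheory.Functor.hext h fun _ _ f => h' f)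

namespace LCat

lemma eqToHom_app {C D : LCat.{v, u}} {F G : LFunctor C D} (h : F = G) (M : C.carrier) :
    NatTrans.app (eqToHom h) M = eqToHom (by rw [h]) := by
  subst h
  rfl

variable {C D : LCat.{u, u}} (F : LFunctor C D)

lemma map_η_eq (M : C.carrier) : F.map (η M) = η (F.obj M) ≫ eqToHom (F.obj_L M).symm := by
  rw [← F.map_η, Category.assoc, eqToHom_trans, eqToHom_refl, Category.comp_id]

/-- The image of the enlargement of an object, as a total object. -/
abbrev mapEnlarge (M : C.carrier) : RObj D := ⟨F.obj (L M), F.isTotalObj (isTotalObj_L M)⟩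

lemma enlarge_obj (M : C.carrier) : RObj.enlarge (F.obj M) = mapEnlarge F M :=
  RObj.ext_obj (F.obj_L M).symm

lemma incl_mapPMap_mk {M N : C.carrier} (f : M ⟶ N) :
    (F.mapPMap (⟨M, rfl, f⟩ : PMap (L M) N)).incl = η (F.obj M) ≫ eqToHom (F.obj_L M).symm := by
  rw [F.incl_mapPMap, incl_mk, map_η_eq]

lemma toLocal_unitObj (M : C.carrier) :
    unitObj (F.obj M) = F.toRestriction.toLocalFunctor.obj (unitObj M) := by
  refine LObj.ext (enlarge_obj F M) (RObj.cls_heq (enlarge_obj F M) (enlarge_obj F M)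
    (p' := F.mapPMap ⟨M, rfl, η M⟩) (Iso.refl _) ?_ ?_)
  · rw [incl_mapPMap_mk, incl_mk]
    exact Category.id_comp _
  · exact (Category.id_comp _).trans (map_η_eq F M)

/-- Both composites represent a morphism by the same domain and, up to the equality `F.obj (L M) = L
(F.obj M)`, the same arrow, because `F` preserves `η` strictly. -/
lemma unit_naturality : compL F (unit D) = compL (unit C) F.toRestriction.toLocal := by
  refine LFunctor.ext_heq (toLocal_unitObj F) fun {M N} f => ?_
  refine LObj.hom_heq (toLocal_unitObj F M) (toLocal_unitObj F N) ?_
  refine RObj.cls_heq (enlarge_obj F M) (enlarge_obj F N) (p := unitPMap (F.map f))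
    (p' := F.mapPMap (unitPMap f)) (Iso.refl _) ?_ ?_
  · rw [incl_mapPMap_mk, incl_mk]
    exact Category.id_comp _
  · refine (Category.id_comp _).trans ((F.map_comp _ _).trans ?_)
    rw [map_η_eq, ← Category.assoc]

/-- After computing the composite on representatives, this is naturality of `φ` at `η M`. -/
lemma unit_naturality₂ {F G : LFunctor C D} (φ : F ⟶ G) (M : C.carrier) :
    HEq (unitMap (NatTrans.app φ M))
      (NatTrans.app (RNat.toLocal (LFunctor.natToRestriction φ)) (unitObj M)) := by
  refine LObj.hom_heq (toLocal_unitObj F M) (toLocal_unitObj G M) ?_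
  have h : LHom.hom (NatTrans.app (RNat.toLocal (LFunctor.natToRestriction φ)) (unitObj M)) =
      RObj.cls (M := mapEnlarge F M) (N := mapEnlarge G M)
        ⟨F.obj M, (F.mapPMap ⟨M, rfl, η M⟩).L_dom, F.map (η M) ≫ NatTrans.app φ (L M)⟩ :=
    RObj.cls_comp (PMap.isComp_ofHom (F.mapPMap ⟨M, rfl, η M⟩) (F.isTotalObj (isTotalObj_L M)) _)
  rw [h]
  refine RObj.cls_heq (enlarge_obj F M) (enlarge_obj G M) (p := unitPMap (NatTrans.app φ M))
    (Iso.refl _) ?_ ?_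
  · refine (Category.id_comp _).trans ((incl_mapPMap_mk F (η M)).trans ?_)
    rw [incl_mk]
  · refine (Category.id_comp _).trans ((NatTrans.naturality φ (η M)).trans ?_)
    rw [map_η_eq, ← Category.assoc]

end LCat

/-- The unit of the 2-equivalence, as a 2-natural transformation. -/
noncomputable def unitTrans : TwoNatTrans (StrictPseudofunctor.id LCat.{u, u})
    (toRestriction2.{u, u}.comp toLocal2.{u, u}) where
  app C := LCat.unit C
  naturality F := LCat.unit_naturality F
  naturality₂ {C D F G} φ := by
    refine LCat.hom₂_ext fun M => ?_
    have h := comp_eqToHom_of_heq (LCat.toLocal_unitObj F M) (LCat.toLocal_unitObj G M)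
      (LCat.unit_naturality₂ φ M)
    have e1 := LCat.eqToHom_app (LCat.unit_naturality F) M
    have e2 := LCat.eqToHom_app (LCat.unit_naturality G) M
    refine (congrArg (fun t => LCat.unitMap (NatTrans.app φ M) ≫ t) e2).trans (h.trans ?_)
    exact congrArg (fun t => t ≫ NatTrans.app
      (RNat.toLocal (LFunctor.natToRestriction φ)) (LCat.unitObj M)) e1.symm

namespace RCat

variable {X Y : RCat.{u, u}}

lemma counit_naturality (F : RFunctor X Y) :
    compR F.toLocal.toRestriction (counit Y) = compR (counit X) F := by
  refine RFunctor_ext (fun _ => rfl) (fun {M N} f => heq_of_eq ?_)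
  obtain ⟨A, rfl⟩ := exists_eq_jObj M
  obtain ⟨B, rfl⟩ := exists_eq_jObj N
  obtain ⟨f, rfl⟩ := exists_eq_jMap f
  refine (Category.id_comp (F.map f)).trans ?_
  exact congrArg F.map (Category.id_comp f).symm

lemma counit_naturality₂ {F G : RFunctor X Y} (φ : F ⟶ G) (M : RObj X.toLocal) :
    kMap (RNat.app (LFunctor.natToRestriction (RNat.toLocal φ)) M) = RNat.app φ M.obj.base := by
  obtain ⟨A, rfl⟩ := exists_eq_jObj M
  refine (Category.id_comp (F.map (𝟙 A) ≫ RNat.app φ A)).trans ?_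
  rw [F.map_id, Category.id_comp]
  rfl

end RCat

/-- The counit of the 2-equivalence, as a 2-natural transformation. -/
noncomputable def counitTrans : TwoNatTrans (toLocal2.{u, u}.comp toRestriction2.{u, u})
    (StrictPseudofunctor.id RCat.{u, u}) where
  app X := RCat.counit X
  naturality F := RCat.counit_naturality F
  naturality₂ {X Y F G} φ := by
    refine RCat.RNat_ext fun M => ?_
    have e1 := RCat.eqToHom_app (RCat.counit_naturality F) M
    have e2 := RCat.eqToHom_app (RCat.counit_naturality G) M
    have h := RCat.counit_naturality₂ φ M
    refine (congrArg
      (fun t => RCat.kMap (RNat.app (LFunctor.natToRestriction (RNat.toLocal φ)) M) ≫ t) e2).trans (Eq.trans ?_ (congrArg (fun t => t ≫ RNat.app φ M.obj.base) e1.symm))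
    exact (Category.comp_id _).trans (h.trans (Category.id_comp _).symm)

/-- On a total object `M` the composite returns `L M = M`. On `(U, f)` it returns `(U, f ≫ η N)`,
and `η N` is an identity up to transport. -/
lemma unit_counit_restriction (C : LCat.{u, u}) :
    RCat.compR (LCat.unit C).toRestriction (RCat.counit C.toRestriction) =
      RCat.idR C.toRestriction := by
  refine RCat.RFunctor_ext (fun M => RObj.ext_obj M.total.1) (fun {M N} f => ?_)
  obtain ⟨p, rfl⟩ := RObj.cls_surj (C := C) f
  have hη : ∀ M : RObj C, η M.obj = eqToHom M.total.1.symm := fun M => M.total.2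
  have h0 : L p.dom = L M.obj := p.L_dom.trans M.total.1.symm
  have e : RObj.enlarge M.obj = RObj.enlarge p.dom := RObj.ext_obj h0.symm
  have h : (RCat.compR (LCat.unit C).toRestriction (RCat.counit C.toRestriction)).map
      (RObj.cls p : M ⟶ N) = RObj.cls (M := RObj.enlarge M.obj) (N := RObj.enlarge N.obj)
        ⟨p.dom, h0, p.arr ≫ η N.obj⟩ := by
    -- `kPMap` contributes the transport `eqToHom e` along `L U = L M`, where `U` is the domain of
    -- `p`; the remaining factor is the unit applied to the arrow of `p`.
    change eqToHom e ≫ (RObj.cls (LCat.unitPMap p.arr) :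
      RObj.enlarge p.dom ⟶ RObj.enlarge N.obj) = _
    refine eq_of_heq ((eqToHom_comp_heq _ _).trans ?_)
    refine RObj.cls_heq e.symm rfl (Iso.refl _) ?_ ?_
    · dsimp only [PMap.incl]
      simp
    · simp
  rw [h]
  refine RObj.cls_heq (RObj.ext_obj M.total.1) (RObj.ext_obj N.total.1) (Iso.refl _) ?_ ?_
  · dsimp only [PMap.incl]
    simp
  · have h1 : (p.arr ≫ η N.obj) ≫ eqToHom N.total.1 = p.arr := by
      rw [hη N, Category.assoc, eqToHom_trans, eqToHom_refl, Category.comp_id]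
    exact (Category.id_comp _).trans h1.symm

lemma unit_counit_local (X : RCat.{u, u}) :
    LCat.compL (LCat.unit X.toLocal) (RCat.counit X).toLocal = LCat.idL X.toLocal := by
  have h : ∀ P : LObj X, 𝟙 P.base ≫ P.idem = P.idem := fun P => Category.id_comp _
  have ho : ∀ P : LObj X, (LCat.compL (LCat.unit X.toLocal) (RCat.counit X).toLocal).obj P = P :=
    fun P => LObj.ext rfl (heq_of_eq (h P))
  refine LFunctor.ext_heq ho fun {P Q} f => ?_
  refine LObj.hom_heq (ho P) (ho Q) (heq_of_eq ?_)
  refine (Category.id_comp (LHom.hom (P := P) (Q := Q) f ≫ Q.idem)).trans ?_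
  exact LHom.hom_idem (P := P) (Q := Q) f

/-- Local categories and restriction categories form 2-equivalent 2-categories. -/
noncomputable def twoEquivalence : TwoEquivalence toRestriction2.{u, u} toLocal2.{u, u} where
  unit := unitTrans
  counit := counitTrans
  left_triangle C := unit_counit_restriction C
  right_triangle X := unit_counit_local X
  unit_equivalence C := LCat.isEquivalenceCell_unit C
  counit_equivalence X := by
    obtain ⟨g, h1, h2⟩ := RCat.isIsoCell_counit X
    exact ⟨g, ⟨eqToIso h1⟩, ⟨eqToIso h2⟩⟩

/-! ### Cartesian structure of the restriction category of a local category -/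

namespace RObj

variable {C : LCat.{v, u}}

lemma total_cls_ofHom {M N : RObj C} (f : M.obj ⟶ N.obj) :
    TotalHom (cls (PMap.ofHom M.total f) : M ⟶ N) :=
  congrArg cls (congrArg (PMap.mk M.obj M.total.1) (PMap.incl_ofHom M.total f))

/-- Totality makes the inclusion of the domain an isomorphism, along which the arrow is transported
to the whole of `M`. -/
lemma exists_eq_ofHom {M N : RObj C} {f : M ⟶ N} (hf : TotalHom f) :
    ∃ g : M.obj ⟶ N.obj, f = cls (PMap.ofHom M.total g) := by
  obtain ⟨p, rfl⟩ := cls_surj f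
  obtain ⟨e, h1, -⟩ := cls_eq_iff.1 hf
  exact ⟨e.inv ≫ p.arr, cls_eq_iff.2 ⟨e, h1, e.hom_inv_id_assoc _⟩⟩

lemma cls_comp_ofHom {M N P : RObj C} (p : PMap M.obj N.obj) (g : N.obj ⟶ P.obj) :
    (cls p : M ⟶ N) ≫ (cls (PMap.ofHom N.total g) : N ⟶ P) =
      cls ⟨p.dom, p.L_dom, p.arr ≫ g⟩ :=
  cls_comp (PMap.isComp_ofHom p N.total g)

/-- The partial morphism `L M ⟶ N` represented by a morphism `M ⟶ N`. -/
abbrev ofMap {M : C.carrier} {N : RObj C} (f : M ⟶ N.obj) : enlarge M ⟶ N :=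
  cls (M := enlarge M) ⟨M, rfl, f⟩

lemma rest_ofMap {M : C.carrier} {N : RObj C} (f : M ⟶ N.obj) :
    rest (ofMap f) = ofMap (N := enlarge M) (η M) :=
  congrArg cls (congrArg (PMap.mk M rfl) (LCat.incl_mk M f))

lemma ofMap_injective {M : C.carrier} {N : RObj C} {f g : M ⟶ N.obj} (h : ofMap f = ofMap g) :
    f = g := by
  obtain ⟨e, h1, h2⟩ := cls_eq_iff.1 h
  have := η_mono M
  rw [LCat.incl_mk, LCat.incl_mk] at h1
  have he : e.hom = 𝟙 M := (cancel_mono (η M)).1 (h1.trans (Category.id_comp _).symm)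
  rw [he] at h2
  exact h2.symm.trans (Category.id_comp _)

/-- With `ofMap_injective`, this identifies maps `M ⟶ N` in `C` with partial maps `L M ⟶ N` whose
domain is exactly `M`; universal properties pass between the two categories through it. -/
lemma exists_eq_ofMap {M : C.carrier} {N : RObj C} {f : enlarge M ⟶ N}
    (hf : rest f = ofMap (N := enlarge M) (η M)) : ∃ g : M ⟶ N.obj, f = ofMap g := by
  obtain ⟨p, rfl⟩ := cls_surj f
  obtain ⟨e, h1, -⟩ := cls_eq_iff.1 hf
  exact ⟨e.inv ≫ p.arr, cls_eq_iff.2 ⟨e, h1, e.hom_inv_id_assoc _⟩⟩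

lemma ofMap_comp_ofHom {M : C.carrier} {N P : RObj C} (f : M ⟶ N.obj) (g : N.obj ⟶ P.obj) :
    ofMap f ≫ (cls (PMap.ofHom N.total g) : N ⟶ P) = ofMap (f ≫ g) :=
  cls_comp_ofHom _ g

theorem isRestrictionTerminal_iff {T : RObj C} :
    RCat.IsRestrictionTerminal (X := C.toRestriction) T ↔ LCat.IsLocalTerminal T.obj := by
  constructor
  · rintro ⟨h1, h2⟩
    have key : ∀ M : C.carrier, ∃ t : L M ⟶ T.obj, ∀ f : M ⟶ T.obj, f = η M ≫ t := by
      intro M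
      obtain ⟨t, ht, -⟩ := h1 (enlarge M)
      obtain ⟨t, rfl⟩ := exists_eq_ofHom ht
      refine ⟨t, fun f => ofMap_injective ?_⟩
      -- The lax axiom, applied to `f` as a partial map on `L M` and to the identity of `T`, says
      -- that `f` is the restriction to `M` of the unique total map.
      have h := h2 (ofMap f) _ (𝟙 T) ht (rest_id T)
      exact (Category.comp_id (ofMap f)).symm.trans (h.trans
        ((congrArg (fun s => s ≫ _) (rest_ofMap f)).trans
          (ofMap_comp_ofHom (N := enlarge M) (η M) t)))
    choose t ht using key
    exact ⟨T.total, ⟨Limits.IsTerminal.ofUniqueHom (fun M => η M ≫ t M) ht⟩⟩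
  · rintro ⟨-, ⟨hT⟩⟩
    refine ⟨fun M => ⟨cls (PMap.ofHom M.total (hT.from M.obj)), total_cls_ofHom _, fun f hf => ?_⟩,
      fun {M N} f a b ha hb => ?_⟩
    · obtain ⟨g, rfl⟩ := exists_eq_ofHom hf
      rw [hT.hom_ext g (hT.from M.obj)]
    · obtain ⟨p, rfl⟩ := cls_surj (C := C) f
      obtain ⟨a, rfl⟩ := exists_eq_ofHom ha
      obtain ⟨b, rfl⟩ := exists_eq_ofHom hb
      refine (cls_comp_ofHom p b).trans (Eq.trans ?_ (cls_comp_ofHom p.restr a).symm)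
      exact congrArg cls (congrArg (PMap.mk p.dom p.L_dom) (hT.hom_ext _ _))

theorem isRestrictionProduct_of_isLimit {P M N : RObj C} {p : P.obj ⟶ M.obj} {q : P.obj ⟶ N.obj}
    (h : Nonempty (Limits.IsLimit (Limits.BinaryFan.mk p q))) :
    RCat.IsRestrictionProduct (X := C.toRestriction) (cls (PMap.ofHom P.total p) : P ⟶ M)
      (cls (PMap.ofHom P.total q) : P ⟶ N) := by
  refine ⟨total_cls_ofHom p, total_cls_ofHom q, fun {K} f g => ?_⟩
  obtain ⟨a, rfl⟩ := cls_surj (C := C) f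
  obtain ⟨b, rfl⟩ := cls_surj (C := C) g
  -- The domain of `r` is the intersection of the domains of `a` and `b`, on which both required
  -- components are defined. The pairing is formed there.
  obtain ⟨r, hr⟩ := PMap.exists_isComp a.restr b
  have hfg : rest (cls a : K ⟶ M) ≫ (cls b : K ⟶ N) = cls r := cls_comp hr
  obtain ⟨m, k, hpb, h1, h2⟩ := hr
  have hgf : rest (cls b : K ⟶ N) ≫ (cls a : K ⟶ M) = cls ⟨r.dom, r.L_dom, m ≫ a.arr⟩ :=
    cls_comp ⟨k, m, hpb.flip, hpb.w.symm.trans h1, rfl⟩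
  refine ⟨cls ⟨r.dom, r.L_dom, fanLift h (m ≫ a.arr) r.arr⟩, ⟨?_, ?_⟩, ?_⟩
  · refine (cls_comp_ofHom _ p).trans (Eq.trans ?_ hgf.symm)
    exact congrArg cls (congrArg (PMap.mk r.dom r.L_dom) (fanLift_fst h _ _))
  · refine (cls_comp_ofHom _ q).trans (Eq.trans ?_ hfg.symm)
    exact congrArg cls (congrArg (PMap.mk r.dom r.L_dom) (fanLift_snd h _ _))
  · rintro c ⟨hc1, hc2⟩
    obtain ⟨c, rfl⟩ := cls_surj (C := C) c
    obtain ⟨e, e1, e2⟩ := cls_eq_iff.1 ((cls_comp_ofHom c p).symm.trans (hc1.trans hgf))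
    obtain ⟨d, d1, d2⟩ := cls_eq_iff.1 ((cls_comp_ofHom c q).symm.trans (hc2.trans hfg))
    -- The two components of `c` give two identifications of its domain with the intersection; both
    -- lie over the same monomorphism, so they agree.
    have hed : e.hom = d.hom := (cancel_mono r.incl).1 (e1.trans d1.symm)
    refine cls_eq_iff.2 ⟨e, e1, fan_hom_ext h ?_ ?_⟩
    · exact (Category.assoc _ _ _).trans ((congrArg (fun t => e.hom ≫ t)
        (fanLift_fst h (m ≫ a.arr) r.arr)).trans e2)
    · exact (Category.assoc _ _ _).trans ((congrArg (fun t => e.hom ≫ t)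
        (fanLift_snd h (m ≫ a.arr) r.arr)).trans ((congrArg (fun t => t ≫ r.arr) hed).trans d2))

theorem isLimit_of_isRestrictionProduct {P M N : RObj C} {p : P.obj ⟶ M.obj} {q : P.obj ⟶ N.obj}
    (h : RCat.IsRestrictionProduct (X := C.toRestriction) (cls (PMap.ofHom P.total p) : P ⟶ M)
      (cls (PMap.ofHom P.total q) : P ⟶ N)) :
    Nonempty (Limits.IsLimit (Limits.BinaryFan.mk p q)) := by
  rw [nonempty_isLimit_binaryFan_iff]
  intro K f g
  obtain ⟨hp, hq, h⟩ := h
  obtain ⟨t, ⟨t1, t2⟩, hu⟩ := h (ofMap f) (ofMap g)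
  -- Both partial maps have domain `K`, so restricting either one to the domain of the other changes
  -- nothing.
  have hf : rest (ofMap g) ≫ ofMap f = ofMap f := by
    rw [rest_ofMap, ← rest_ofMap f, rest_comp_self]
  have hg : rest (ofMap f) ≫ ofMap g = ofMap g := by
    rw [rest_ofMap, ← rest_ofMap g, rest_comp_self]
  have ht : rest t = ofMap (N := enlarge K) (η K) := by
    have := rest_comp_total t hp
    rw [t1] at this
    exact this.symm.trans ((congrArg rest hf).trans (rest_ofMap f))
  obtain ⟨t, rfl⟩ := exists_eq_ofMap ht
  refine ⟨t, ⟨ofMap_injective ?_, ofMap_injective ?_⟩, fun s ⟨s1, s2⟩ => ofMap_injective ?_⟩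
  · exact (ofMap_comp_ofHom t p).symm.trans (t1.trans hf)
  · exact (ofMap_comp_ofHom t q).symm.trans (t2.trans hg)
  · exact hu _ ⟨(ofMap_comp_ofHom s p).trans ((congrArg ofMap s1).trans hf.symm),
      (ofMap_comp_ofHom s q).trans ((congrArg ofMap s2).trans hg.symm)⟩

end RObj

namespace LCat

variable {C D : LCat.{v, u}}

lemma isLocalProduct_of_total {P M N : C.carrier} (hP : IsTotalObj P) (hM : IsTotalObj M)
    (hN : IsTotalObj N) {p : P ⟶ M} {q : P ⟶ N}
    (h : Nonempty (Limits.IsLimit (Limits.BinaryFan.mk p q))) : IsLocalProduct p q := by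
  refine ⟨h, eqToHom hP.1 ≫ p ≫ eqToHom hM.1.symm, eqToHom hP.1 ≫ q ≫ eqToHom hN.1.symm,
    isLimit_binaryFan_of_iso h (eqToIso hP.1) (eqToIso hM.1.symm) (eqToIso hN.1.symm), ?_, ?_⟩
  · rw [hP.2, hM.2]
    simp
  · rw [hP.2, hN.2]
    simp

theorem isCartesian_toRestriction (h : IsCartesian C) : RCat.IsCartesian C.toRestriction := by
  obtain ⟨⟨T, hT⟩, hP⟩ := h
  refine ⟨⟨⟨T, hT.1⟩, RObj.isRestrictionTerminal_iff.2 hT⟩, fun M N => ?_⟩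
  obtain ⟨P, p, q, h⟩ := exists_total_products hP (RObj.obj M) (RObj.obj N)
  obtain ⟨hP, hl⟩ := h (RObj.total M) (RObj.total N)
  exact ⟨⟨P, hP⟩, _, _, RObj.isRestrictionProduct_of_isLimit (P := ⟨P, hP⟩) hl⟩

theorem preservesCartesian_toRestriction {F : LFunctor C D} (hF : PreservesCartesian F) :
    RCat.PreservesCartesian F.toRestriction := by
  refine ⟨fun T hT => RObj.isRestrictionTerminal_iff.2
    (hF.1 _ (RObj.isRestrictionTerminal_iff.1 hT)), fun {P M N} p q h => ?_⟩
  obtain ⟨p, rfl⟩ := RObj.exists_eq_ofHom (C := C) h.1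
  obtain ⟨q, rfl⟩ := RObj.exists_eq_ofHom (C := C) h.2.1
  have hl := isLocalProduct_of_total (RObj.total P) (RObj.total M) (RObj.total N)
    (RObj.isLimit_of_isRestrictionProduct h)
  exact RObj.isRestrictionProduct_of_isLimit (P := F.toRestrictionFunctor.obj P)
    (M := F.toRestrictionFunctor.obj M) (N := F.toRestrictionFunctor.obj N) (hF.2 p q hl).1

end LCat

/-! ### Cartesian structure of the local category of a restriction category -/

namespace LObj

variable {X : RCat.{v, u}}

lemma isLocalTerminal_mk {T : X.carrier} (hT : RCat.IsRestrictionTerminal T) :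
    LCat.IsLocalTerminal (C := X.toLocal) (LObj.mk T (𝟙 T) (rest_id T)) := by
  obtain ⟨h1, h2⟩ := hT
  choose t ht _ using h1
  refine ⟨LCat.isTotalObj_L (C := X.toLocal) (LObj.mk T (𝟙 T) (rest_id T)),
    ⟨Limits.IsTerminal.ofUniqueHom (fun P : LObj X => LHom.mk (P.idem ≫ t P.base)
      ((rest_comp_total _ (ht _)).trans P.rest_idem) (Category.comp_id _)) (fun P f => ?_)⟩⟩
  refine hom_ext ?_
  have h := h2 (LHom.hom (P := P) f) (t P.base) (𝟙 T) (ht _) (rest_id T)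
  exact (Category.comp_id _).symm.trans (h.trans
    (congrArg (fun s => s ≫ t P.base) (LHom.rest_hom (P := P) f)))

/-- A morphism `f` into the base is a morphism from `(A, rest f)` into the terminal object, so it is
determined by `rest f`. Both axioms then become comparisons of restrictions. -/
lemma isRestrictionTerminal_base {Q : LObj X} (hQ : LCat.IsLocalTerminal (C := X.toLocal) Q) :
    RCat.IsRestrictionTerminal Q.base := by
  obtain ⟨⟨h, -⟩, ⟨hT⟩⟩ := hQ
  obtain ⟨T, rfl⟩ : ∃ T : X.carrier, Q = LObj.mk T (𝟙 T) (rest_id T) := ⟨Q.base, h.symm⟩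
  have key : ∀ {A : X.carrier} (f g : A ⟶ T), rest f = rest g → f = g := fun {A} f g hfg =>
    congrArg LHom.hom (hT.hom_ext
      (LHom.mk f rfl (Category.comp_id f) : LObj.mk A (rest f) (rest_rest f) ⟶ LObj.mk T (𝟙 T) _)
      (LHom.mk g hfg.symm (Category.comp_id g)))
  refine ⟨fun A => ?_, fun {A B} f a b ha hb => key _ _ ?_⟩
  · have ht : TotalHom (LHom.hom (P := LObj.mk A (𝟙 A) (rest_id A))
        (Q := LObj.mk T (𝟙 T) (rest_id T)) (hT.from _)) := LHom.rest_hom _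
    exact ⟨_, ht, fun f hf => key _ _ (Eq.trans hf ht.symm)⟩
  · rw [rest_comp_total f hb, rest_comp_total _ ha, rest_rest]

/-- The hypothesis `hi` says that the idempotent of `P` is the part of the restriction product where
the first projection lands in `M` and the second in `N`. Two maps out of `K` have the same
restriction, so their pairing has exact components, and it lands in that part. -/
lemma isLimit_of_isRestrictionProduct {P M N : LObj X} {p : P ⟶ M} {q : P ⟶ N}
    {p' : P.base ⟶ M.base} {q' : P.base ⟶ N.base} (h : RCat.IsRestrictionProduct p' q')
    (hp : P.idem ≫ p' = LHom.hom p) (hq : P.idem ≫ q' = LHom.hom q)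
    (hi : P.idem = rest (p' ≫ M.idem) ≫ rest (q' ≫ N.idem)) :
    Nonempty (Limits.IsLimit (Limits.BinaryFan.mk p q)) := by
  rw [nonempty_isLimit_binaryFan_iff]
  intro K f g
  obtain ⟨tp, tq, h⟩ := h
  obtain ⟨t, ⟨t1, t2⟩, hu⟩ := h (LHom.hom f) (LHom.hom g)
  rw [LHom.rest_hom, idem_hom] at t1 t2
  simp only [LHom.rest_hom, idem_hom] at hu
  have ht : rest t = K.idem := by
    rw [← rest_comp_total t tp, t1, LHom.rest_hom]
  have h1 : t ≫ rest (p' ≫ M.idem) = t := by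
    rw [comp_rest, ← Category.assoc, t1, LHom.hom_idem, LHom.rest_hom, ← ht, rest_comp_self]
  have h2 : t ≫ rest (q' ≫ N.idem) = t := by
    rw [comp_rest, ← Category.assoc, t2, LHom.hom_idem, LHom.rest_hom, ← ht, rest_comp_self]
  have h3 : t ≫ P.idem = t := by
    rw [hi, ← Category.assoc, h1, h2]
  refine ⟨LHom.mk t ht h3, ⟨hom_ext ?_, hom_ext ?_⟩, fun s ⟨s1, s2⟩ => hom_ext (hu _ ⟨?_, ?_⟩)⟩
  · rw [comp_hom, ← hp, ← Category.assoc, h3, t1]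
  · rw [comp_hom, ← hq, ← Category.assoc, h3, t2]
  · rw [← s1, comp_hom, ← hp, ← Category.assoc, LHom.hom_idem]
  · rw [← s2, comp_hom, ← hq, ← Category.assoc, LHom.hom_idem]

/-- Call the right-hand side `c`. The maps `c ≫ p'` and `c ≫ q'` factor through the product `P` by a
map that uniqueness in the restriction product identifies with `c`, so `c ≫ P.idem = c`. Conversely
`P.idem ≫ c = P.idem`, since `p` and `q` land in `M` and `N`; the idempotents commute. -/
lemma idem_eq_of_isLimit {P M N : LObj X} {p : P ⟶ M} {q : P ⟶ N} {p' : P.base ⟶ M.base}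
    {q' : P.base ⟶ N.base} (h : Nonempty (Limits.IsLimit (Limits.BinaryFan.mk p q)))
    (hprod : RCat.IsRestrictionProduct p' q') (hp1 : P.idem ≫ p' = LHom.hom p)
    (hq1 : P.idem ≫ q' = LHom.hom q) : P.idem = rest (p' ≫ M.idem) ≫ rest (q' ≫ N.idem) := by
  rw [nonempty_isLimit_binaryFan_iff] at h
  obtain ⟨tp, tq, hu⟩ := id hprod
  obtain ⟨c, hc⟩ : ∃ c, c = rest (p' ≫ M.idem) ≫ rest (q' ≫ N.idem) := ⟨_, rfl⟩
  have hcr : rest c = c := by rw [hc, ← rest_rest_comp, rest_rest]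
  have hcc : c ≫ c = c := by
    have := RestrictionStructure.rest_idem c
    rwa [hcr] at this
  have hM : p' ≫ M.idem = rest (p' ≫ M.idem) ≫ p' := by
    rw [← comp_rest, M.rest_idem]
  have hN : q' ≫ N.idem = rest (q' ≫ N.idem) ≫ q' := by
    rw [← comp_rest, N.rest_idem]
  have hcM : c ≫ rest (p' ≫ M.idem) = c := by
    rw [hc, rest_comm, Category.assoc, RestrictionStructure.rest_idem]
  have hcN : c ≫ rest (q' ≫ N.idem) = c := by
    rw [hc, Category.assoc, RestrictionStructure.rest_idem]
  obtain ⟨t, ⟨t1, t2⟩, -⟩ := h (X := LObj.mk P.base c hcr)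
    (LHom.mk (c ≫ p') ((rest_comp_total c tp).trans hcr)
      (by rw [Category.assoc, hM, ← Category.assoc, hcM]))
    (LHom.mk (c ≫ q') ((rest_comp_total c tq).trans hcr)
      (by rw [Category.assoc, hN, ← Category.assoc, hcN]))
  have ht : LHom.hom t ≫ P.idem = LHom.hom t := LHom.hom_idem t
  have t1' : LHom.hom t ≫ LHom.hom p = c ≫ p' := congrArg LHom.hom t1
  have t2' : LHom.hom t ≫ LHom.hom q = c ≫ q' := congrArg LHom.hom t2
  rw [← hp1, ← Category.assoc, ht] at t1'
  rw [← hq1, ← Category.assoc, ht] at t2'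
  have htc : LHom.hom t = c := by
    have hu := hu (c ≫ p') (c ≫ q')
    rw [rest_comp_total c tp, rest_comp_total c tq, hcr, ← Category.assoc, ← Category.assoc,
      hcc] at hu
    exact hu.unique ⟨t1', t2'⟩ ⟨rfl, rfl⟩
  rw [htc] at ht
  have e1 : P.idem ≫ rest (p' ≫ M.idem) = P.idem := by
    rw [comp_rest, ← Category.assoc, hp1, LHom.hom_idem, LHom.rest_hom, idem_comp]
  have e2 : P.idem ≫ rest (q' ≫ N.idem) = P.idem := by
    rw [comp_rest, ← Category.assoc, hq1, LHom.hom_idem, LHom.rest_hom, idem_comp]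
  have e3 : P.idem ≫ c = P.idem := by rw [hc, ← Category.assoc, e1, e2]
  have e4 : c ≫ P.idem = P.idem ≫ c := by
    have := rest_comm c P.idem
    rwa [hcr, P.rest_idem] at this
  rw [← hc, ← ht, e4, e3]

/-- The product of the enlargements carries the restriction product. The right-hand side mentions
only restrictions, composites and a restriction product, so Cartesian restriction functors preserve
it, although they need not preserve arbitrary limits of the local category. -/
theorem isLocalProduct_iff {P M N : LObj X} {p : P ⟶ M} {q : P ⟶ N} :
    LCat.IsLocalProduct (C := X.toLocal) p q ↔ ∃ (p' : P.base ⟶ M.base) (q' : P.base ⟶ N.base),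
      RCat.IsRestrictionProduct p' q' ∧ P.idem ≫ p' = LHom.hom p ∧ P.idem ≫ q' = LHom.hom q ∧
        P.idem = rest (p' ≫ M.idem) ≫ rest (q' ≫ N.idem) := by
  constructor
  · rintro ⟨h, p', q', h', hp, hq⟩
    have h₀ : ∀ {K : LObj X} (f : K ⟶ M.enlarge) (g : K ⟶ N.enlarge),
        ∃! t : K ⟶ P.enlarge, t ≫ p' = f ∧ t ≫ q' = g :=
      (nonempty_isLimit_binaryFan_iff (C := LObj X) (P := P.enlarge) (M := M.enlarge)
        (N := N.enlarge) p' q').1 h'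
    obtain ⟨p', tp, _⟩ := p'
    obtain ⟨q', tq, _⟩ := q'
    have hp1 : P.idem ≫ p' = LHom.hom p := (congrArg LHom.hom hp).trans (LHom.hom_idem p)
    have hq1 : P.idem ≫ q' = LHom.hom q := (congrArg LHom.hom hq).trans (LHom.hom_idem q)
    have hprod : RCat.IsRestrictionProduct (X := X) p' q' := by
      refine ⟨tp, tq, fun {K} f g => ?_⟩
      have e1 : rest (rest g ≫ f) = rest f ≫ rest g := by rw [← rest_rest_comp, rest_comm]
      have e2 : rest (rest f ≫ g) = rest f ≫ rest g := by rw [← rest_rest_comp]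
      have e3 : rest (rest f ≫ rest g) = rest f ≫ rest g := by
        rw [← rest_rest_comp, rest_rest]
      -- `rest g ≫ f` and `rest f ≫ g` have the common restriction `rest f ≫ rest g`, so both are
      -- morphisms out of `K` with that idempotent.
      obtain ⟨t, ⟨t1, t2⟩, hu⟩ := h₀ (K := LObj.mk K (rest f ≫ rest g) e3)
        (LHom.mk (rest g ≫ f) e1 (Category.comp_id _))
        (LHom.mk (rest f ≫ g) e2 (Category.comp_id _))
      refine ⟨LHom.hom t, ⟨congrArg LHom.hom t1, congrArg LHom.hom t2⟩, fun s ⟨s1, s2⟩ => ?_⟩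
      have hs : rest s = rest f ≫ rest g := by rw [← e1, ← s1, rest_comp_total s tp]
      exact congrArg LHom.hom (hu (LHom.mk s hs (Category.comp_id s))
        ⟨hom_ext s1, hom_ext s2⟩)
    exact ⟨p', q', hprod, hp1, hq1, idem_eq_of_isLimit h hprod hp1 hq1⟩
  · rintro ⟨p', q', h, hp, hq, hi⟩
    refine ⟨isLimit_of_isRestrictionProduct h hp hq hi,
      (LHom.mk p' h.1 (Category.comp_id _) : P.enlarge ⟶ M.enlarge),
      (LHom.mk q' h.2.1 (Category.comp_id _) : P.enlarge ⟶ N.enlarge),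
      isLimit_of_isRestrictionProduct (X := X) h (Category.id_comp _) (Category.id_comp _) ?_,
      hom_ext (hp.trans (LHom.hom_idem p).symm), hom_ext (hq.trans (LHom.hom_idem q).symm)⟩
    have h1 : rest p' = 𝟙 _ := h.1
    have h2 : rest q' = 𝟙 _ := h.2.1
    change 𝟙 P.base = rest (p' ≫ 𝟙 _) ≫ rest (q' ≫ 𝟙 _)
    rw [Category.comp_id, Category.comp_id, h1, h2, Category.comp_id]

end LObj

namespace RCat

variable {X Y : RCat.{v, u}}

theorem isCartesian_toLocal (h : IsCartesian X) : LCat.IsCartesian X.toLocal := by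
  obtain ⟨⟨T, hT⟩, hP⟩ := h
  refine ⟨⟨_, LObj.isLocalTerminal_mk hT⟩, fun (M N : LObj X) => ?_⟩
  obtain ⟨P, p, q, h⟩ := hP M.base N.base
  -- The idempotent that `LObj.isLocalProduct_iff` forces on any local product of `M` and `N` over
  -- this restriction product.
  obtain ⟨c, hc⟩ : ∃ c, c = rest (p ≫ M.idem) ≫ rest (q ≫ N.idem) := ⟨_, rfl⟩
  have hcr : rest c = c := by rw [hc, ← rest_rest_comp, rest_rest]
  have hM : p ≫ M.idem = rest (p ≫ M.idem) ≫ p := by rw [← comp_rest, M.rest_idem]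
  have hN : q ≫ N.idem = rest (q ≫ N.idem) ≫ q := by rw [← comp_rest, N.rest_idem]
  have hcM : c ≫ rest (p ≫ M.idem) = c := by
    rw [hc, rest_comm, Category.assoc, RestrictionStructure.rest_idem]
  have hcN : c ≫ rest (q ≫ N.idem) = c := by
    rw [hc, Category.assoc, RestrictionStructure.rest_idem]
  exact ⟨LObj.mk P c hcr,
    LHom.mk (c ≫ p) ((rest_comp_total c h.1).trans hcr)
      (by rw [Category.assoc, hM, ← Category.assoc, hcM]),
    LHom.mk (c ≫ q) ((rest_comp_total c h.2.1).trans hcr)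
      (by rw [Category.assoc, hN, ← Category.assoc, hcN]),
    LObj.isLocalProduct_iff.2 ⟨p, q, h, rfl, rfl, hc⟩⟩

theorem preservesCartesian_toLocal {F : RFunctor X Y} (hF : PreservesCartesian F) :
    LCat.PreservesCartesian F.toLocal := by
  constructor
  · intro (Q : LObj X) hQ
    have h := LObj.isLocalTerminal_mk (hF.1 _ (LObj.isRestrictionTerminal_base hQ))
    obtain ⟨⟨h', -⟩, -⟩ := hQ
    obtain ⟨T, rfl⟩ : ∃ T : X.carrier, Q = LObj.mk T (𝟙 T) (rest_id T) := ⟨Q.base, h'.symm⟩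
    have e : F.toLocalFunctor.obj (LObj.mk T (𝟙 T) (rest_id T)) =
        LObj.mk (F.obj T) (𝟙 (F.obj T)) (rest_id _) := LObj.ext rfl (heq_of_eq (F.map_id T))
    exact e ▸ h
  · intro P M N p q h
    obtain ⟨p', q', h, hp, hq, hi⟩ := LObj.isLocalProduct_iff.1 h
    refine LObj.isLocalProduct_iff.2 ⟨F.map p', F.map q', hF.2 _ _ h,
      (F.map_comp _ _).symm.trans (congrArg F.map hp),
      (F.map_comp _ _).symm.trans (congrArg F.map hq), ?_⟩
    refine (congrArg F.map hi).trans ?_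
    rw [F.map_comp, F.map_rest, F.map_rest, F.map_comp, F.map_comp]
    rfl

/-- A faithful restriction functor reflects totality. With fullness and strict surjectivity on
objects, every test object and test morphism in `Y` comes from `X`, where the universal property is
known. -/
lemma preservesCartesian_of_surjective (F : RFunctor X Y) [F.toFunctor.Full]
    [F.toFunctor.Faithful] (hF : ∀ B, ∃ A, F.obj A = B) : PreservesCartesian F := by
  have htot : ∀ {A B : X.carrier} {f : A ⟶ B}, TotalHom (F.map f) → TotalHom f :=
    fun {A B f} hf => F.toFunctor.map_injective (by
      rw [F.map_rest, F.map_id]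
      exact hf)
  constructor
  · rintro T ⟨h1, h2⟩
    refine ⟨fun B => ?_, fun {A B} f a b ha hb => ?_⟩
    · obtain ⟨A, rfl⟩ := hF B
      obtain ⟨t, ht, hu⟩ := h1 A
      refine ⟨F.map t, RFunctor_total F ht, fun s hs => ?_⟩
      obtain ⟨s, rfl⟩ := F.toFunctor.map_surjective s
      rw [hu s (htot hs)]
    · obtain ⟨A, rfl⟩ := hF A
      obtain ⟨B, rfl⟩ := hF B
      obtain ⟨f, rfl⟩ := F.toFunctor.map_surjective f
      obtain ⟨a, rfl⟩ := F.toFunctor.map_surjective a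
      obtain ⟨b, rfl⟩ := F.toFunctor.map_surjective b
      rw [← F.map_comp, h2 f a b (htot ha) (htot hb), F.map_comp, F.map_rest]
  · rintro P A B p q ⟨hp, hq, h⟩
    refine ⟨RFunctor_total F hp, RFunctor_total F hq, fun {K} f g => ?_⟩
    obtain ⟨K, rfl⟩ := hF K
    obtain ⟨f, rfl⟩ := F.toFunctor.map_surjective f
    obtain ⟨g, rfl⟩ := F.toFunctor.map_surjective g
    obtain ⟨t, ⟨t1, t2⟩, hu⟩ := h f g
    refine ⟨F.map t, ⟨?_, ?_⟩, fun s ⟨s1, s2⟩ => ?_⟩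
    · rw [← F.map_comp, t1, F.map_comp, F.map_rest]
    · rw [← F.map_comp, t2, F.map_comp, F.map_rest]
    · obtain ⟨s, rfl⟩ := F.toFunctor.map_surjective s
      rw [← F.map_rest, ← F.map_comp, ← F.map_comp] at s1 s2
      rw [hu s ⟨F.toFunctor.map_injective s1, F.toFunctor.map_injective s2⟩]

lemma preservesCartesian_of_inverse {F : RFunctor X Y} {G : RFunctor Y X}
    (h : compR F G = idR X) (h' : compR G F = idR Y) : PreservesCartesian F := by
  have e : F.toFunctor ⋙ G.toFunctor = 𝟭 _ := congrArg RFunctor.toFunctor h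
  have e' : G.toFunctor ⋙ F.toFunctor = 𝟭 _ := congrArg RFunctor.toFunctor h'
  have : F.toFunctor.IsEquivalence :=
    Functor.IsEquivalence.mk' G.toFunctor (eqToIso e.symm) (eqToIso e')
  exact preservesCartesian_of_surjective F fun B => ⟨G.obj B, Functor.congr_obj e' B⟩

end RCat

/-! ### Restriction of the 2-equivalence to Cartesian objects -/

lemma toRestriction2_mapsTo_cartesian :
    SubTwoCat.MapsTo toRestriction2.{u, u} LCat.cartesian RCat.cartesian where
  obj h := LCat.isCartesian_toRestriction h
  hom _ _ h := LCat.preservesCartesian_toRestriction h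

lemma toLocal2_mapsTo_cartesian :
    SubTwoCat.MapsTo toLocal2.{u, u} RCat.cartesian LCat.cartesian where
  obj h := RCat.isCartesian_toLocal h
  hom _ _ h := RCat.preservesCartesian_toLocal h

/-! ### Restricting a 2-equivalence to locally full 2-subcategories -/

namespace TwoEquivalence

open SubTwoCat

universe w₁ w₂ v₁ v₂ u₁ u₂

variable {B : Type u₁} [Bicategory.{w₁, v₁} B] {C : Type u₂} [Bicategory.{w₂, v₂} C]
  [Bicategory.Strict B] [Bicategory.Strict C] {S : SubTwoCat B} {T : SubTwoCat C}
  {F : StrictPseudofunctor B C} {G : StrictPseudofunctor C B}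

/-- A 2-equivalence restricts to 2-subcategories that are preserved by the 2-functors and contain
the components of the unit and the counit together with their pseudo-inverses. -/
def restrict (e : TwoEquivalence F G) (hF : MapsTo F S T) (hG : MapsTo G T S)
    (hu : ∀ b, S.IsHom (e.unit.app b)) (hc : ∀ c, T.IsHom (e.counit.app c))
    (hu' : ∀ b, ∃ g : G.obj (F.obj b) ⟶ b, S.IsHom g ∧ Nonempty (e.unit.app b ≫ g ≅ 𝟙 b) ∧
      Nonempty (g ≫ e.unit.app b ≅ 𝟙 (G.obj (F.obj b))))
    (hc' : ∀ c, ∃ g : c ⟶ F.obj (G.obj c), T.IsHom g ∧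
      Nonempty (e.counit.app c ≫ g ≅ 𝟙 (F.obj (G.obj c))) ∧
      Nonempty (g ≫ e.counit.app c ≅ 𝟙 c)) :
    TwoEquivalence (SubTwoCat.restrict F hF) (SubTwoCat.restrict G hG) where
  unit :=
    { app := fun b => ⟨e.unit.app b.obj, hu b.obj⟩
      naturality := fun f => Hom.ext (e.unit.naturality f.hom)
      naturality₂ := fun {_ _ f g} α => by
        have h := e.unit.naturality₂ (f := f.hom) (g := g.hom) α
        rw [eqToHom_eq, eqToHom_eq]
        exact h }
  counit :=
    { app := fun c => ⟨e.counit.app c.obj, hc c.obj⟩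
      naturality := fun f => Hom.ext (e.counit.naturality f.hom)
      naturality₂ := fun {_ _ f g} α => by
        have h := e.counit.naturality₂ (f := f.hom) (g := g.hom) α
        rw [eqToHom_eq, eqToHom_eq]
        exact h }
  left_triangle b := Hom.ext (e.left_triangle b.obj)
  right_triangle c := Hom.ext (e.right_triangle c.obj)
  unit_equivalence b := by
    obtain ⟨g, h, h1, h2⟩ := hu' b.obj
    exact ⟨⟨g, h⟩, h1.map isoMk, h2.map isoMk⟩
  counit_equivalence c := by
    obtain ⟨g, h, h1, h2⟩ := hc' c.obj
    exact ⟨⟨g, h⟩, h1.map isoMk, h2.map isoMk⟩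

end TwoEquivalence

/-- Cartesian local categories and Cartesian restriction categories form 2-equivalent
2-categories. -/
noncomputable def cartesianTwoEquivalence :
    TwoEquivalence (SubTwoCat.restrict toRestriction2.{u, u} toRestriction2_mapsTo_cartesian)
      (SubTwoCat.restrict toLocal2.{u, u} toLocal2_mapsTo_cartesian) :=
  twoEquivalence.restrict _ _
    (fun C => LCat.preservesCartesian_of_isEquivalence (LCat.unit C))
    (fun X => RCat.preservesCartesian_of_inverse (RCat.counit_comp_counitInv X)
      (RCat.counitInv_comp_counit X))
    (fun C => by
      obtain ⟨g, h1, h2⟩ := LCat.isEquivalenceCell_unit C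
      -- The pseudo-inverse of the unit is itself an equivalence of underlying categories, so it too
      -- preserves the Cartesian structure and lies in the 2-subcategory.
      have := LCat.toFunctor_isEquivalence h2 h1
      exact ⟨g, LCat.preservesCartesian_of_isEquivalence g, h1, h2⟩)
    (fun X => ⟨RCat.counitInv X, RCat.preservesCartesian_of_inverse (RCat.counitInv_comp_counit X)
      (RCat.counit_comp_counitInv X), ⟨eqToIso (RCat.counit_comp_counitInv X)⟩,
      ⟨eqToIso (RCat.counitInv_comp_counit X)⟩⟩)

lemma isIsoCell_counit_cartesianTwoEquivalence (X : RCat.cartesian.{u, u}.Obj) :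
    IsIsoCell (cartesianTwoEquivalence.counit.app X) :=
  ⟨⟨RCat.counitInv X.obj, RCat.preservesCartesian_of_inverse
    (RCat.counitInv_comp_counit X.obj) (RCat.counit_comp_counitInv X.obj)⟩,
    SubTwoCat.Hom.ext (RCat.counit_comp_counitInv X.obj),
    SubTwoCat.Hom.ext (RCat.counitInv_comp_counit X.obj)⟩

theorem mainTheorem6 :
    HasFiniteTwoProducts LCat.{v, w} ∧
    (∀ C : LCat.{v, w}, IsCartesianObject C ↔ LCat.IsCartesian C) ∧
    ∃ (hR : SubTwoCat.MapsTo toRestriction2.{u, u} LCat.cartesian RCat.cartesian)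
      (hL : SubTwoCat.MapsTo toLocal2.{u, u} RCat.cartesian LCat.cartesian)
      (e : TwoEquivalence toRestriction2.{u, u} toLocal2.{u, u})
      (e' : TwoEquivalence (SubTwoCat.restrict toRestriction2.{u, u} hR)
        (SubTwoCat.restrict toLocal2.{u, u} hL)),
      (∀ C, (e'.unit.app C).hom = e.unit.app C.obj) ∧
      (∀ X, (e'.counit.app X).hom = e.counit.app X.obj) ∧
      (∀ X, IsIsoCell (e.counit.app X)) ∧
      (∀ X, IsIsoCell (e'.counit.app X)) :=
  ⟨LCat.hasFiniteTwoProducts, LCat.isCartesianObject_iff, toRestriction2_mapsTo_cartesian,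
    toLocal2_mapsTo_cartesian, twoEquivalence, cartesianTwoEquivalence, fun _ => rfl,
    fun _ => rfl, RCat.isIsoCell_counit, isIsoCell_counit_cartesianTwoEquivalence⟩
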